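/- Setting. Let $p\ge 0$ be an integer and $r$ an integer with $-1\le r\le p-1$. A $p$-open knot vector is a sequence $\Xi=(\xi_1\le\dots\le\xi_{n+p+1})$ in which exactly the first $p+1$ knots equal $0$ and exactly the last $p+1$ knots equal $1$; it has regularity $r$ if every knot in $(0,1)$ has multiplicity at most $p-r$. Let $\widehat B_{j,p}$ ($1\le j\le n$) be the B-splines of degree $p$ on $\Xi$ given by the Cox–de Boor recursion (with $\widehat B_{j,0}=1_{[\xi_j,\xi_{j+1})}$ and $0/0=0$), and $S_p^r=\mathrm{span}\{\widehat B_{1,p},\dots,\widehat B_{n,p}\}$. For $k=1,2$, $S_{p-k}^{r-k}$ is the span of the B-splines of degree $p-k$ on the knot vector obtained from $\Xi$ by deleting the first $k$ and the last $k$ knots. An element is an interval $I=(\xi_i,\xi_{i+1})\neq\emptyset$, and $\tilde I=(\xi_{i-p},\xi_{i+p+1})$ is its support extension. The mesh is regular with constant $c_u$ if $\max_{J}|J|\le c_u|I|$ for all elements $I$, the maximum being over all elements $J$. $H^l$ denotes the Sobolev space of functions with weak derivatives up to order $l$ in $L^2$, and $|v|_{H^l}$ is the $L^2$-norm of the $l$-th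 weak derivative. Projections. Let $g_p(x)=\int_{-1}^{x}B^*$, where $B^*$ is the B-spline of degree $p$ on the knots $\cos\frac{(p+1-j)\pi}{p+1}$, $0\le j\le p+1$, scaled so that $\int B^*=1$, and put $$\psi_j(x)=g_p\Big(\frac{2x-\xi_j-\xi_{j+p+1}}{\xi_{j+p+1}-\xi_j}\Big)\,\frac{1}{p!}\prod_{k=1}^{p}(x-\xi_{j+k}),\qquad \lambda_j^p(v)=\int_{\xi_j}^{\xi_{j+p+1}}v\,\psi_j^{(p+1)}\,dx .$$ For $v\in L^2((0,1))$ define $\widehat\Pi_p v=\sum_{j=1}^n\lambda_j^p(v)\widehat B_{j,p}$; if $r\ge0$, $\widehat\Pi^{c,1}_{p-1}v=\frac{d}{d\zeta}\widehat\Pi_p\int_0^\zeta v(\tau)\,d\tau$; and if $r\ge1$, $\widehat\Pi^{c,2}_{p-2}v=\frac{d^2}{d\zeta^2}\widehat\Pi_p\int_0^\zeta\int_0^\tau v(s)\,ds\,d\tau=\frac{d}{d\zeta}\widehat\Pi^{c,1}_{p-1}\int_0^\zeta v(\tau)\,d\tau$. Functions on $(0,1)$ are identified if they agree almost everywhere.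 Lemma. For every $p$-open knot vector of regularity $r$: (1) $\widehat\Pi_p$ maps $L^2((0,1))$ into $S_p^r$ and $\widehat\Pi_p s=s$ for all $s\in S_p^r$. (2) If $r\ge 0$, then $\widehat\Pi^{c,1}_{p-1}$ maps $L^2((0,1))$ into $S_{p-1}^{r-1}$, $\widehat\Pi^{c,1}_{p-1}s=s$ for all $s\in S_{p-1}^{r-1}$, and $\widehat\Pi^{c,1}_{p-1}\partial_\zeta v=\partial_\zeta\widehat\Pi_p v$ for all $v\in H^1((0,1))$. (3) If $r\ge 1$, then $\widehat\Pi^{c,2}_{p-2}$ maps $L^2((0,1))$ into $S_{p-2}^{r-2}$, $\widehat\Pi^{c,2}_{p-2}s=s$ for all $s\in S_{p-2}^{r-2}$, and $\widehat\Pi^{c,2}_{p-2}\partial_\zeta^2 v=\partial_\zeta^2\widehat\Pi_p v=\partial_\zeta\widehat\Pi^{c,1}_{p-1}\partial_\zeta v$ for all $v\in H^2((0,1))$. In (2) and (3) the derivatives of the projected functions are both classical derivatives almost everywhere and weak derivatives on $(0,1)$. (4) For every $c_u$ there is a constant $C$, depending only on $p$, $r$ and $c_u$, such that for every $p$-open knot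 vector of regularity $r$ whose mesh is regular with constant $c_u$, and every element $I$, $$|\widehat\Pi_p v|_{H^l(I)}\le C|v|_{H^l(\tilde I)}\quad\text{for all }v\in H^l((0,1)),\ 0\le l\le p+1,$$ $$|\widehat\Pi^{c,1}_{p-1} v|_{H^l(I)}\le C|v|_{H^l(\tilde I)}\quad\text{for all }v\in H^l((0,1)),\ 0\le l\le p,\ \text{ if } r\ge0,$$ $$|\widehat\Pi^{c,2}_{p-2} v|_{H^l(I)}\le C|v|_{H^l(\tilde I)}\quad\text{for all }v\in H^l((0,1)),\ 0\le l\le p-1,\ \text{ if } r\ge1 .$$ -/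

import Mathlib

open MeasureTheory Set

open scoped ENNReal NNReal ContDiff

namespace UnivariateSpline

noncomputable section

/-! ### B-splines and spline spaces

Knots are indexed from `0`: a knot vector of degree `p` with `n` basis functions consists of the
`n + p + 1` values `ξ 0, …, ξ (n + p)`; the values of `ξ` beyond `n + p` are never used. -/

/-- The B-spline `B_{j,p}` by the Cox–de Boor recursion. Division by zero yields zero, which is the
usual convention `0 / 0 = 0`. -/
def bspline (ξ : ℕ → ℝ) : ℕ → ℕ → ℝ → ℝ
  | 0, j, x => (Ico (ξ j) (ξ (j + 1))).indicator (fun _ => 1) x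
  | p + 1, j, x =>
      (x - ξ j) / (ξ (j + p + 1) - ξ j) * bspline ξ p j x
        + (ξ (j + p + 2) - x) / (ξ (j + p + 2) - ξ (j + 1)) * bspline ξ p (j + 1) x

/-- The span of the B-splines `B_{0,p}, …, B_{n-1,p}`. -/
def splineSpace (ξ : ℕ → ℝ) (p n : ℕ) : Submodule ℝ (ℝ → ℝ) :=
  Submodule.span ℝ {f | ∃ j < n, f = bspline ξ p j}

/-- The spline space `S_{p-k}^{r-k}` belonging to `S_p^r`: it is generated by the B-splines of
degree `p - k` on the knot vector from which the first `k` and the last `k` knots are removed. -/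
def reducedSplineSpace (k : ℕ) (ξ : ℕ → ℝ) (p n : ℕ) : Submodule ℝ (ℝ → ℝ) :=
  splineSpace (fun j => ξ (j + k)) (p - k) (n - k)

/-- The knots `ξ 0 ≤ … ≤ ξ (n + p)` form a `p`-open knot vector of `[0,1]`: exactly the first
`p + 1` knots are `0` and exactly the last `p + 1` knots are `1`. -/
structure IsOpenKnotVector (p n : ℕ) (ξ : ℕ → ℝ) : Prop where
  mono : ∀ i j, i ≤ j → j ≤ n + p → ξ i ≤ ξ j
  eq_zero : ∀ j, j ≤ p → ξ j = 0
  pos : ∀ j, p < j → j ≤ n + p → 0 < ξ j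
  lt_one : ∀ j, j < n → ξ j < 1
  eq_one : ∀ j, n ≤ j → j ≤ n + p → ξ j = 1

/-- The multiplicity `m(x)` of the value `x` in the knot vector. -/
def multiplicity (p n : ℕ) (ξ : ℕ → ℝ) (x : ℝ) : ℕ :=
  Set.ncard {k : ℕ | k ≤ n + p ∧ ξ k = x}

/-- Regularity `r`: every internal knot has multiplicity at most `p - r`. -/
def HasRegularity (p n : ℕ) (ξ : ℕ → ℝ) (r : ℤ) : Prop :=
  ∀ j, j ≤ n + p → 0 < ξ j → ξ j < 1 → (multiplicity p n ξ (ξ j) : ℤ) ≤ (p : ℤ) - r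

/-- `i` is the index of a mesh element `(ξ i, ξ (i + 1))`. -/
def IsElement (p n : ℕ) (ξ : ℕ → ℝ) (i : ℕ) : Prop :=
  i + 1 ≤ n + p ∧ ξ i < ξ (i + 1)

/-- The element `I = (ξ i, ξ (i + 1))`. -/
def element (ξ : ℕ → ℝ) (i : ℕ) : Set ℝ := Ioo (ξ i) (ξ (i + 1))

/-- The support extension `(ξ (i - p), ξ (i + p + 1))` of the element with index `i`
(for an element of a `p`-open knot vector one always has `p ≤ i < n`). -/
def supportExtension (ξ : ℕ → ℝ) (p i : ℕ) : Set ℝ := Ioo (ξ (i - p)) (ξ (i + p + 1))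

/-- The mesh size, i.e. the maximal length of an element. -/
def meshSize (p n : ℕ) (ξ : ℕ → ℝ) : ℝ := ⨆ i : Fin (n + p), (ξ (i + 1) - ξ i)

/-- The regular mesh condition `h ≤ c * h_I` for all elements `I`. -/
def IsRegularMesh (c : ℝ) (p n : ℕ) (ξ : ℕ → ℝ) : Prop :=
  ∀ i, IsElement p n ξ i → meshSize p n ξ ≤ c * (ξ (i + 1) - ξ i)

/-! ### The dual functionals and the projections -/

/-- The Chebyshev knots `cos ((p + 1 - j) π / (p + 1))`, `0 ≤ j ≤ p + 1`, in `[-1, 1]`. -/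
def perfectKnot (p j : ℕ) : ℝ := Real.cos (((p : ℝ) + 1 - j) * Real.pi / ((p : ℝ) + 1))

/-- The transition function from `0` (left of `-1`) to `1` (right of `1`): the antiderivative of the
perfect B-spline of degree `p`, normalized to have integral one. -/
def transition (p : ℕ) (x : ℝ) : ℝ :=
  ∫ t in (-1 : ℝ)..x, ((p : ℝ) + 1) / 2 * bspline (perfectKnot p) p 0 t

/-- `ψ_j(x) = G_j(x) φ_j(x)` with `φ_j(x) = (x - ξ_{j+1}) ⋯ (x - ξ_{j+p}) / p!` and
`G_j(x) = g ((2 x - ξ_j - ξ_{j+p+1}) / (ξ_{j+p+1} - ξ_j))`, `g` the transition function. -/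
def dualKernel (ξ : ℕ → ℝ) (p j : ℕ) (x : ℝ) : ℝ :=
  transition p ((2 * x - ξ j - ξ (j + p + 1)) / (ξ (j + p + 1) - ξ j))
    * ((∏ k ∈ Finset.Icc 1 p, (x - ξ (j + k))) / (p.factorial : ℝ))

/-- The dual functional `λ_j^p(v) = ∫_{ξ_j}^{ξ_{j+p+1}} v D^{p+1} ψ_j`. The function `ψ_j` is `C^p`
and piecewise polynomial, so that its classical derivative of order `p + 1` exists off a finite
set. -/
def dualFunctional (ξ : ℕ → ℝ) (p j : ℕ) (v : ℝ → ℝ) : ℝ :=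
  ∫ x in (ξ j)..(ξ (j + p + 1)), v x * iteratedDeriv (p + 1) (dualKernel ξ p j) x

/-- The projection `Π_p v = ∑_j λ_j^p(v) B_{j,p}`. -/
def proj (ξ : ℕ → ℝ) (p n : ℕ) (v : ℝ → ℝ) : ℝ → ℝ := fun x =>
  ∑ j ∈ Finset.range n, dualFunctional ξ p j v * bspline ξ p j x

/-- The antiderivative `ζ ↦ ∫_0^ζ v`. -/
def antideriv (v : ℝ → ℝ) : ℝ → ℝ := fun x => ∫ t in (0 : ℝ)..x, v t

/-- The projection `Π^{c,1}_{p-1} v = d/dζ Π_p ∫_0^ζ v`. -/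
def projC1 (ξ : ℕ → ℝ) (p n : ℕ) (v : ℝ → ℝ) : ℝ → ℝ :=
  deriv (proj ξ p n (antideriv v))

/-- The projection `Π^{c,2}_{p-2} v = d/dζ Π^{c,1}_{p-1} ∫_0^ζ v = d²/dζ² Π_p ∫_0^ζ ∫_0^τ v`. -/
def projC2 (ξ : ℕ → ℝ) (p n : ℕ) (v : ℝ → ℝ) : ℝ → ℝ :=
  deriv (deriv (proj ξ p n (antideriv (antideriv v))))

/-! ### Sobolev spaces -/

/-- `g` is the weak derivative of order `k` of `v` on the open set `Ω`. -/
def HasWeakDeriv (Ω : Set ℝ) (k : ℕ) (v g : ℝ → ℝ) : Prop :=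
  LocallyIntegrableOn v Ω ∧ LocallyIntegrableOn g Ω ∧
    ∀ φ : ℝ → ℝ, ContDiff ℝ ∞ φ → HasCompactSupport φ → tsupport φ ⊆ Ω →
      ∫ x in Ω, v x * iteratedDeriv k φ x = (-1) ^ k * ∫ x in Ω, g x * φ x

/-- `v ∈ H^l(Ω)`: all weak derivatives of order at most `l` exist and are in `L²(Ω)`. -/
def MemSobolev (Ω : Set ℝ) (l : ℕ) (v : ℝ → ℝ) : Prop :=
  ∀ k ≤ l, ∃ g, HasWeakDeriv Ω k v g ∧ MemLp g 2 (volume.restrict Ω)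

/-- The seminorm `|v|_{H^l(Ω)}`: the `L²(Ω)`-norm of the weak derivative of order `l` (which is
unique almost everywhere), and `∞` if there is no such derivative. -/
def sobolevSeminorm (Ω : Set ℝ) (l : ℕ) (v : ℝ → ℝ) : ℝ≥0∞ :=
  ⨅ (g : ℝ → ℝ) (_ : HasWeakDeriv Ω l v g), eLpNorm g 2 (volume.restrict Ω)

end

end UnivariateSpline

namespace UnivariateSpline

/-- The knots with indices between `a` and `b` are sorted. -/
def SortedKnots (ξ : ℕ → ℝ) (a b : ℕ) : Prop :=
  ∀ ⦃k l : ℕ⦄, a ≤ k → k ≤ l → l ≤ b → ξ k ≤ ξ l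

lemma SortedKnots.mono {ξ : ℕ → ℝ} {a b a' b' : ℕ} (h : SortedKnots ξ a b) (ha : a ≤ a')
    (hb : b' ≤ b) : SortedKnots ξ a' b' :=
  fun _ _ h1 h2 h3 => h (ha.trans h1) h2 (h3.trans hb)

lemma bspline_zero (ξ : ℕ → ℝ) (j : ℕ) (x : ℝ) :
    bspline ξ 0 j x = (Ico (ξ j) (ξ (j + 1))).indicator (fun _ => 1) x := rfl

lemma bspline_succ (ξ : ℕ → ℝ) (p j : ℕ) (x : ℝ) :
    bspline ξ (p + 1) j x = (x - ξ j) / (ξ (j + p + 1) - ξ j) * bspline ξ p j x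
      + (ξ (j + p + 2) - x) / (ξ (j + p + 2) - ξ (j + 1)) * bspline ξ p (j + 1) x := rfl

lemma bspline_shift (ξ : ℕ → ℝ) (k p j : ℕ) :
    bspline (fun i => ξ (i + k)) p j = bspline ξ p (j + k) := by
  induction p generalizing j with
  | zero =>
    funext x
    rw [bspline_zero, bspline_zero, Nat.add_right_comm j 1 k]
  | succ p ih =>
    funext x
    rw [bspline_succ, bspline_succ, ih, ih, Nat.add_right_comm j 1 k]
    simp only [show j + p + 1 + k = j + k + p + 1 by omega,
      show j + p + 2 + k = j + k + p + 2 by omega]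

lemma measurable_bspline (ξ : ℕ → ℝ) (p j : ℕ) : Measurable (bspline ξ p j) := by
  induction p generalizing j with
  | zero => exact measurable_const.indicator measurableSet_Ico
  | succ p ih =>
    have h1 := ih j
    have h2 := ih (j + 1)
    change Measurable fun x => _
    simp only [bspline_succ]
    fun_prop

lemma bspline_eq_zero_of_lt {ξ : ℕ → ℝ} {p j : ℕ} (h : SortedKnots ξ j (j + p + 1)) {x : ℝ}
    (hx : x < ξ j) : bspline ξ p j x = 0 := by
  induction p generalizing j with
  | zero => simp [bspline_zero, hx]
  | succ p ih =>
    rw [bspline_succ, ih (h.mono le_rfl (by omega)) hx,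
      ih (h.mono (by omega) (by omega)) (hx.trans_le (h le_rfl (by omega) (by omega)))]
    simp

lemma bspline_eq_zero_of_ge {ξ : ℕ → ℝ} {p j : ℕ} (h : SortedKnots ξ j (j + p + 1)) {x : ℝ}
    (hx : ξ (j + p + 1) ≤ x) : bspline ξ p j x = 0 := by
  induction p generalizing j with
  | zero => simp only [bspline_zero]; rw [indicator_of_notMem]; simpa using fun _ => hx
  | succ p ih =>
    rw [bspline_succ, ih (h.mono le_rfl (by omega)) ((h (by omega) (by omega) (by omega)).trans hx),
      ih (h.mono (by omega) (by omega)) (by rwa [show j + 1 + p + 1 = j + (p + 1) + 1 by omega])]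
    simp

lemma bspline_eq_zero_of_eq {ξ : ℕ → ℝ} {p j : ℕ} (h : SortedKnots ξ j (j + p + 1))
    (he : ξ j = ξ (j + p + 1)) (x : ℝ) : bspline ξ p j x = 0 := by
  rcases lt_or_ge x (ξ j) with hx | hx
  · exact bspline_eq_zero_of_lt h hx
  · exact bspline_eq_zero_of_ge h (he ▸ hx)

lemma mem_Ico_of_bspline_ne_zero {ξ : ℕ → ℝ} {p j : ℕ} (h : SortedKnots ξ j (j + p + 1)) {x : ℝ}
    (hx : bspline ξ p j x ≠ 0) : x ∈ Ico (ξ j) (ξ (j + p + 1)) := by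
  constructor
  · by_contra! hc; exact hx (bspline_eq_zero_of_lt h hc)
  · by_contra! hc; exact hx (bspline_eq_zero_of_ge h hc)

lemma abs_bspline_le {ξ : ℕ → ℝ} {p j : ℕ} (h : SortedKnots ξ j (j + p + 1)) (x : ℝ) :
    |bspline ξ p j x| ≤ 2 ^ p := by
  induction p generalizing j with
  | zero =>
    rw [bspline_zero]
    by_cases hx : x ∈ Ico (ξ j) (ξ (j + 1)) <;> simp [hx]
  | succ p ih =>
    have h1 : SortedKnots ξ j (j + p + 1) := h.mono le_rfl (by omega)
    have h2 : SortedKnots ξ (j + 1) (j + 1 + p + 1) := h.mono (by omega) (by omega)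
    have key : ∀ a b : ℝ, (b ≠ 0 → |a| ≤ 1) → |b| ≤ 2 ^ p → |a * b| ≤ 2 ^ p := by
      intro a b ha hb
      by_cases hb0 : b = 0
      · simp [hb0]
      · rw [abs_mul]
        calc |a| * |b| ≤ 1 * 2 ^ p := by gcongr; exact ha hb0
          _ = 2 ^ p := one_mul _
    have e1 : |(x - ξ j) / (ξ (j + p + 1) - ξ j) * bspline ξ p j x| ≤ 2 ^ p := by
      refine key _ _ (fun hb => ?_) (ih h1)
      have := mem_Ico_of_bspline_ne_zero h1 hb
      rw [abs_div, div_le_one (abs_pos.2 (by linarith [this.1, this.2])), abs_of_nonneg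
        (by linarith [this.1]), abs_of_nonneg (by linarith [this.1, this.2])]
      linarith [this.2]
    have e2 : |(ξ (j + p + 2) - x) / (ξ (j + p + 2) - ξ (j + 1)) * bspline ξ p (j + 1) x|
        ≤ 2 ^ p := by
      refine key _ _ (fun hb => ?_) (ih h2)
      have := mem_Ico_of_bspline_ne_zero h2 hb
      rw [show j + 1 + p + 1 = j + p + 2 by omega] at this
      rw [abs_div, div_le_one (abs_pos.2 (by linarith [this.1, this.2])), abs_of_nonneg
        (by linarith [this.2]), abs_of_nonneg (by linarith [this.1, this.2])]
      linarith [this.1]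
    rw [bspline_succ]
    calc _ ≤ _ := abs_add_le _ _
      _ ≤ 2 ^ p + 2 ^ p := add_le_add e1 e2
      _ = 2 ^ (p + 1) := by ring

/-- `x` is none of the knots with indices between `a` and `b`. -/
def OffKnots (ξ : ℕ → ℝ) (a b : ℕ) (x : ℝ) : Prop := ∀ k, a ≤ k → k ≤ b → x ≠ ξ k

lemma OffKnots.mono {ξ : ℕ → ℝ} {a b a' b' : ℕ} {x : ℝ} (h : OffKnots ξ a b x) (ha : a ≤ a')
    (hb : b' ≤ b) : OffKnots ξ a' b' x :=
  fun k h1 h2 => h k (ha.trans h1) (h2.trans hb)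

/-- The finite set of the knots with indices between `a` and `b`. -/
def knotSet (ξ : ℕ → ℝ) (a b : ℕ) : Set ℝ := ξ '' Icc a b

lemma finite_knotSet (ξ : ℕ → ℝ) (a b : ℕ) : (knotSet ξ a b).Finite := (finite_Icc a b).image ξ

lemma notMem_knotSet {ξ : ℕ → ℝ} {a b : ℕ} {x : ℝ} : x ∉ knotSet ξ a b ↔ OffKnots ξ a b x := by
  simp only [knotSet, mem_image, mem_Icc, not_exists, not_and, OffKnots]
  exact ⟨fun h k h1 h2 h3 => h k ⟨h1, h2⟩ h3.symm, fun h k hk h3 => h k hk.1 hk.2 h3.symm⟩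

lemma OffKnots.eventually {ξ : ℕ → ℝ} {a b : ℕ} {x : ℝ} (h : OffKnots ξ a b x) :
    ∀ᶠ y in nhds x, OffKnots ξ a b y := by
  have := (finite_knotSet ξ a b).isClosed.isOpen_compl.mem_nhds (notMem_knotSet.2 h)
  filter_upwards [this] with y hy
  exact notMem_knotSet.1 hy

lemma ae_offKnots (ξ : ℕ → ℝ) (a b : ℕ) : ∀ᵐ x : ℝ, OffKnots ξ a b x := by
  have := (finite_knotSet ξ a b).countable.ae_notMem volume
  filter_upwards [this] with y hy
  exact notMem_knotSet.1 hy

lemma bspline_zero_eventuallyEq {ξ : ℕ → ℝ} {j : ℕ} {x : ℝ} (hx : OffKnots ξ j (j + 1) x) :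
    bspline ξ 0 j =ᶠ[nhds x] fun _ => bspline ξ 0 j x := by
  have h0 := hx j le_rfl (by omega)
  have h1 := hx (j + 1) (by omega) le_rfl
  rcases lt_or_gt_of_ne h0 with h0 | h0 <;> rcases lt_or_gt_of_ne h1 with h1 | h1 <;>
  [have := (gt_mem_nhds h0).and (gt_mem_nhds h1);
   have := (gt_mem_nhds h0).and (lt_mem_nhds h1);
   have := (lt_mem_nhds h0).and (gt_mem_nhds h1);
   have := (lt_mem_nhds h0).and (lt_mem_nhds h1)] <;>
  · filter_upwards [this] with y hy
    simp only [bspline_zero, indicator, mem_Ico]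
    grind

lemma contDiffAt_bspline {ξ : ℕ → ℝ} {p j : ℕ} {x : ℝ} (hx : OffKnots ξ j (j + p + 1) x) :
    ContDiffAt ℝ ∞ (bspline ξ p j) x := by
  induction p generalizing j with
  | zero => exact contDiffAt_const.congr_of_eventuallyEq (bspline_zero_eventuallyEq hx)
  | succ p ih =>
    have h1 := ih (hx.mono le_rfl (by omega) : OffKnots ξ j (j + p + 1) x)
    have h2 := ih (hx.mono (by omega) (by omega) : OffKnots ξ (j + 1) (j + 1 + p + 1) x)
    change ContDiffAt ℝ ∞ (fun x => _) x
    simp only [bspline_succ, div_eq_mul_inv]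
    fun_prop

/-- The derivative of a B-spline off the knots. -/
noncomputable def bsplineDeriv (ξ : ℕ → ℝ) (p j : ℕ) (x : ℝ) : ℝ :=
  ((p : ℝ) + 1) * (bspline ξ p j x / (ξ (j + p + 1) - ξ j)
    - bspline ξ p (j + 1) x / (ξ (j + p + 2) - ξ (j + 1)))

lemma hasDerivAt_bspline {ξ : ℕ → ℝ} {p j : ℕ} (h : SortedKnots ξ j (j + p + 2)) {x : ℝ}
    (hx : OffKnots ξ j (j + p + 2) x) :
    HasDerivAt (bspline ξ (p + 1) j) (bsplineDeriv ξ p j x) x := by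
  have aux : ∀ {f g : ℝ → ℝ} {f' g' : ℝ} (a b c d : ℝ), HasDerivAt f f' x → HasDerivAt g g' x →
      HasDerivAt (fun y => (y - a) / b * f y + (c - y) / d * g y)
        (f x / b - g x / d + ((x - a) / b * f' + (c - x) / d * g')) x := by
    intro f g f' g' a b c d hf hg
    have h1 := ((((hasDerivAt_id x).sub_const a).div_const b).mul hf).add
      ((((hasDerivAt_id x).const_sub c).div_const d).mul hg)
    refine h1.congr_deriv ?_
    simp only [id]
    ring
  induction p generalizing j with
  | zero =>
    have h1 : HasDerivAt (bspline ξ 0 j) 0 x :=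
      (hasDerivAt_const x _).congr_of_eventuallyEq
        (bspline_zero_eventuallyEq (hx.mono le_rfl (by omega)))
    have h2 : HasDerivAt (bspline ξ 0 (j + 1)) 0 x :=
      (hasDerivAt_const x _).congr_of_eventuallyEq
        (bspline_zero_eventuallyEq (hx.mono (by omega) (by omega)))
    refine (aux (ξ j) (ξ (j + 0 + 1) - ξ j) (ξ (j + 0 + 2)) (ξ (j + 0 + 2) - ξ (j + 1))
      h1 h2).congr_deriv ?_
    simp [bsplineDeriv]
  | succ p ih =>
    have h1 := ih (h.mono le_rfl (by omega) : SortedKnots ξ j (j + p + 2))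
      (hx.mono le_rfl (by omega))
    have h2 := ih (h.mono (by omega) (by omega) : SortedKnots ξ (j + 1) (j + 1 + p + 2))
      (hx.mono (by omega) (by omega))
    refine (aux (ξ j) (ξ (j + (p + 1) + 1) - ξ j) (ξ (j + (p + 1) + 2))
      (ξ (j + (p + 1) + 2) - ξ (j + 1)) h1 h2).congr_deriv ?_
    simp only [bsplineDeriv, bspline_succ]
    push_cast
    rw [show j + (p + 1) + 1 = j + p + 2 by omega, show j + (p + 1) + 2 = j + p + 3 by omega,
      show j + 1 + p + 1 = j + p + 2 by omega, show j + 1 + p + 2 = j + p + 3 by omega,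
      show j + 1 + 1 = j + 2 by omega]
    have m1 : ξ j ≤ ξ (j + 1) := h (by omega) (by omega) (by omega)
    have m2 : ξ (j + 1) ≤ ξ (j + p + 2) := h (by omega) (by omega) (by omega)
    have m3 : ξ (j + p + 2) ≤ ξ (j + p + 3) := h (by omega) (by omega) (by omega)
    set β := bspline ξ p (j + 1) x / (ξ (j + p + 2) - ξ (j + 1)) with hβ
    have c1 : (ξ (j + p + 2) - ξ j) / (ξ (j + p + 2) - ξ j) * β = β := by
      by_cases h0 : ξ (j + p + 2) - ξ j = 0
      · have : ξ (j + p + 2) - ξ (j + 1) = 0 := by linarith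
        simp [hβ, this]
      · rw [div_self h0, one_mul]
    have c2 : (ξ (j + p + 3) - ξ (j + 1)) / (ξ (j + p + 3) - ξ (j + 1)) * β = β := by
      by_cases h0 : ξ (j + p + 3) - ξ (j + 1) = 0
      · have : ξ (j + p + 2) - ξ (j + 1) = 0 := by linarith
        simp [hβ, this]
      · rw [div_self h0, one_mul]
    have e1 : ∀ t : ℝ, t / (ξ (j + p + 2) - ξ (j + 1)) * bspline ξ p (j + 1) x = t * β := by
      intro t; rw [hβ]; ring
    simp only [e1]
    linear_combination (-(p : ℝ) - 1) * c1 + ((p : ℝ) + 1) * c2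

end UnivariateSpline

namespace UnivariateSpline

lemma bspline_eventuallyEq_zero {ξ : ℕ → ℝ} {p j : ℕ} (h : SortedKnots ξ j (j + p + 1)) {x : ℝ}
    (hx : x < ξ j ∨ ξ (j + p + 1) < x) : bspline ξ p j =ᶠ[nhds x] fun _ => 0 := by
  rcases hx with hx | hx
  · filter_upwards [gt_mem_nhds hx] with y hy using bspline_eq_zero_of_lt h hy
  · filter_upwards [lt_mem_nhds hx] with y hy using bspline_eq_zero_of_ge h hy.le

lemma abs_iteratedDeriv_bspline_le {ξ : ℕ → ℝ} {p j : ℕ} (l : ℕ) (h : SortedKnots ξ j (j + p + 1))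
    {x δ : ℝ} (hx : OffKnots ξ j (j + p + 1) x) (hδ0 : 0 < δ)
    (hδ : ∀ a b, j ≤ a → a < b → b ≤ j + p + 1 → ξ a < x → x < ξ b → δ ≤ ξ b - ξ a) :
    |iteratedDeriv l (bspline ξ p j) x| * δ ^ l ≤ 2 ^ p * (2 * (p : ℝ)) ^ l := by
  induction l generalizing p j with
  | zero => simpa using abs_bspline_le h x
  | succ l ih =>
    cases p with
    | zero =>
      rw [(bspline_zero_eventuallyEq hx).iteratedDeriv_eq, iteratedDeriv_const]
      simp
    | succ p =>
      have hS1 : SortedKnots ξ j (j + p + 1) := h.mono le_rfl (by omega)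
      have hS2 : SortedKnots ξ (j + 1) (j + 1 + p + 1) := h.mono (by omega) (by omega)
      have hO1 : OffKnots ξ j (j + p + 1) x := hx.mono le_rfl (by omega)
      have hO2 : OffKnots ξ (j + 1) (j + 1 + p + 1) x := hx.mono (by omega) (by omega)
      have hd : deriv (bspline ξ (p + 1) j) =ᶠ[nhds x] bsplineDeriv ξ p j := by
        filter_upwards [hx.eventually] with y hy
        exact (hasDerivAt_bspline h hy).deriv
      have i1 := ih hS1 hO1 (fun a b ha hab hb => hδ a b ha hab (by omega))
      have i2 := ih hS2 hO2 (fun a b ha hab hb => hδ a b (by omega) hab (by omega))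
      have key : ∀ k, j ≤ k → k + p + 1 ≤ j + p + 2 → SortedKnots ξ k (k + p + 1) →
          OffKnots ξ k (k + p + 1) x →
          |iteratedDeriv l (bspline ξ p k) x| * δ ^ l ≤ 2 ^ p * (2 * (p : ℝ)) ^ l →
          |iteratedDeriv l (bspline ξ p k) x / (ξ (k + p + 1) - ξ k)| * δ ^ (l + 1)
            ≤ 2 ^ p * (2 * (p : ℝ)) ^ l := by
        intro k hk1 hk2 hS hO hi
        have n1 := hO k (by omega) (by omega)
        have n2 := hO (k + p + 1) (by omega) (by omega)
        by_cases hm : ξ k < x ∧ x < ξ (k + p + 1)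
        · have h3 := hδ k (k + p + 1) hk1 (by omega) (by omega) hm.1 hm.2
          rw [abs_div, abs_of_pos (lt_of_lt_of_le hδ0 h3)]
          calc |iteratedDeriv l (bspline ξ p k) x| / (ξ (k + p + 1) - ξ k) * δ ^ (l + 1)
              = |iteratedDeriv l (bspline ξ p k) x| * δ ^ l * (δ / (ξ (k + p + 1) - ξ k)) := by
                ring
            _ ≤ |iteratedDeriv l (bspline ξ p k) x| * δ ^ l * 1 := by
                gcongr
                exact div_le_one_of_le₀ h3 (by linarith)
            _ ≤ _ := by rw [mul_one]; exact hi
        · have hz : x < ξ k ∨ ξ (k + p + 1) < x := by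
            rcases lt_or_gt_of_ne n1 with h1 | h1
            · exact Or.inl h1
            · rcases lt_or_gt_of_ne n2 with h2 | h2
              · exact absurd ⟨h1, h2⟩ hm
              · exact Or.inr h2
          rw [(bspline_eventuallyEq_zero hS hz).iteratedDeriv_eq, iteratedDeriv_fun_const_zero]
          simp only [zero_div, abs_zero, zero_mul]
          positivity
      have k1 := key j le_rfl (by omega) hS1 hO1 i1
      have k2 := key (j + 1) (by omega) (by omega) hS2 hO2 i2
      rw [show j + 1 + p + 1 = j + p + 2 by omega] at k2
      have c1 := ((contDiffAt_bspline hO1).of_le (m := (l : WithTop ℕ∞)) (by exact_mod_cast le_top))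
      have c2 := ((contDiffAt_bspline hO2).of_le (m := (l : WithTop ℕ∞)) (by exact_mod_cast le_top))
      rw [iteratedDeriv_succ', hd.iteratedDeriv_eq]
      have : iteratedDeriv l (bsplineDeriv ξ p j) x
          = ((p : ℝ) + 1) * (iteratedDeriv l (bspline ξ p j) x / (ξ (j + p + 1) - ξ j)
            - iteratedDeriv l (bspline ξ p (j + 1)) x / (ξ (j + p + 2) - ξ (j + 1))) := by
        rw [show bsplineDeriv ξ p j = fun x => ((p : ℝ) + 1) *
          ((fun x => bspline ξ p j x / (ξ (j + p + 1) - ξ j))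
            - fun x => bspline ξ p (j + 1) x / (ξ (j + p + 2) - ξ (j + 1))) x from rfl,
          iteratedDeriv_const_mul_field, iteratedDeriv_sub (c1.div_const _) (c2.div_const _),
          iteratedDeriv_div_const, iteratedDeriv_div_const]
      rw [this, abs_mul, abs_of_nonneg (by positivity)]
      set A := iteratedDeriv l (bspline ξ p j) x / (ξ (j + p + 1) - ξ j)
      set B := iteratedDeriv l (bspline ξ p (j + 1)) x / (ξ (j + p + 2) - ξ (j + 1))
      calc ((p : ℝ) + 1) * |A - B| * δ ^ (l + 1)
          ≤ ((p : ℝ) + 1) * (|A| + |B|) * δ ^ (l + 1) := by gcongr; exact abs_sub _ _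
        _ = ((p : ℝ) + 1) * (|A| * δ ^ (l + 1) + |B| * δ ^ (l + 1)) := by ring
        _ ≤ ((p : ℝ) + 1) * (2 ^ p * (2 * (p : ℝ)) ^ l + 2 ^ p * (2 * (p : ℝ)) ^ l) := by gcongr
        _ = 2 ^ p * (2 * (p : ℝ)) ^ l * (2 * ((p : ℝ) + 1)) := by ring
        _ ≤ 2 ^ (p + 1) * (2 * ((p : ℝ) + 1)) ^ l * (2 * ((p : ℝ) + 1)) := by
            gcongr
            · norm_num
            · omega
            · linarith
        _ = 2 ^ (p + 1) * (2 * ((p + 1 : ℕ) : ℝ)) ^ (l + 1) := by push_cast; ring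

lemma bspline_eq_pow_of_left_eq {ξ : ℕ → ℝ} {p j : ℕ} (h : SortedKnots ξ j (j + p + 1))
    (he : ξ j = ξ (j + p)) {x : ℝ} (hx : x ∈ Ico (ξ j) (ξ (j + p + 1))) :
    bspline ξ p j x = ((ξ (j + p + 1) - x) / (ξ (j + p + 1) - ξ j)) ^ p := by
  induction p generalizing j with
  | zero => rw [bspline_zero, indicator_of_mem hx]; simp
  | succ p ih =>
    have e1 : ξ j ≤ ξ (j + 1) := h (by omega) (by omega) (by omega)
    have e2 : ξ (j + 1) ≤ ξ (j + (p + 1)) := h (by omega) (by omega) (by omega)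
    have e3 : ξ (j + 1) = ξ j := by linarith
    have e4 : ξ (j + p + 1) = ξ j := he.symm
    have i := ih (j := j + 1) (h.mono (by omega) (by omega))
      (by rw [e3, show j + 1 + p = j + (p + 1) by omega, he])
      (by rw [e3, show j + 1 + p + 1 = j + (p + 1) + 1 by omega]; exact hx)
    rw [bspline_succ, i, e4, e3, show j + 1 + p + 1 = j + p + 2 by omega,
      show j + (p + 1) + 1 = j + p + 2 by omega]
    simp [pow_succ, mul_comm]

lemma bspline_eq_pow_of_right_eq {ξ : ℕ → ℝ} {p j : ℕ} (h : SortedKnots ξ j (j + p + 1))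
    (he : ξ (j + 1) = ξ (j + p + 1)) {x : ℝ} (hx : x ∈ Ico (ξ j) (ξ (j + p + 1))) :
    bspline ξ p j x = ((x - ξ j) / (ξ (j + p + 1) - ξ j)) ^ p := by
  induction p with
  | zero => rw [bspline_zero, indicator_of_mem hx]; simp
  | succ p ih =>
    have e1 : ξ (j + 1) ≤ ξ (j + p + 1) := h (by omega) (by omega) (by omega)
    have e2 : ξ (j + p + 1) ≤ ξ (j + (p + 1) + 1) := h (by omega) (by omega) (by omega)
    have e3 : ξ (j + p + 1) = ξ (j + (p + 1) + 1) := by linarith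
    have i := ih (h.mono (by omega) (by omega)) (by rw [e3, he]) (by rw [e3]; exact hx)
    rw [bspline_succ, i, e3, he, show j + (p + 1) + 1 = j + p + 2 by omega]
    simp [pow_succ, mul_comm]

lemma continuousAt_bspline {ξ : ℕ → ℝ} {p j : ℕ} (h : SortedKnots ξ j (j + p + 1)) {x : ℝ}
    (h1 : ¬ (ξ j = x ∧ ξ (j + p) = x)) (h2 : ¬ (ξ (j + 1) = x ∧ ξ (j + p + 1) = x)) :
    ContinuousAt (bspline ξ p j) x := by
  have bdd : ∀ (f g : ℝ → ℝ) (C : ℝ), (∀ y, |g y| ≤ C) → Continuous f → f x = 0 →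
      ContinuousAt (fun y => f y * g y) x := by
    intro f g C hg hf hx
    have h0 : Filter.Tendsto (fun y => f y * g y) (nhds x) (nhds 0) := by
      refine squeeze_zero_norm (a := fun y => |f y| * C) (fun y => ?_) ?_
      · rw [Real.norm_eq_abs, abs_mul]
        gcongr
        exact hg y
      · have : ContinuousAt (fun y => |f y| * C) x := by fun_prop
        simpa [ContinuousAt, hx] using this
    simpa [ContinuousAt, hx] using h0
  induction p generalizing j with
  | zero =>
    simp only [add_zero, and_self] at h1 h2
    have : OffKnots ξ j (j + 1) x := by
      intro k hk1 hk2
      obtain rfl | rfl : k = j ∨ k = j + 1 := by omega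
      · exact fun hc => h1 hc.symm
      · exact fun hc => h2 hc.symm
    exact continuousAt_const.congr (bspline_zero_eventuallyEq this).symm
  | succ p ih =>
    have hS1 : SortedKnots ξ j (j + p + 1) := h.mono le_rfl (by omega)
    have hS2 : SortedKnots ξ (j + 1) (j + 1 + p + 1) := h.mono (by omega) (by omega)
    have m1 : ξ j ≤ ξ (j + 1) := h (by omega) (by omega) (by omega)
    have m2 : ξ (j + p + 1) ≤ ξ (j + p + 2) := h (by omega) (by omega) (by omega)
    rw [show j + (p + 1) = j + p + 1 by omega] at h1
    rw [show j + (p + 1) + 1 = j + p + 2 by omega] at h2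
    by_cases hc : ξ (j + 1) = x ∧ ξ (j + p + 1) = x
    · have a1 : ξ j < x := lt_of_le_of_ne (by linarith [hc.1]) fun hh => h1 ⟨hh, hc.2⟩
      have a2 : x < ξ (j + p + 2) := lt_of_le_of_ne (by linarith [hc.2]) fun hh => h2 ⟨hc.1, hh.symm⟩
      set a := ξ j with ha
      set c := ξ (j + p + 2) with hcc
      have hcont : Continuous fun y : ℝ =>
          (min ((y - a) / (x - a)) 1) ^ (p + 1) * (min ((c - y) / (c - x)) 1) ^ (p + 1) := by
        fun_prop
      refine hcont.continuousAt.congr ?_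
      filter_upwards [Ioo_mem_nhds a1 a2] with y hy
      rw [bspline_succ, hc.1, hc.2]
      rcases lt_or_ge y x with hyx | hyx
      · rw [bspline_eq_pow_of_right_eq hS1 (by rw [hc.1, hc.2]) ⟨hy.1.le, by rw [hc.2]; exact hyx⟩,
          bspline_eq_zero_of_lt hS2 (by rw [hc.1]; exact hyx), hc.2,
          min_eq_left (by rw [div_le_one (by linarith)]; linarith),
          min_eq_right (by rw [one_le_div (by linarith)]; linarith)]
        simp [pow_succ, mul_comm, ha]
      · rw [bspline_eq_zero_of_ge hS1 (by rw [hc.2]; exact hyx),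
          bspline_eq_pow_of_left_eq hS2 (by rw [show j + 1 + p = j + p + 1 by omega, hc.1, hc.2])
            ⟨by rw [hc.1]; exact hyx, by rw [show j + 1 + p + 1 = j + p + 2 by omega]; exact hy.2⟩,
          hc.1, min_eq_right (by rw [one_le_div (by linarith)]; linarith),
          min_eq_left (by rw [div_le_one (by linarith)]; linarith)]
        rw [show j + 1 + p + 1 = j + p + 2 by omega, ← hcc]
        simp [pow_succ, mul_comm]
    · have t1 : ContinuousAt (fun y => (y - ξ j) / (ξ (j + p + 1) - ξ j) * bspline ξ p j y) x := by
        by_cases hl : ξ j = x ∧ ξ (j + p) = x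
        · exact bdd _ _ _ (abs_bspline_le hS1) (by fun_prop) (by simp [hl.1])
        · have := ih hS1 hl hc
          fun_prop
      have t2 : ContinuousAt (fun y => (ξ (j + p + 2) - y) / (ξ (j + p + 2) - ξ (j + 1))
          * bspline ξ p (j + 1) y) x := by
        by_cases hl : ξ (j + 1 + 1) = x ∧ ξ (j + 1 + p + 1) = x
        · exact bdd _ _ _ (abs_bspline_le hS2) (by fun_prop)
            (by rw [← hl.2, show j + 1 + p + 1 = j + p + 2 by omega]; simp)
        · have := ih hS2 (by rwa [show j + 1 + p = j + p + 1 by omega]) hl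
          fun_prop
      exact t1.add t2

lemma sum_bspline_zero {ξ : ℕ → ℝ} {n : ℕ} (h : SortedKnots ξ 0 n) {x : ℝ}
    (hx : x ∈ Ico (ξ 0) (ξ n)) : ∑ j ∈ Finset.range n, bspline ξ 0 j x = 1 := by
  induction n with
  | zero => simp at hx
  | succ n ih =>
    rw [Finset.sum_range_succ]
    rcases lt_or_ge x (ξ n) with hn | hn
    · have h' : SortedKnots ξ 0 n := h.mono le_rfl (by omega)
      rw [ih h' ⟨hx.1, hn⟩, bspline_zero, indicator_of_notMem (by simp [hn])]
      simp
    · rw [Finset.sum_eq_zero, bspline_zero, indicator_of_mem (mem_Ico.2 ⟨hn, hx.2⟩),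
        zero_add]
      intro j hj
      rw [Finset.mem_range] at hj
      exact bspline_eq_zero_of_ge (h.mono (by omega) (by omega))
        ((h (by omega) (by omega) (by omega) : ξ (j + 0 + 1) ≤ ξ n).trans hn)

/-- Marsden's identity. -/
lemma marsden {ξ : ℕ → ℝ} {p n : ℕ} (h : SortedKnots ξ 0 (n + p)) {x : ℝ}
    (hx : x ∈ Ico (ξ p) (ξ n)) (y : ℝ) :
    ∑ j ∈ Finset.range n, (∏ k ∈ Finset.Icc 1 p, (y - ξ (j + k))) * bspline ξ p j x
      = (y - x) ^ p := by
  induction p generalizing n with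
  | zero => simpa using sum_bspline_zero h hx
  | succ p ih =>
    have hn : n ≠ 0 := by
      rintro rfl
      have := h (le_refl 0) (by omega : 0 ≤ p + 1) (by omega)
      linarith [hx.1, hx.2]
    have hmn : ξ n ≤ ξ (n + 1) := h (by omega) (by omega) (by omega)
    have hmp : ξ p ≤ ξ (p + 1) := h (by omega) (by omega) (by omega)
    have i := ih (n := n + 1) (h.mono le_rfl (by omega)) ⟨hmp.trans hx.1, hx.2.trans_le hmn⟩
    have z0 : bspline ξ p 0 x = 0 :=
      bspline_eq_zero_of_ge (h.mono (by omega) (by omega)) (by simpa using hx.1)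
    have zn : bspline ξ p n x = 0 := bspline_eq_zero_of_lt (h.mono (by omega) (by omega)) hx.2
    set P : ℕ → ℝ := fun j => ∏ k ∈ Finset.Icc 1 p, (y - ξ (j + k)) with hP
    have prod1 : ∀ j, ∏ k ∈ Finset.Icc 1 (p + 1), (y - ξ (j + k)) = P j * (y - ξ (j + p + 1)) := by
      intro j
      rw [Finset.prod_Icc_succ_top (by omega)]
      rfl
    have prod2 : ∀ j, ∏ k ∈ Finset.Icc 1 (p + 1), (y - ξ (j + k))
        = (y - ξ (j + 1)) * P (j + 1) := by
      intro j
      have : Finset.Icc 1 (p + 1) = insert 1 ((Finset.Icc 1 p).map (addRightEmbedding 1)) := by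
        ext k
        simp only [Finset.mem_Icc, Finset.mem_insert, Finset.mem_map, addRightEmbedding_apply]
        constructor
        · rintro ⟨h1, h2⟩
          rcases Nat.eq_or_lt_of_le h1 with h3 | h3
          · exact Or.inl h3.symm
          · exact Or.inr ⟨k - 1, by omega, by omega⟩
        · rintro (rfl | ⟨m, hm, rfl⟩) <;> omega
      rw [this, Finset.prod_insert (by simp), Finset.prod_map]
      simp only [addRightEmbedding_apply, hP]
      congr 1
      refine Finset.prod_congr rfl fun k _ => ?_
      rw [show j + (k + 1) = j + 1 + k by omega]
    set s : ℕ → ℝ := fun j => P j * (y - ξ (j + p + 1)) *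
      ((x - ξ j) / (ξ (j + p + 1) - ξ j) * bspline ξ p j x) with hs
    set t : ℕ → ℝ := fun j => (y - ξ j) * P j *
      ((ξ (j + p + 1) - x) / (ξ (j + p + 1) - ξ j) * bspline ξ p j x) with ht
    have e1 : ∀ j, (∏ k ∈ Finset.Icc 1 (p + 1), (y - ξ (j + k))) * bspline ξ (p + 1) j x
        = s j + t (j + 1) := by
      intro j
      rw [bspline_succ, mul_add]
      congr 1
      · rw [prod1]
      · rw [prod2, ht]
        simp only [show j + 1 + p + 1 = j + p + 2 by omega]
    have e2 : ∀ j ∈ Finset.range (n + 1), s j + t j = (y - x) * (P j * bspline ξ p j x) := by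
      intro j hj
      rw [Finset.mem_range] at hj
      have hSj : SortedKnots ξ j (j + p + 1) := h.mono (by omega) (by omega)
      by_cases hb : bspline ξ p j x = 0
      · simp [hs, ht, hb]
      · have := mem_Ico_of_bspline_ne_zero hSj hb
        have hne : ξ (j + p + 1) - ξ j ≠ 0 := by linarith [this.1, this.2]
        simp only [hs, ht]
        field_simp
        ring
    calc ∑ j ∈ Finset.range n, (∏ k ∈ Finset.Icc 1 (p + 1), (y - ξ (j + k))) * bspline ξ (p + 1) j x
        = ∑ j ∈ Finset.range n, (s j + t (j + 1)) := Finset.sum_congr rfl fun j _ => e1 j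
      _ = ∑ j ∈ Finset.range n, s j + ∑ j ∈ Finset.range n, t (j + 1) := Finset.sum_add_distrib
      _ = ∑ j ∈ Finset.range (n + 1), s j + ∑ j ∈ Finset.range (n + 1), t j := by
          rw [Finset.sum_range_succ s, Finset.sum_range_succ' t]
          simp [hs, ht, z0, zn]
      _ = ∑ j ∈ Finset.range (n + 1), (y - x) * (P j * bspline ξ p j x) := by
          rw [← Finset.sum_add_distrib]
          exact Finset.sum_congr rfl e2
      _ = (y - x) ^ (p + 1) := by rw [← Finset.mul_sum, i, pow_succ, mul_comm]

lemma marsden_polynomial {ξ : ℕ → ℝ} {p n : ℕ} (h : SortedKnots ξ 0 (n + p)) {x : ℝ}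
    (hx : x ∈ Ico (ξ p) (ξ n)) :
    ∑ j ∈ Finset.range n, (∏ k ∈ Finset.Icc 1 p, (Polynomial.X - Polynomial.C (ξ (j + k))))
      * Polynomial.C (bspline ξ p j x) = (Polynomial.X + Polynomial.C (-x)) ^ p := by
  refine Polynomial.funext fun y => ?_
  rw [Polynomial.eval_finsetSum]
  simp only [Polynomial.eval_mul, Polynomial.eval_prod, Polynomial.eval_sub, Polynomial.eval_X,
    Polynomial.eval_C, Polynomial.eval_pow, Polynomial.eval_add, ← sub_eq_add_neg]
  exact marsden h hx y

/-- The B-splines form a partition of unity. -/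
lemma sum_bspline {ξ : ℕ → ℝ} {p n : ℕ} (h : SortedKnots ξ 0 (n + p)) {x : ℝ}
    (hx : x ∈ Ico (ξ p) (ξ n)) : ∑ j ∈ Finset.range n, bspline ξ p j x = 1 := by
  have hc := congrArg (fun P => Polynomial.coeff P p) (marsden_polynomial h hx)
  simp only [Polynomial.finsetSum_coeff, Polynomial.coeff_mul_C,
    Polynomial.coeff_X_add_C_pow, Nat.sub_self, pow_zero, Nat.choose_self] at hc
  rw [show (1 : ℝ) = 1 * ((1 : ℕ) : ℝ) by simp, ← hc]
  refine Finset.sum_congr rfl fun j _ => ?_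
  have hm : (∏ k ∈ Finset.Icc 1 p, (Polynomial.X - Polynomial.C (ξ (j + k)))).Monic :=
    Polynomial.monic_prod_of_monic _ _ fun k _ => Polynomial.monic_X_sub_C _
  have hd : (∏ k ∈ Finset.Icc 1 p, (Polynomial.X - Polynomial.C (ξ (j + k)))).natDegree = p := by
    rw [Polynomial.natDegree_prod_of_monic _ _ fun k _ => Polynomial.monic_X_sub_C _]
    simp
  have := hm.coeff_natDegree
  rw [hd] at this
  rw [this, one_mul]

/-- Polynomials of degree at most `p` are combinations of the B-splines of degree `p`. -/
lemma exists_eq_sum_bspline (ξ : ℕ → ℝ) (p n : ℕ) (h : SortedKnots ξ 0 (n + p))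
    (q : Polynomial ℝ) (hq : q.natDegree ≤ p) :
    ∃ c : ℕ → ℝ, ∀ x ∈ Ico (ξ p) (ξ n), ∑ j ∈ Finset.range n, c j * bspline ξ p j x = q.eval x := by
  have mono : ∀ m ≤ p, ∃ c : ℕ → ℝ, ∀ x ∈ Ico (ξ p) (ξ n),
      ∑ j ∈ Finset.range n, c j * bspline ξ p j x = x ^ m := by
    intro m hm
    refine ⟨fun j => ((-1) ^ m * ((p.choose m : ℕ) : ℝ)⁻¹) *
      (∏ k ∈ Finset.Icc 1 p, (Polynomial.X - Polynomial.C (ξ (j + k)))).coeff (p - m),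
      fun x hx => ?_⟩
    have hpoly := marsden_polynomial h hx
    have hc := congrArg (fun P => Polynomial.coeff P (p - m)) hpoly
    simp only [Polynomial.finsetSum_coeff, Polynomial.coeff_mul_C,
      Polynomial.coeff_X_add_C_pow] at hc
    simp only [mul_assoc]
    rw [← Finset.mul_sum, ← Finset.mul_sum, hc, Nat.sub_sub_self hm, Nat.choose_symm hm, neg_pow]
    have : ((p.choose m : ℕ) : ℝ) ≠ 0 := by exact_mod_cast (Nat.choose_pos hm).ne'
    have h1 : ((-1 : ℝ) ^ m) * (-1) ^ m = 1 := by rw [← mul_pow]; simp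
    field_simp
    linear_combination (x ^ m) * h1
  choose! c hc using mono
  refine ⟨fun j => ∑ m ∈ Finset.range (p + 1), q.coeff m * c m j, fun x hx => ?_⟩
  rw [Polynomial.eval_eq_sum_range' (Nat.lt_succ_of_le hq)]
  simp only [Finset.sum_mul]
  rw [Finset.sum_comm]
  refine Finset.sum_congr rfl fun m hm => ?_
  rw [← hc m (by simpa [Nat.lt_succ_iff] using hm) x hx, Finset.mul_sum]
  exact Finset.sum_congr rfl fun j _ => by ring

end UnivariateSpline

namespace UnivariateSpline

lemma integral_eq_intervalIntegral_of_eq_zero {f : ℝ → ℝ} {a b : ℝ} (hab : a ≤ b)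
    (hf : ∀ x ∉ Icc a b, f x = 0) : ∫ x, f x = ∫ x in a..b, f x := by
  rw [intervalIntegral.integral_of_le hab, ← integral_Icc_eq_integral_Ioc,
    setIntegral_eq_integral_of_forall_compl_eq_zero hf]

lemma bspline_eq_zero_of_notMem_Icc {ξ : ℕ → ℝ} {p j : ℕ} (h : SortedKnots ξ j (j + p + 1)) {x : ℝ}
    (hx : x ∉ Icc (ξ j) (ξ (j + p + 1))) : bspline ξ p j x = 0 := by
  by_contra hc
  have := mem_Ico_of_bspline_ne_zero h hc
  exact hx ⟨this.1, this.2.le⟩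

lemma bsplineDeriv_eq_zero_of_notMem_Icc {ξ : ℕ → ℝ} {p j : ℕ} (h : SortedKnots ξ j (j + p + 2))
    {x : ℝ} (hx : x ∉ Icc (ξ j) (ξ (j + p + 2))) : bsplineDeriv ξ p j x = 0 := by
  have m1 : ξ j ≤ ξ (j + 1) := h (by omega) (by omega) (by omega)
  have m2 : ξ (j + p + 1) ≤ ξ (j + p + 2) := h (by omega) (by omega) (by omega)
  rw [bsplineDeriv, bspline_eq_zero_of_notMem_Icc (h.mono le_rfl (by omega))
    fun hc => hx ⟨hc.1, hc.2.trans m2⟩, bspline_eq_zero_of_notMem_Icc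
    (h.mono (by omega) (by omega)) fun hc => hx ⟨m1.trans hc.1, by
      rw [show j + p + 2 = j + 1 + p + 1 by omega]; exact hc.2⟩]
  simp

lemma intervalIntegrable_of_bounded {f : ℝ → ℝ} (hf : Measurable f) {C : ℝ}
    (hC : ∀ᵐ x, |f x| ≤ C) (a b : ℝ) : IntervalIntegrable f volume a b := by
  refine (intervalIntegrable_const (c := C)).mono_fun hf.aestronglyMeasurable ?_
  refine ae_restrict_of_ae ?_
  filter_upwards [hC] with x hx
  rw [Real.norm_eq_abs, Real.norm_eq_abs]
  exact hx.trans (le_abs_self C)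

lemma intervalIntegrable_bspline {ξ : ℕ → ℝ} {p j : ℕ} (h : SortedKnots ξ j (j + p + 1)) (a b : ℝ) :
    IntervalIntegrable (bspline ξ p j) volume a b :=
  intervalIntegrable_of_bounded (measurable_bspline ξ p j)
    (Filter.Eventually.of_forall (abs_bspline_le h)) a b

lemma intervalIntegrable_bsplineDeriv {ξ : ℕ → ℝ} {p j : ℕ} (h : SortedKnots ξ j (j + p + 2))
    (a b : ℝ) : IntervalIntegrable (bsplineDeriv ξ p j) volume a b :=
  (((intervalIntegrable_bspline (h.mono le_rfl (by omega)) a b).div_const _).sub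
    ((intervalIntegrable_bspline (h.mono (by omega) (by omega)) a b).div_const _)).const_mul _

lemma bspline_left_endpoint {ξ : ℕ → ℝ} {p j : ℕ} (h : SortedKnots ξ j (j + p + 1))
    (hlt : ξ j < ξ (j + p)) : bspline ξ p j (ξ j) = 0 := by
  induction p generalizing j with
  | zero => simp at hlt
  | succ p ih =>
    have hS2 : SortedKnots ξ (j + 1) (j + 1 + p + 1) := h.mono (by omega) (by omega)
    rw [bspline_succ]
    rcases (h (by omega) (by omega) (by omega) : ξ j ≤ ξ (j + 1)).eq_or_lt with he | he
    · have : bspline ξ p (j + 1) (ξ (j + 1)) = 0 :=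
        ih hS2 (by rw [← he, show j + 1 + p = j + (p + 1) by omega]; exact hlt)
      rw [← he] at this
      simp [this]
    · rw [bspline_eq_zero_of_lt hS2 he]
      simp

/-- On its support a B-spline of positive degree agrees with a function that is continuous up to
the end points. -/
lemma exists_continuousOn_eqOn_bspline {ξ : ℕ → ℝ} {p j : ℕ} (h : SortedKnots ξ j (j + p + 2))
    (hlt : ξ j < ξ (j + p + 2)) :
    ∃ u : ℝ → ℝ, ContinuousOn u (Icc (ξ j) (ξ (j + p + 2))) ∧
      EqOn u (bspline ξ (p + 1) j) (Ioo (ξ j) (ξ (j + p + 2))) ∧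
      u (ξ j) = (if ξ j = ξ (j + p + 1) then 1 else 0) ∧
      u (ξ (j + p + 2)) = (if ξ (j + 1) = ξ (j + p + 2) then 1 else 0) := by
  have m1 : ξ j ≤ ξ (j + 1) := h (by omega) (by omega) (by omega)
  have m2 : ξ (j + 1) ≤ ξ (j + p + 1) := h (by omega) (by omega) (by omega)
  have m3 : ξ (j + p + 1) ≤ ξ (j + p + 2) := h (by omega) (by omega) (by omega)
  have hne : ξ (j + p + 2) - ξ j ≠ 0 := by linarith
  by_cases c1 : ξ j = ξ (j + p + 1)
  · refine ⟨fun x => ((ξ (j + p + 2) - x) / (ξ (j + p + 2) - ξ j)) ^ (p + 1),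
      by fun_prop, fun x hx => ?_, ?_, ?_⟩
    · exact (bspline_eq_pow_of_left_eq h c1 ⟨hx.1.le, hx.2⟩).symm
    · rw [if_pos c1]; simp [hne]
    · rw [if_neg (by linarith)]; simp
  · by_cases c2 : ξ (j + 1) = ξ (j + p + 2)
    · refine ⟨fun x => ((x - ξ j) / (ξ (j + p + 2) - ξ j)) ^ (p + 1),
        by fun_prop, fun x hx => ?_, ?_, ?_⟩
      · exact (bspline_eq_pow_of_right_eq h c2 ⟨hx.1.le, hx.2⟩).symm
      · rw [if_neg c1]; simp
      · rw [if_pos c2]; simp [hne]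
    · refine ⟨bspline ξ (p + 1) j, fun x _ => ContinuousAt.continuousWithinAt ?_, fun x _ => rfl,
        ?_, ?_⟩
      · exact continuousAt_bspline h (fun hh => c1 (hh.1.trans hh.2.symm))
          (fun hh => c2 (hh.1.trans hh.2.symm))
      · rw [if_neg c1]
        exact bspline_left_endpoint h (lt_of_le_of_ne (m1.trans m2) c1)
      · rw [if_neg c2]
        exact bspline_eq_zero_of_ge h le_rfl

lemma integrable_bspline {ξ : ℕ → ℝ} {p j : ℕ} (h : SortedKnots ξ j (j + p + 1)) :
    Integrable (bspline ξ p j) := by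
  have h1 := intervalIntegrable_bspline h (ξ j) (ξ (j + p + 1))
  rw [intervalIntegrable_iff_integrableOn_Icc_of_le (h le_rfl (by omega) le_rfl)] at h1
  refine (integrableOn_iff_integrable_of_support_subset fun x hx => ?_).1 h1
  by_contra hc
  exact hx (bspline_eq_zero_of_notMem_Icc h hc)

/-- Integration by parts against a B-spline. -/
lemma integral_bspline_mul_deriv {ξ : ℕ → ℝ} {p j : ℕ} (h : SortedKnots ξ j (j + p + 2))
    (hlt : ξ j < ξ (j + p + 2)) {F F' : ℝ → ℝ} (hF : Continuous F) {S : Set ℝ} (hS : S.Finite)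
    (hd : ∀ x ∉ S, HasDerivAt F (F' x) x) (hi : ∀ a b, IntervalIntegrable F' volume a b) :
    ∫ x, bspline ξ (p + 1) j x * F' x
      = (if ξ (j + 1) = ξ (j + p + 2) then F (ξ (j + p + 2)) else 0)
        - (if ξ j = ξ (j + p + 1) then F (ξ j) else 0) - ∫ x, bsplineDeriv ξ p j x * F x := by
  obtain ⟨u, uc, ue, ua, ub⟩ := exists_continuousOn_eqOn_bspline h hlt
  rw [integral_eq_intervalIntegral_of_eq_zero (f := fun x => bspline ξ (p + 1) j x * F' x) hlt.le
      (fun x hx => by rw [bspline_eq_zero_of_notMem_Icc h hx, zero_mul]),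
    integral_eq_intervalIntegral_of_eq_zero (f := fun x => bsplineDeriv ξ p j x * F x) hlt.le
      (fun x hx => by rw [bsplineDeriv_eq_zero_of_notMem_Icc h hx, zero_mul])]
  have hI1 : IntervalIntegrable (fun x => u x * F' x) volume (ξ j) (ξ (j + p + 2)) :=
    (hi _ _).continuousOn_mul (by rwa [uIcc_of_le hlt.le])
  have hI2 : IntervalIntegrable (fun x => bsplineDeriv ξ p j x * F x) volume (ξ j)
      (ξ (j + p + 2)) :=
    (intervalIntegrable_bsplineDeriv h _ _).mul_continuousOn hF.continuousOn
  have e1 : ∫ x in ξ j..ξ (j + p + 2), bspline ξ (p + 1) j x * F' x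
      = ∫ x in ξ j..ξ (j + p + 2), u x * F' x := by
    refine intervalIntegral.integral_congr_ae ?_
    have := (Set.countable_singleton (ξ (j + p + 2))).ae_notMem volume
    filter_upwards [this] with x hx hx2
    rw [uIoc_of_le hlt.le] at hx2
    rw [ue ⟨hx2.1, lt_of_le_of_ne hx2.2 hx⟩]
  have key := integral_eq_of_hasDerivAt_off_countable_of_le (fun x => u x * F x)
    (fun x => bsplineDeriv ξ p j x * F x + u x * F' x) hlt.le
    (s := S ∪ knotSet ξ j (j + p + 2)) (hS.union (finite_knotSet _ _ _)).countable
    (uc.mul hF.continuousOn)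
    (fun x hx => by
      have hx1 : x ∉ S := fun hc => hx.2 (Or.inl hc)
      have hx2 : OffKnots ξ j (j + p + 2) x := notMem_knotSet.1 fun hc => hx.2 (Or.inr hc)
      have hu : HasDerivAt u (bsplineDeriv ξ p j x) x :=
        (hasDerivAt_bspline h hx2).congr_of_eventuallyEq
          (Filter.eventuallyEq_of_mem (Ioo_mem_nhds hx.1.1 hx.1.2) ue)
      exact hu.mul (hd x hx1))
    (hI2.add hI1)
  rw [intervalIntegral.integral_add hI2 hI1] at key
  simp only [ua, ub, ite_mul, one_mul, zero_mul] at key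
  rw [e1]
  linarith

lemma integral_bsplineDeriv_mul {ξ : ℕ → ℝ} {p j : ℕ} (h : SortedKnots ξ j (j + p + 2))
    {F : ℝ → ℝ} (hF : Continuous F) :
    ∫ x, bsplineDeriv ξ p j x * F x = ((p : ℝ) + 1) *
      ((∫ x, bspline ξ p j x * F x) / (ξ (j + p + 1) - ξ j)
        - (∫ x, bspline ξ p (j + 1) x * F x) / (ξ (j + p + 2) - ξ (j + 1))) := by
  have hS1 : SortedKnots ξ j (j + p + 1) := h.mono le_rfl (by omega)
  have hS2 : SortedKnots ξ (j + 1) (j + 1 + p + 1) := h.mono (by omega) (by omega)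
  have hI : ∀ k, SortedKnots ξ k (k + p + 1) → Integrable fun x => bspline ξ p k x * F x := by
    intro k hk
    have h1 := (intervalIntegrable_bspline hk (ξ k) (ξ (k + p + 1))).mul_continuousOn
      (hF.continuousOn (s := uIcc (ξ k) (ξ (k + p + 1))))
    rw [intervalIntegrable_iff_integrableOn_Icc_of_le (hk le_rfl (by omega) le_rfl)] at h1
    refine (integrableOn_iff_integrable_of_support_subset fun x hx => ?_).1 h1
    by_contra hc
    exact hx (by simp [bspline_eq_zero_of_notMem_Icc hk hc])
  rw [← integral_div, ← integral_div, ← integral_sub ((hI j hS1).div_const _)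
    ((hI (j + 1) hS2).div_const _), ← integral_const_mul]
  refine integral_congr_ae (Filter.Eventually.of_forall fun x => ?_)
  simp only [bsplineDeriv]
  ring

lemma integral_bspline {ξ : ℕ → ℝ} {p j : ℕ} (h : SortedKnots ξ j (j + p + 1)) :
    ∫ x, bspline ξ p j x = (ξ (j + p + 1) - ξ j) / ((p : ℝ) + 1) := by
  induction p generalizing j with
  | zero =>
    have h0 : ξ j ≤ ξ (j + 1) := h le_rfl (by omega) le_rfl
    simp only [bspline_zero]
    rw [integral_indicator measurableSet_Ico]
    simp [h0]
  | succ p ih =>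
    have hS1 : SortedKnots ξ j (j + p + 1) := h.mono le_rfl (by omega)
    have hS2 : SortedKnots ξ (j + 1) (j + 1 + p + 1) := h.mono (by omega) (by omega)
    rw [show j + (p + 1) + 1 = j + p + 2 by omega]
    have h02 : ξ j ≤ ξ (j + p + 2) := h le_rfl (by omega) le_rfl
    rcases h02.eq_or_lt with he | hlt
    · simp [bspline_eq_zero_of_eq h he, he]
    have i2 := ih hS2
    rw [show j + 1 + p + 1 = j + p + 2 by omega] at i2
    have ibp := integral_bspline_mul_deriv h hlt (F := fun x => x - ξ j) (F' := fun _ => 1)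
      (by fun_prop) finite_empty (fun x _ => (hasDerivAt_id x).sub_const _)
      (fun a b => intervalIntegrable_const)
    simp only [sub_self, ite_self, sub_zero, mul_one] at ibp
    have pw : ∀ x, bsplineDeriv ξ p j x * (x - ξ j) = ((p : ℝ) + 1) * bspline ξ (p + 1) j x
        - ((p : ℝ) + 1) * ((ξ (j + p + 2) - ξ j) / (ξ (j + p + 2) - ξ (j + 1))
          * bspline ξ p (j + 1) x) := by
      intro x
      rw [bsplineDeriv, bspline_succ]
      ring
    have e : ∫ x, bsplineDeriv ξ p j x * (x - ξ j) = ((p : ℝ) + 1) * (∫ x, bspline ξ (p + 1) j x)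
        - ((p : ℝ) + 1) * ((ξ (j + p + 2) - ξ j) / (ξ (j + p + 2) - ξ (j + 1))
          * ∫ x, bspline ξ p (j + 1) x) := by
      simp only [pw]
      rw [integral_sub ((integrable_bspline h).const_mul _) (((integrable_bspline hS2).const_mul _).const_mul _),
        integral_const_mul, integral_const_mul, integral_const_mul]
    rw [e, i2] at ibp
    have hp : (p : ℝ) + 1 ≠ 0 := by positivity
    have hp2 : (p : ℝ) + 1 + 1 ≠ 0 := by positivity
    push_cast
    rw [eq_div_iff hp2]
    by_cases hc : ξ (j + 1) = ξ (j + p + 2)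
    · rw [if_pos hc, hc] at ibp
      simp only [sub_self, div_zero, zero_mul, mul_zero] at ibp
      linarith
    · rw [if_neg hc] at ibp
      have hd : ξ (j + p + 2) - ξ (j + 1) ≠ 0 := fun h0 => hc (by linarith)
      field_simp at ibp
      linarith

/-- `f` is of class `C^p` and its derivative of order `p` is differentiable off a finite set, with
a locally integrable derivative. -/
structure PiecewiseSmooth (p : ℕ) (f : ℝ → ℝ) : Prop where
  contDiff : ContDiff ℝ p f
  exists_finite : ∃ S : Set ℝ, S.Finite ∧ ∀ x ∉ S, DifferentiableAt ℝ (iteratedDeriv p f) x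
  intervalIntegrable : ∀ a b, IntervalIntegrable (iteratedDeriv (p + 1) f) volume a b

lemma PiecewiseSmooth.of_succ {p : ℕ} {f : ℝ → ℝ} (h : PiecewiseSmooth (p + 1) f) :
    PiecewiseSmooth p f where
  contDiff := h.contDiff.of_le (by exact_mod_cast Nat.le_succ p)
  exists_finite := ⟨∅, finite_empty, fun x _ =>
    (h.contDiff.differentiable_iteratedDeriv p (by exact_mod_cast Nat.lt_succ_self p)) x⟩
  intervalIntegrable := fun a b =>
    (h.contDiff.continuous_iteratedDeriv (p + 1) le_rfl).intervalIntegrable a b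

/-- The integral of `D^{p+1} f` against a B-spline of degree `p` is a multiple of a divided
difference of `f`; it vanishes if `f` vanishes at the knots, counted with multiplicity. -/
lemma integral_bspline_mul_iteratedDeriv_eq_zero {ξ : ℕ → ℝ} {p i : ℕ}
    (h : SortedKnots ξ i (i + p + 1)) {f : ℝ → ℝ} (hf : PiecewiseSmooth p f)
    (hz : ∀ a m, i ≤ a → a + m ≤ i + p + 1 → m ≤ p → ξ a = ξ (a + m) →
      iteratedDeriv m f (ξ a) = 0) :
    ∫ x, bspline ξ p i x * iteratedDeriv (p + 1) f x = 0 := by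
  induction p generalizing i with
  | zero =>
    have h0 : ξ i ≤ ξ (i + 1) := h le_rfl (by omega) le_rfl
    rw [integral_eq_intervalIntegral_of_eq_zero h0
      (fun x hx => by rw [bspline_eq_zero_of_notMem_Icc h hx, zero_mul])]
    have e1 : ∫ x in ξ i..ξ (i + 1), bspline ξ 0 i x * iteratedDeriv (0 + 1) f x
        = ∫ x in ξ i..ξ (i + 1), iteratedDeriv (0 + 1) f x := by
      refine intervalIntegral.integral_congr_ae ?_
      have := (Set.countable_singleton (ξ (i + 1))).ae_notMem volume
      filter_upwards [this] with x hx hx2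
      rw [uIoc_of_le h0] at hx2
      rw [bspline_zero, indicator_of_mem (mem_Ico.2 ⟨hx2.1.le, lt_of_le_of_ne hx2.2 hx⟩), one_mul]
    obtain ⟨S, hS, hd⟩ := hf.exists_finite
    rw [e1, integral_eq_of_hasDerivAt_off_countable_of_le f _ h0 hS.countable
      hf.contDiff.continuous.continuousOn
      (fun x hx => by
        have := (hd x hx.2).hasDerivAt
        rwa [← iteratedDeriv_succ, iteratedDeriv_zero] at this) (hf.intervalIntegrable _ _)]
    have z1 := hz i 0 le_rfl (by omega) (by omega) rfl
    have z2 := hz (i + 1) 0 (by omega) (by omega) (by omega) rfl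
    rw [iteratedDeriv_zero] at z1 z2
    rw [z1, z2, sub_zero]
  | succ p ih =>
    have hS1 : SortedKnots ξ i (i + p + 1) := h.mono le_rfl (by omega)
    have hS2 : SortedKnots ξ (i + 1) (i + 1 + p + 1) := h.mono (by omega) (by omega)
    have h02 : ξ i ≤ ξ (i + p + 2) := h le_rfl (by omega) le_rfl
    rcases h02.eq_or_lt with he | hlt
    · simp [bspline_eq_zero_of_eq h he]
    obtain ⟨S, hS, hd⟩ := hf.exists_finite
    have hc := hf.contDiff.continuous_iteratedDeriv (p + 1) le_rfl
    have i1 := ih hS1 hf.of_succ fun a m h1 h2 h3 => hz a m h1 (by omega) (by omega)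
    have i2 := ih hS2 hf.of_succ fun a m h1 h2 h3 => hz a m (by omega) (by omega) (by omega)
    rw [integral_bspline_mul_deriv h hlt hc hS
      (fun x hx => by
        have := (hd x hx).hasDerivAt
        rwa [← iteratedDeriv_succ] at this) hf.intervalIntegrable,
      integral_bsplineDeriv_mul h hc, i1, i2]
    have z1 : (if ξ (i + 1) = ξ (i + p + 2) then iteratedDeriv (p + 1) f (ξ (i + p + 2)) else 0)
        = 0 := by
      split_ifs with hcc
      · rw [← hcc]
        exact hz (i + 1) (p + 1) (by omega) (by omega) le_rfl
          (by rw [hcc, show i + 1 + (p + 1) = i + p + 2 by omega])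
      · rfl
    have z2 : (if ξ i = ξ (i + p + 1) then iteratedDeriv (p + 1) f (ξ i) else 0) = 0 := by
      split_ifs with hcc
      · exact hz i (p + 1) le_rfl (by omega) le_rfl (by rw [hcc, show i + (p + 1) = i + p + 1 by omega])
      · rfl
    rw [z1, z2]
    simp

end UnivariateSpline

namespace UnivariateSpline

lemma hasDerivAt_of_eventually_ne {f g : ℝ → ℝ} {x : ℝ}
    (hd : ∀ᶠ y in nhdsWithin x {x}ᶜ, HasDerivAt f (g y) y) (hf : ContinuousAt f x)
    (hg : ContinuousAt g x) : HasDerivAt f (g x) x := by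
  have hr : ∀ᶠ y in nhdsWithin x (Ioi x), HasDerivAt f (g y) y :=
    hd.filter_mono (nhdsWithin_mono x fun y hy => (ne_of_gt hy : y ≠ x))
  have hl : ∀ᶠ y in nhdsWithin x (Iio x), HasDerivAt f (g y) y :=
    hd.filter_mono (nhdsWithin_mono x fun y hy => (ne_of_lt hy : y ≠ x))
  have A : HasDerivWithinAt f (g x) (Ici x) x :=
    hasDerivWithinAt_Ici_of_tendsto_deriv
      (fun y hy => (HasDerivAt.differentiableAt hy).differentiableWithinAt)
      hf.continuousWithinAt hr
      ((hg.tendsto.mono_left nhdsWithin_le_nhds).congr' (hr.mono fun y hy => hy.deriv.symm))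
  have B : HasDerivWithinAt f (g x) (Iic x) x :=
    hasDerivWithinAt_Iic_of_tendsto_deriv
      (fun y hy => (HasDerivAt.differentiableAt hy).differentiableWithinAt)
      hf.continuousWithinAt hl
      ((hg.tendsto.mono_left nhdsWithin_le_nhds).congr' (hl.mono fun y hy => hy.deriv.symm))
  simpa using B.union A

lemma eventually_offKnots_nhdsNE (ξ : ℕ → ℝ) (a b : ℕ) (x : ℝ) :
    ∀ᶠ y in nhdsWithin x {x}ᶜ, OffKnots ξ a b y := by
  have := ((finite_knotSet ξ a b).subset (sdiff_subset (t := {x}))).isClosed.isOpen_compl.mem_nhds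
    (show x ∈ (knotSet ξ a b \ {x})ᶜ by simp)
  filter_upwards [nhdsWithin_le_nhds this, self_mem_nhdsWithin] with y hy hyx
  exact notMem_knotSet.1 fun hc => hy ⟨hc, hyx⟩

lemma hasDerivAt_bspline_of_continuousAt {ξ : ℕ → ℝ} {p j : ℕ} (h : SortedKnots ξ j (j + p + 2))
    {x : ℝ} (h0 : ContinuousAt (bspline ξ (p + 1) j) x) (h1 : ContinuousAt (bspline ξ p j) x)
    (h2 : ContinuousAt (bspline ξ p (j + 1)) x) :
    HasDerivAt (bspline ξ (p + 1) j) (bsplineDeriv ξ p j x) x := by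
  refine hasDerivAt_of_eventually_ne ?_ h0 ?_
  · filter_upwards [eventually_offKnots_nhdsNE ξ j (j + p + 2) x] with y hy
    exact hasDerivAt_bspline h hy
  · exact continuousAt_const.mul ((h1.div_const _).sub (h2.div_const _))

/-- The knots with indices between `a` and `b` are simple. -/
def SimpleKnots (ξ : ℕ → ℝ) (a b : ℕ) : Prop :=
  ∀ ⦃k l : ℕ⦄, a ≤ k → k < l → l ≤ b → ξ k < ξ l

lemma SimpleKnots.mono {ξ : ℕ → ℝ} {a b a' b' : ℕ} (h : SimpleKnots ξ a b) (ha : a ≤ a')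
    (hb : b' ≤ b) : SimpleKnots ξ a' b' :=
  fun _ _ h1 h2 h3 => h (ha.trans h1) h2 (h3.trans hb)

lemma SimpleKnots.sorted {ξ : ℕ → ℝ} {a b : ℕ} (h : SimpleKnots ξ a b) : SortedKnots ξ a b :=
  fun k l h1 h2 h3 => by
    rcases h2.eq_or_lt with rfl | h2
    · exact le_rfl
    · exact (h h1 h2 h3).le

lemma SimpleKnots.continuous_bspline {ξ : ℕ → ℝ} {p j : ℕ} (h : SimpleKnots ξ j (j + p + 2)) :
    Continuous (bspline ξ (p + 1) j) := by
  refine continuous_iff_continuousAt.2 fun x => continuousAt_bspline h.sorted (fun hc => ?_)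
    fun hc => ?_
  · exact (h le_rfl (by omega : j < j + (p + 1)) (by omega)).ne (hc.1.trans hc.2.symm)
  · exact (h (by omega) (by omega : j + 1 < j + (p + 1) + 1) (by omega)).ne (hc.1.trans hc.2.symm)

lemma SimpleKnots.contDiff_bspline {ξ : ℕ → ℝ} {p j : ℕ} (h : SimpleKnots ξ j (j + p + 2)) :
    ContDiff ℝ p (bspline ξ (p + 1) j) := by
  induction p generalizing j with
  | zero => exact_mod_cast contDiff_zero.2 h.continuous_bspline
  | succ p ih =>
    have h1 : SimpleKnots ξ j (j + p + 2) := h.mono le_rfl (by omega)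
    have h2 : SimpleKnots ξ (j + 1) (j + 1 + p + 2) := h.mono (by omega) (by omega)
    have hd : ∀ x, HasDerivAt (bspline ξ (p + 1 + 1) j) (bsplineDeriv ξ (p + 1) j x) x := fun x =>
      hasDerivAt_bspline_of_continuousAt h.sorted h.continuous_bspline.continuousAt
        h1.continuous_bspline.continuousAt h2.continuous_bspline.continuousAt
    push_cast
    refine contDiff_succ_iff_deriv.2 ⟨fun x => (hd x).differentiableAt, by simp, ?_⟩
    rw [funext fun x => (hd x).deriv]
    exact contDiff_const.mul (((ih h1).div_const _).sub ((ih h2).div_const _))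

/-! ### The transition function -/

lemma perfectKnot_simple (p : ℕ) : SimpleKnots (perfectKnot p) 0 (p + 1) := by
  intro k l _ hkl hl
  have hk' : (k : ℝ) + 1 ≤ l := by exact_mod_cast hkl
  have hl' : (l : ℝ) ≤ p + 1 := by exact_mod_cast hl
  have hp : (0 : ℝ) < p + 1 := by positivity
  have hk0 : (0 : ℝ) ≤ k := by positivity
  refine Real.strictAntiOn_cos ⟨?_, ?_⟩ ⟨?_, ?_⟩ ?_
  · have := Real.pi_pos
    have : 0 ≤ (p : ℝ) + 1 - l := by linarith
    positivity
  · rw [div_le_iff₀ hp]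
    nlinarith [Real.pi_pos]
  · have := Real.pi_pos
    have : 0 ≤ (p : ℝ) + 1 - k := by linarith
    positivity
  · rw [div_le_iff₀ hp]
    nlinarith [Real.pi_pos]
  · have := Real.pi_pos
    gcongr

lemma perfectKnot_zero (p : ℕ) : perfectKnot p 0 = -1 := by
  have hp : (p : ℝ) + 1 ≠ 0 := by positivity
  simp [perfectKnot, hp]

lemma perfectKnot_last (p : ℕ) : perfectKnot p (p + 1) = 1 := by
  simp [perfectKnot]

lemma perfectKnot_sorted (p : ℕ) : SortedKnots (perfectKnot p) 0 (0 + p + 1) := by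
  rw [Nat.zero_add]; exact (perfectKnot_simple p).sorted

lemma transition_eq_zero {p : ℕ} {x : ℝ} (hx : x ≤ -1) : transition p x = 0 := by
  rw [transition, intervalIntegral.integral_symm, intervalIntegral.integral_of_le hx,
    integral_Ioc_eq_integral_Ioo, setIntegral_eq_zero_of_forall_eq_zero, neg_zero]
  intro t ht
  rw [bspline_eq_zero_of_lt (perfectKnot_sorted p) (by rw [perfectKnot_zero]; exact ht.2), mul_zero]

lemma transition_eq_one {p : ℕ} {x : ℝ} (hx : 1 ≤ x) : transition p x = 1 := by
  rw [transition, intervalIntegral.integral_const_mul,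
    ← integral_eq_intervalIntegral_of_eq_zero (f := bspline (perfectKnot p) p 0) (by linarith),
    integral_bspline (perfectKnot_sorted p), Nat.zero_add, perfectKnot_last, perfectKnot_zero]
  · have hp : (p : ℝ) + 1 ≠ 0 := by positivity
    field_simp
    norm_num
  · intro t ht
    refine bspline_eq_zero_of_notMem_Icc (perfectKnot_sorted p) fun hc => ht ?_
    rw [Nat.zero_add, perfectKnot_last, perfectKnot_zero] at hc
    exact ⟨hc.1, hc.2.trans hx⟩

lemma continuous_transition (p : ℕ) : Continuous (transition p) :=
  intervalIntegral.continuous_primitive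
    (fun a b => (intervalIntegrable_bspline (perfectKnot_sorted p) a b).const_mul _) _

lemma hasDerivAt_transition {p : ℕ} {x : ℝ} (hx : ContinuousAt (bspline (perfectKnot p) p 0) x) :
    HasDerivAt (transition p) (((p : ℝ) + 1) / 2 * bspline (perfectKnot p) p 0 x) x :=
  intervalIntegral.integral_hasDerivAt_right
    ((intervalIntegrable_bspline (perfectKnot_sorted p) _ _).const_mul _)
    ((measurable_bspline _ _ _).const_mul _).stronglyMeasurable.stronglyMeasurableAtFilter
    (continuousAt_const.mul hx)

lemma iteratedDeriv_succ_transition {p : ℕ} {x : ℝ} (hx : OffKnots (perfectKnot p) 0 (p + 1) x)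
    (k : ℕ) : iteratedDeriv (k + 1) (transition p) x
      = ((p : ℝ) + 1) / 2 * iteratedDeriv k (bspline (perfectKnot p) p 0) x := by
  have : deriv (transition p) =ᶠ[nhds x] fun y =>
      ((p : ℝ) + 1) / 2 * bspline (perfectKnot p) p 0 y := by
    filter_upwards [hx.eventually] with y hy
    exact (hasDerivAt_transition (contDiffAt_bspline (by rwa [Nat.zero_add])).continuousAt).deriv
  rw [iteratedDeriv_succ', this.iteratedDeriv_eq, iteratedDeriv_const_mul_field]

lemma contDiff_transition (p : ℕ) : ContDiff ℝ p (transition p) := by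
  cases p with
  | zero => exact_mod_cast contDiff_zero.2 (continuous_transition 0)
  | succ p =>
    have hs : SimpleKnots (perfectKnot (p + 1)) 0 (0 + p + 2) := by
      rw [Nat.zero_add]; exact perfectKnot_simple (p + 1)
    have hd := fun x => hasDerivAt_transition (hs.continuous_bspline.continuousAt (x := x))
    push_cast
    refine contDiff_succ_iff_deriv.2 ⟨fun x => (hd x).differentiableAt, by simp, ?_⟩
    rw [funext fun x => (hd x).deriv]
    exact contDiff_const.mul hs.contDiff_bspline

lemma differentiableAt_iteratedDeriv_transition {p : ℕ} {x : ℝ} (hx : OffKnots (perfectKnot p) 0 (p + 1) x) :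
    DifferentiableAt ℝ (iteratedDeriv p (transition p)) x := by
  have hB : ∀ y, OffKnots (perfectKnot p) 0 (p + 1) y →
      ContDiffAt ℝ ∞ (bspline (perfectKnot p) p 0) y :=
    fun y hy => contDiffAt_bspline (by rwa [Nat.zero_add])
  cases p with
  | zero =>
    rw [iteratedDeriv_zero]
    exact (hasDerivAt_transition (hB x hx).continuousAt).differentiableAt
  | succ p =>
    have e : iteratedDeriv (p + 1) (transition (p + 1)) =ᶠ[nhds x] fun y =>
        (((p + 1 : ℕ) : ℝ) + 1) / 2 * iteratedDeriv p (bspline (perfectKnot (p + 1)) (p + 1) 0) y := by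
      filter_upwards [hx.eventually] with y hy
      exact iteratedDeriv_succ_transition hy p
    refine DifferentiableAt.congr_of_eventuallyEq (DifferentiableAt.const_mul ?_ _) e
    have h1 : ContDiffWithinAt ℝ ∞ (bspline (perfectKnot (p + 1)) (p + 1) 0) univ x :=
      (hB x hx).contDiffWithinAt
    have h2 := h1.differentiableWithinAt_iteratedDerivWithin (m := p)
      (by exact_mod_cast WithTop.coe_lt_top _) (by simp [uniqueDiffOn_univ])
    simpa [iteratedDerivWithin_univ, differentiableWithinAt_univ] using h2

lemma exists_transition_bound (p : ℕ) : ∃ C : ℝ, 0 ≤ C ∧ ∀ k ≤ p + 1, ∀ x,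
    OffKnots (perfectKnot p) 0 (p + 1) x → |iteratedDeriv k (transition p) x| ≤ C := by
  obtain ⟨δ, hδ0, hδ⟩ : ∃ δ : ℝ, 0 < δ ∧ ∀ a b, a < b → b ≤ p + 1 →
      δ ≤ perfectKnot p b - perfectKnot p a := by
    let T : Finset (ℕ × ℕ) := (Finset.range (p + 2) ×ˢ Finset.range (p + 2)).filter
      fun q => q.1 < q.2
    have hT : T.Nonempty := ⟨(0, p + 1), by simp [T]⟩
    refine ⟨T.inf' hT fun q => perfectKnot p q.2 - perfectKnot p q.1, ?_, ?_⟩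
    · rw [Finset.lt_inf'_iff]
      intro q hq
      simp only [T, Finset.mem_filter, Finset.mem_product, Finset.mem_range] at hq
      exact sub_pos.2 (perfectKnot_simple p (Nat.zero_le _) hq.2 (by omega))
    · intro a b hab hb
      exact Finset.inf'_le (fun q : ℕ × ℕ => perfectKnot p q.2 - perfectKnot p q.1) (b := (a, b))
        (by simp only [T, Finset.mem_filter, Finset.mem_product, Finset.mem_range]; omega)
  have hk : ∀ k, ∃ C : ℝ, ∀ x, OffKnots (perfectKnot p) 0 (p + 1) x →
      |iteratedDeriv k (transition p) x| ≤ C := by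
    intro k
    cases k with
    | zero =>
      refine ⟨((p : ℝ) + 1) / 2 * 2 ^ p * 2, fun x _ => ?_⟩
      rw [iteratedDeriv_zero]
      rcases le_total x (-1) with hx | hx
      · rw [transition_eq_zero hx, abs_zero]; positivity
      rcases le_total x 1 with hx1 | hx1
      · have := intervalIntegral.norm_integral_le_of_norm_le_const (a := -1) (b := x)
          (C := ((p : ℝ) + 1) / 2 * 2 ^ p)
          (f := fun t => ((p : ℝ) + 1) / 2 * bspline (perfectKnot p) p 0 t) (fun t _ => by
            rw [Real.norm_eq_abs, abs_mul, abs_of_nonneg (by positivity)]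
            gcongr
            exact abs_bspline_le (perfectKnot_sorted p) t)
        rw [Real.norm_eq_abs] at this
        refine this.trans ?_
        gcongr
        rw [abs_of_nonneg (by linarith)]
        linarith
      · have h1 := transition_eq_one (p := p) hx1
        have := intervalIntegral.norm_integral_le_of_norm_le_const (a := -1) (b := 1)
          (C := ((p : ℝ) + 1) / 2 * 2 ^ p)
          (f := fun t => ((p : ℝ) + 1) / 2 * bspline (perfectKnot p) p 0 t) (fun t _ => by
            rw [Real.norm_eq_abs, abs_mul, abs_of_nonneg (by positivity)]
            gcongr
            exact abs_bspline_le (perfectKnot_sorted p) t)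
        rw [Real.norm_eq_abs, ← transition, transition_eq_one le_rfl] at this
        rw [h1]
        refine this.trans (le_of_eq ?_)
        norm_num
    | succ k =>
      refine ⟨((p : ℝ) + 1) / 2 * (2 ^ p * (2 * (p : ℝ)) ^ k / δ ^ k), fun x hx => ?_⟩
      rw [iteratedDeriv_succ_transition hx, abs_mul, abs_of_nonneg (by positivity)]
      gcongr
      rw [le_div_iff₀ (by positivity)]
      refine abs_iteratedDeriv_bspline_le k (perfectKnot_sorted p) (by rwa [Nat.zero_add]) hδ0
        fun a b _ hab hb _ _ => hδ a b hab (by rwa [Nat.zero_add] at hb)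
  choose C hC using hk
  refine ⟨∑ k ∈ Finset.range (p + 2), |C k|, by positivity, fun k hkp x hx => ?_⟩
  refine (hC k x hx).trans ((le_abs_self _).trans ?_)
  exact Finset.single_le_sum (f := fun k => |C k|) (fun _ _ => abs_nonneg _)
    (Finset.mem_range.2 (by omega))

end UnivariateSpline

namespace UnivariateSpline

lemma iteratedDeriv_polynomial_eval (q : Polynomial ℝ) (m : ℕ) :
    iteratedDeriv m (fun x => q.eval x) = fun x => (Polynomial.derivative^[m] q).eval x := by
  induction m generalizing q with
  | zero => simp
  | succ m ih =>
    rw [iteratedDeriv_succ', Function.iterate_succ_apply, ← ih]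
    congr 1
    funext x
    exact q.deriv

lemma contDiff_polynomial_eval (q : Polynomial ℝ) {n : WithTop ℕ∞} :
    ContDiff ℝ n (fun x => q.eval x) := by
  simpa using q.contDiff_aeval (R := ℝ) (𝕜 := ℝ) n

/-- The polynomial `(x - ξ_{j+1}) ⋯ (x - ξ_{j+p}) / p!`. -/
noncomputable def nodePoly (ξ : ℕ → ℝ) (p j : ℕ) : Polynomial ℝ :=
  Polynomial.C ((p.factorial : ℝ)⁻¹) *
    ∏ k ∈ Finset.Icc 1 p, (Polynomial.X - Polynomial.C (ξ (j + k)))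

lemma natDegree_prod_nodes (ξ : ℕ → ℝ) (p j : ℕ) :
    (∏ k ∈ Finset.Icc 1 p, (Polynomial.X - Polynomial.C (ξ (j + k)))).natDegree = p := by
  rw [Polynomial.natDegree_prod_of_monic _ _ fun k _ => Polynomial.monic_X_sub_C _]
  simp

lemma natDegree_nodePoly_le (ξ : ℕ → ℝ) (p j : ℕ) : (nodePoly ξ p j).natDegree ≤ p :=
  (Polynomial.natDegree_C_mul_le _ _).trans (natDegree_prod_nodes ξ p j).le

lemma iterate_derivative_nodePoly_succ (ξ : ℕ → ℝ) (p j : ℕ) :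
    Polynomial.derivative^[p + 1] (nodePoly ξ p j) = 0 :=
  Polynomial.iterate_derivative_eq_zero (Nat.lt_succ_of_le (natDegree_nodePoly_le ξ p j))

lemma eval_iterate_derivative_nodePoly (ξ : ℕ → ℝ) (p j : ℕ) (x : ℝ) :
    (Polynomial.derivative^[p] (nodePoly ξ p j)).eval x = 1 := by
  have hm : (∏ k ∈ Finset.Icc 1 p, (Polynomial.X - Polynomial.C (ξ (j + k)))).Monic :=
    Polynomial.monic_prod_of_monic _ _ fun k _ => Polynomial.monic_X_sub_C _
  have hd : (Polynomial.derivative^[p] (nodePoly ξ p j)).natDegree = 0 := by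
    have := Polynomial.natDegree_iterate_derivative (nodePoly ξ p j) p
    have := natDegree_nodePoly_le ξ p j
    omega
  have hc := hm.coeff_natDegree
  rw [natDegree_prod_nodes] at hc
  rw [Polynomial.eq_C_of_natDegree_eq_zero hd, Polynomial.eval_C,
    Polynomial.coeff_iterate_derivative, Nat.zero_add, Nat.descFactorial_self, nodePoly,
    Polynomial.coeff_C_mul, hc, nsmul_eq_mul, mul_one]
  exact mul_inv_cancel₀ (by exact_mod_cast p.factorial_ne_zero)

lemma eval_iterate_derivative_nodePoly_eq_zero {ξ : ℕ → ℝ} {p j a m : ℕ} (ha : j + 1 ≤ a)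
    (ham : a + m ≤ j + p) (h : SortedKnots ξ a (a + m)) (he : ξ a = ξ (a + m)) {s : ℕ}
    (hs : s ≤ m) : (Polynomial.derivative^[s] (nodePoly ξ p j)).eval (ξ a) = 0 := by
  have hdvd : (Polynomial.X - Polynomial.C (ξ a)) ^ (m + 1) ∣ nodePoly ξ p j := by
    refine Dvd.dvd.mul_left ?_ _
    have hsub : Finset.Icc (a - j) (a + m - j) ⊆ Finset.Icc 1 p := by
      intro k hk
      rw [Finset.mem_Icc] at hk ⊢
      omega
    refine dvd_trans (dvd_of_eq ?_) (Finset.prod_dvd_prod_of_subset _ _ _ hsub)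
    rw [Finset.prod_congr rfl (g := fun _ => Polynomial.X - Polynomial.C (ξ a)),
      Finset.prod_const, Nat.card_Icc]
    · congr 1; omega
    · intro k hk
      rw [Finset.mem_Icc] at hk
      have h1 : ξ a ≤ ξ (j + k) := h (by omega) (by omega) (by omega)
      have h2 : ξ (j + k) ≤ ξ (a + m) := h (by omega) (by omega) (by omega)
      rw [le_antisymm (h2.trans he.ge) h1]
  have h1 := Polynomial.pow_sub_dvd_iterate_derivative_of_pow_dvd s hdvd
  have h2 : (Polynomial.X - Polynomial.C (ξ a)) ∣ Polynomial.derivative^[s] (nodePoly ξ p j) :=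
    (dvd_pow_self _ (by omega)).trans h1
  exact Polynomial.dvd_iff_isRoot.1 h2

lemma iterate_derivative_X_sub_C_mul (c : ℝ) (q : Polynomial ℝ) (s : ℕ) :
    Polynomial.derivative^[s + 1] ((Polynomial.X - Polynomial.C c) * q)
      = (Polynomial.X - Polynomial.C c) * Polynomial.derivative^[s + 1] q
        + ((s : Polynomial ℝ) + 1) * Polynomial.derivative^[s] q := by
  induction s with
  | zero => simp; ring
  | succ s ih =>
    rw [Function.iterate_succ_apply', ih]
    simp only [Function.iterate_succ_apply', Polynomial.derivative_add, Polynomial.derivative_mul,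
      Polynomial.derivative_sub, Polynomial.derivative_X, Polynomial.derivative_C,
      Polynomial.derivative_one, Polynomial.derivative_natCast]
    push_cast
    ring

lemma abs_eval_iterate_derivative_prod_le {ι : Type*} (T : Finset ι) (c : ι → ℝ) {x H : ℝ}
    (hH : 0 ≤ H) (hc : ∀ k ∈ T, |x - c k| ≤ H) (s : ℕ) :
    |(Polynomial.derivative^[s] (∏ k ∈ T, (Polynomial.X - Polynomial.C (c k)))).eval x| * H ^ s
      ≤ ((s : ℝ) + 1) ^ T.card * H ^ T.card := by
  classical
  induction T using Finset.induction_on generalizing s with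
  | empty =>
    cases s with
    | zero => simp
    | succ s => simp
  | insert k T hk ih =>
    have hck := hc k (Finset.mem_insert_self _ _)
    have ih' := ih fun i hi => hc i (Finset.mem_insert_of_mem hi)
    rw [Finset.prod_insert hk, Finset.card_insert_of_notMem hk]
    set Q := ∏ k ∈ T, (Polynomial.X - Polynomial.C (c k))
    set t := T.card
    cases s with
    | zero =>
      have := ih' 0
      simp only [Function.iterate_zero, id, pow_zero, mul_one, Nat.cast_zero, zero_add, one_pow,
        one_mul] at this ⊢
      rw [Polynomial.eval_mul, abs_mul, pow_succ, mul_comm]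
      gcongr
      simpa using hck
    | succ s =>
      have h1 := ih' (s + 1)
      have h2 := ih' s
      rw [iterate_derivative_X_sub_C_mul]
      simp only [Polynomial.eval_add, Polynomial.eval_mul, Polynomial.eval_sub, Polynomial.eval_X,
        Polynomial.eval_C, Polynomial.eval_natCast, Polynomial.eval_one]
      set A := (Polynomial.derivative^[s + 1] Q).eval x
      set B := (Polynomial.derivative^[s] Q).eval x
      push_cast at h1 ⊢
      calc |(x - c k) * A + ((s : ℝ) + 1) * B| * H ^ (s + 1)
          ≤ (|(x - c k) * A| + |((s : ℝ) + 1) * B|) * H ^ (s + 1) := by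
            gcongr; exact abs_add_le _ _
        _ = |x - c k| * (|A| * H ^ (s + 1)) + ((s : ℝ) + 1) * H * (|B| * H ^ s) := by
            rw [abs_mul, abs_mul, abs_of_nonneg (by positivity : (0 : ℝ) ≤ (s : ℝ) + 1)]; ring
        _ ≤ H * (((s : ℝ) + 1 + 1) ^ t * H ^ t)
              + ((s : ℝ) + 1) * H * (((s : ℝ) + 1) ^ t * H ^ t) := by gcongr
        _ ≤ H * (((s : ℝ) + 1 + 1) ^ t * H ^ t)
              + ((s : ℝ) + 1) * H * (((s : ℝ) + 1 + 1) ^ t * H ^ t) := by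
            gcongr; linarith
        _ = ((s : ℝ) + 1 + 1) ^ (t + 1) * H ^ (t + 1) := by ring

lemma abs_eval_iterate_derivative_nodePoly_le {ξ : ℕ → ℝ} {p j : ℕ}
    (h : SortedKnots ξ j (j + p + 1)) {x : ℝ} (hx : x ∈ Icc (ξ j) (ξ (j + p + 1))) {s : ℕ}
    (hs : s ≤ p + 1) :
    |(Polynomial.derivative^[s] (nodePoly ξ p j)).eval x| * (ξ (j + p + 1) - ξ j) ^ s
      ≤ ((p : ℝ) + 2) ^ p * (ξ (j + p + 1) - ξ j) ^ p := by
  have hH : 0 ≤ ξ (j + p + 1) - ξ j := by linarith [hx.1, hx.2]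
  have key := abs_eval_iterate_derivative_prod_le (Finset.Icc 1 p) (fun k => ξ (j + k)) (x := x)
    hH (fun k hk => by
      rw [Finset.mem_Icc] at hk
      have h1 : ξ j ≤ ξ (j + k) := h (by omega) (by omega) (by omega)
      have h2 : ξ (j + k) ≤ ξ (j + p + 1) := h (by omega) (by omega) (by omega)
      rw [abs_le]
      constructor <;> linarith [hx.1, hx.2]) s
  rw [Nat.card_Icc, Nat.add_sub_cancel] at key
  have hs' : (s : ℝ) + 1 ≤ p + 2 := by
    have : (s : ℝ) ≤ p + 1 := by exact_mod_cast hs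
    linarith
  rw [nodePoly, Polynomial.iterate_derivative_C_mul, Polynomial.eval_mul, Polynomial.eval_C,
    abs_mul, abs_of_nonneg (by positivity), mul_assoc]
  calc _ ≤ 1 * (((s : ℝ) + 1) ^ p * (ξ (j + p + 1) - ξ j) ^ p) := by
        gcongr
        exact inv_le_one_of_one_le₀ (by exact_mod_cast p.factorial_pos)
    _ ≤ _ := by
        rw [one_mul]
        gcongr

/-! ### Products and affine substitutions of piecewise smooth functions -/

lemma PiecewiseSmooth.hasDerivAt_iteratedDeriv_mul {p : ℕ} {K φ : ℝ → ℝ} (hK : ContDiff ℝ p K)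
    (hφ : ContDiff ℝ ∞ φ) {x : ℝ} (hx : DifferentiableAt ℝ (iteratedDeriv p K) x) :
    HasDerivAt (iteratedDeriv p (fun y => K y * φ y))
      (∑ i ∈ Finset.range (p + 1), ((p.choose i : ℝ) * iteratedDeriv (i + 1) K x
        * iteratedDeriv (p - i) φ x
        + (p.choose i : ℝ) * iteratedDeriv i K x * iteratedDeriv (p - i + 1) φ x)) x := by
  have e : iteratedDeriv p (fun y => K y * φ y) = fun y => ∑ i ∈ Finset.range (p + 1),
      (p.choose i : ℝ) * iteratedDeriv i K y * iteratedDeriv (p - i) φ y := by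
    funext y
    exact iteratedDeriv_fun_mul hK.contDiffAt
      (hφ.of_le (by exact_mod_cast le_top)).contDiffAt
  have hlt : ∀ k : ℕ, (k : WithTop ℕ∞) < ((⊤ : ℕ∞) : WithTop ℕ∞) := fun k => by exact_mod_cast WithTop.coe_lt_top _
  rw [e]
  refine HasDerivAt.fun_sum fun i hi => ?_
  rw [Finset.mem_range] at hi
  have h1 : HasDerivAt (iteratedDeriv i K) (iteratedDeriv (i + 1) K x) x := by
    rw [iteratedDeriv_succ]
    refine DifferentiableAt.hasDerivAt ?_
    rcases Nat.lt_succ_iff_lt_or_eq.1 hi with h | rfl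
    · exact hK.differentiable_iteratedDeriv i (by exact_mod_cast h) x
    · exact hx
  have h2 : HasDerivAt (iteratedDeriv (p - i) φ) (iteratedDeriv (p - i + 1) φ x) x := by
    rw [iteratedDeriv_succ]
    exact (hφ.differentiable_iteratedDeriv (p - i) (hlt _) x).hasDerivAt
  exact (h1.const_mul _).mul h2

lemma PiecewiseSmooth.mul {p : ℕ} {K φ : ℝ → ℝ} (hK : PiecewiseSmooth p K)
    (hφ : ContDiff ℝ ∞ φ) : PiecewiseSmooth p (fun y => K y * φ y) := by
  obtain ⟨S, hS, hd⟩ := hK.exists_finite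
  refine ⟨hK.contDiff.mul (hφ.of_le (by exact_mod_cast le_top)), ⟨S, hS, fun x hx =>
    (hasDerivAt_iteratedDeriv_mul hK.contDiff hφ (hd x hx)).differentiableAt⟩, fun a b => ?_⟩
  have hcφ : ∀ k, Continuous (iteratedDeriv k φ) := fun k =>
    hφ.continuous_iteratedDeriv k (by exact_mod_cast le_top)
  have hi : IntervalIntegrable (fun x => ∑ i ∈ Finset.range (p + 1),
      ((p.choose i : ℝ) * iteratedDeriv (i + 1) K x * iteratedDeriv (p - i) φ x
        + (p.choose i : ℝ) * iteratedDeriv i K x * iteratedDeriv (p - i + 1) φ x)) volume a b := by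
    have := IntervalIntegrable.sum (μ := volume) (a := a) (b := b) (Finset.range (p + 1))
      (f := fun i x => ((p.choose i : ℝ) * iteratedDeriv (i + 1) K x * iteratedDeriv (p - i) φ x
        + (p.choose i : ℝ) * iteratedDeriv i K x * iteratedDeriv (p - i + 1) φ x)) ?_
    · simpa only [Finset.sum_fn] using this
    intro i hi
    rw [Finset.mem_range] at hi
    refine IntervalIntegrable.add ?_ ?_
    · refine IntervalIntegrable.mul_continuousOn (IntervalIntegrable.const_mul ?_ _)
        (hcφ _).continuousOn
      rcases Nat.lt_succ_iff_lt_or_eq.1 hi with h | rfl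
      · exact (hK.contDiff.continuous_iteratedDeriv (i + 1) (by exact_mod_cast h)).intervalIntegrable
          a b
      · exact hK.intervalIntegrable a b
    · refine IntervalIntegrable.mul_continuousOn (IntervalIntegrable.const_mul ?_ _)
        (hcφ _).continuousOn
      exact (hK.contDiff.continuous_iteratedDeriv i
        (by exact_mod_cast Nat.lt_succ_iff.1 hi)).intervalIntegrable a b
  refine hi.congr_ae (ae_restrict_of_ae ?_)
  filter_upwards [hS.countable.ae_notMem volume] with x hx
  rw [iteratedDeriv_succ]
  exact (hasDerivAt_iteratedDeriv_mul hK.contDiff hφ (hd x hx)).deriv.symm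

lemma PiecewiseSmooth.sub {p : ℕ} {f h : ℝ → ℝ} (hf : PiecewiseSmooth p f)
    (hh : ContDiff ℝ ∞ h) : PiecewiseSmooth p (f - h) ∧
      ∀ᵐ x, iteratedDeriv (p + 1) (f - h) x
        = iteratedDeriv (p + 1) f x - iteratedDeriv (p + 1) h x := by
  obtain ⟨S, hS, hd⟩ := hf.exists_finite
  have hhp : ContDiff ℝ p h := hh.of_le (by exact_mod_cast le_top)
  have e : iteratedDeriv p (f - h) = fun y => iteratedDeriv p f y - iteratedDeriv p h y :=
    funext fun y => iteratedDeriv_sub hf.contDiff.contDiffAt hhp.contDiffAt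
  have hd2 : Differentiable ℝ (iteratedDeriv p h) :=
    hh.differentiable_iteratedDeriv p (by exact_mod_cast WithTop.coe_lt_top _)
  have ae : ∀ᵐ x, iteratedDeriv (p + 1) (f - h) x
      = iteratedDeriv (p + 1) f x - iteratedDeriv (p + 1) h x := by
    filter_upwards [hS.countable.ae_notMem volume] with x hx
    rw [iteratedDeriv_succ, iteratedDeriv_succ, iteratedDeriv_succ, e]
    exact deriv_fun_sub (hd x hx) (hd2 x)
  refine ⟨⟨hf.contDiff.sub hhp, ⟨S, hS, fun x hx => ?_⟩, fun a b => ?_⟩, ae⟩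
  · rw [e]; exact (hd x hx).sub (hd2 x)
  · refine ((hf.intervalIntegrable a b).sub ((hh.continuous_iteratedDeriv (p + 1)
      (by exact_mod_cast le_top)).intervalIntegrable a b)).congr_ae (ae_restrict_of_ae ?_)
    filter_upwards [ae] with x hx
    exact hx.symm

lemma iteratedDeriv_comp_affine (g : ℝ → ℝ) (α β : ℝ) (k : ℕ) :
    iteratedDeriv k (fun x => g (α * x + β))
      = fun x => α ^ k * iteratedDeriv k g (α * x + β) := by
  induction k with
  | zero => simp
  | succ k ih =>
    funext x
    rw [iteratedDeriv_succ, ih, deriv_const_mul_field]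
    have := deriv_comp_mul_left α (fun y => iteratedDeriv k g (y + β)) x
    rw [this, deriv_comp_add_const, smul_eq_mul, iteratedDeriv_succ]
    ring

lemma piecewiseSmooth_transition_comp (p : ℕ) {α : ℝ} (hα : α ≠ 0) (β : ℝ) :
    PiecewiseSmooth p (fun x => transition p (α * x + β)) := by
  obtain ⟨C, -, hC⟩ := exists_transition_bound p
  set S : Set ℝ := (fun x => α * x + β) ⁻¹' knotSet (perfectKnot p) 0 (p + 1) with hSdef
  have hS : S.Finite := (finite_knotSet _ _ _).preimage fun x _ y _ hxy => by
    have : α * x + β = α * y + β := hxy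
    exact mul_left_cancel₀ hα (by linarith)
  refine ⟨(contDiff_transition p).comp (by fun_prop), ⟨S, hS, fun x hx => ?_⟩, fun a b => ?_⟩
  · rw [iteratedDeriv_comp_affine]
    refine DifferentiableAt.const_mul ?_ _
    exact DifferentiableAt.comp (g := iteratedDeriv p (transition p)) x
      (differentiableAt_iteratedDeriv_transition (notMem_knotSet.1 hx)) (by fun_prop)
  · refine intervalIntegrable_of_bounded (C := |α ^ (p + 1)| * C) ?_ ?_ a b
    · rw [iteratedDeriv_succ]; exact measurable_deriv _
    · filter_upwards [hS.countable.ae_notMem volume] with x hx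
      rw [iteratedDeriv_comp_affine, abs_mul]
      gcongr
      exact hC _ le_rfl _ (notMem_knotSet.1 hx)

end UnivariateSpline

namespace UnivariateSpline

lemma dualKernel_eq (ξ : ℕ → ℝ) (p j : ℕ) :
    dualKernel ξ p j = fun x => transition p (2 / (ξ (j + p + 1) - ξ j) * x
      + -(ξ j + ξ (j + p + 1)) / (ξ (j + p + 1) - ξ j)) * (nodePoly ξ p j).eval x := by
  funext x
  simp only [dualKernel, nodePoly, Polynomial.eval_mul, Polynomial.eval_C, Polynomial.eval_prod,
    Polynomial.eval_sub, Polynomial.eval_X]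
  congr 1
  · congr 1; ring
  · ring

lemma dualKernel_of_le {ξ : ℕ → ℝ} {p j : ℕ} (h : ξ j < ξ (j + p + 1)) {x : ℝ} (hx : x ≤ ξ j) :
    dualKernel ξ p j x = 0 := by
  rw [dualKernel, transition_eq_zero, zero_mul]
  rw [div_le_iff₀ (by linarith)]
  linarith

lemma dualKernel_of_ge {ξ : ℕ → ℝ} {p j : ℕ} (h : ξ j < ξ (j + p + 1)) {x : ℝ}
    (hx : ξ (j + p + 1) ≤ x) : dualKernel ξ p j x = (nodePoly ξ p j).eval x := by
  rw [dualKernel_eq]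
  simp only
  rw [transition_eq_one, one_mul]
  have : 2 / (ξ (j + p + 1) - ξ j) * x + -(ξ j + ξ (j + p + 1)) / (ξ (j + p + 1) - ξ j)
      = (2 * x - (ξ j + ξ (j + p + 1))) / (ξ (j + p + 1) - ξ j) := by ring
  rw [this, le_div_iff₀ (by linarith)]
  linarith

lemma piecewiseSmooth_dualKernel {ξ : ℕ → ℝ} {p j : ℕ} (h : ξ j < ξ (j + p + 1)) :
    PiecewiseSmooth p (dualKernel ξ p j) := by
  rw [dualKernel_eq]
  exact (piecewiseSmooth_transition_comp p
    (div_ne_zero two_ne_zero (by linarith : ξ (j + p + 1) - ξ j ≠ 0)) _).mul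
    (contDiff_polynomial_eval _)

lemma iteratedDeriv_dualKernel_of_le {ξ : ℕ → ℝ} {p j : ℕ} (h : ξ j < ξ (j + p + 1)) {x : ℝ}
    (hx : x ≤ ξ j) {m : ℕ} (hm : m ≤ p) : iteratedDeriv m (dualKernel ξ p j) x = 0 := by
  have h1 : EqOn (dualKernel ξ p j) (fun _ => 0) (Iio (ξ j)) :=
    fun y hy => dualKernel_of_le h (le_of_lt hy)
  have h2 := (h1.iteratedDeriv_of_isOpen isOpen_Iio m).closure
    ((piecewiseSmooth_dualKernel h).contDiff.continuous_iteratedDeriv m (by exact_mod_cast hm))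
    (contDiff_const.continuous_iteratedDeriv' m)
  rw [closure_Iio] at h2
  rw [h2 hx, iteratedDeriv_fun_const_zero]

lemma iteratedDeriv_dualKernel_of_ge {ξ : ℕ → ℝ} {p j : ℕ} (h : ξ j < ξ (j + p + 1)) {x : ℝ}
    (hx : ξ (j + p + 1) ≤ x) {m : ℕ} (hm : m ≤ p) :
    iteratedDeriv m (dualKernel ξ p j) x = (Polynomial.derivative^[m] (nodePoly ξ p j)).eval x := by
  have h1 : EqOn (dualKernel ξ p j) (fun y => (nodePoly ξ p j).eval y) (Ioi (ξ (j + p + 1))) :=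
    fun y hy => dualKernel_of_ge h (le_of_lt hy)
  have h2 := (h1.iteratedDeriv_of_isOpen isOpen_Ioi m).closure
    ((piecewiseSmooth_dualKernel h).contDiff.continuous_iteratedDeriv m (by exact_mod_cast hm))
    ((contDiff_polynomial_eval _).continuous_iteratedDeriv' m)
  rw [closure_Ioi] at h2
  rw [h2 hx, iteratedDeriv_polynomial_eval]

lemma iteratedDeriv_succ_dualKernel_eq_zero {ξ : ℕ → ℝ} {p j : ℕ} (h : ξ j < ξ (j + p + 1)) {x : ℝ}
    (hx : x ∉ Icc (ξ j) (ξ (j + p + 1))) : iteratedDeriv (p + 1) (dualKernel ξ p j) x = 0 := by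
  rcases lt_or_ge x (ξ j) with h1 | h1
  · have : dualKernel ξ p j =ᶠ[nhds x] fun _ => 0 := by
      filter_upwards [gt_mem_nhds h1] with y hy using dualKernel_of_le h (le_of_lt hy)
    rw [this.iteratedDeriv_eq, iteratedDeriv_fun_const_zero]
  · have h2 : ξ (j + p + 1) < x := by
      by_contra! hc
      exact hx ⟨h1, hc⟩
    have : dualKernel ξ p j =ᶠ[nhds x] fun y => (nodePoly ξ p j).eval y := by
      filter_upwards [lt_mem_nhds h2] with y hy using dualKernel_of_ge h (le_of_lt hy)
    rw [this.iteratedDeriv_eq, iteratedDeriv_polynomial_eval, iterate_derivative_nodePoly_succ]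
    simp

lemma iteratedDeriv_dualKernel_knot {ξ : ℕ → ℝ} {p j a m : ℕ} (h : ξ j < ξ (j + p + 1))
    (ha : j + 1 ≤ a) (ham : a + m ≤ j + p) (hs : SortedKnots ξ a (a + m)) (he : ξ a = ξ (a + m)) :
    iteratedDeriv m (dualKernel ξ p j) (ξ a) = 0 := by
  have hK := piecewiseSmooth_transition_comp p
    (div_ne_zero two_ne_zero (by linarith : ξ (j + p + 1) - ξ j ≠ 0))
    (-(ξ j + ξ (j + p + 1)) / (ξ (j + p + 1) - ξ j))
  rw [dualKernel_eq, iteratedDeriv_fun_mul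
    (hK.contDiff.of_le (by exact_mod_cast (by omega : m ≤ p))).contDiffAt
    (contDiff_polynomial_eval _).contDiffAt]
  refine Finset.sum_eq_zero fun i _ => ?_
  rw [iteratedDeriv_polynomial_eval]
  simp only
  rw [eval_iterate_derivative_nodePoly_eq_zero ha ham hs he (by omega), mul_zero]

/-- A bound for the density of the dual functional in terms of the length of the support. -/
lemma exists_dualKernel_bound (p : ℕ) : ∃ C : ℝ, 0 ≤ C ∧ ∀ (ξ : ℕ → ℝ) (j : ℕ),
    SortedKnots ξ j (j + p + 1) → ξ j < ξ (j + p + 1) →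
    ∀ᵐ x, |iteratedDeriv (p + 1) (dualKernel ξ p j) x| ≤ C / (ξ (j + p + 1) - ξ j) := by
  obtain ⟨C, hC0, hC⟩ := exists_transition_bound p
  refine ⟨∑ i ∈ Finset.range (p + 1), (p.choose i : ℝ) * (2 ^ (i + 1) + 2 ^ i)
    * (C * ((p : ℝ) + 2) ^ p), by positivity, fun ξ j hs h => ?_⟩
  set H := ξ (j + p + 1) - ξ j with hHdef
  have hH : 0 < H := by linarith
  set β := -(ξ j + ξ (j + p + 1)) / H with hβ
  have hα : (2 / H) ≠ 0 := by positivity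
  have hK := piecewiseSmooth_transition_comp p hα β
  have hS : ((fun x => 2 / H * x + β) ⁻¹' knotSet (perfectKnot p) 0 (p + 1)).Finite :=
    (finite_knotSet _ _ _).preimage fun x _ y _ hxy => by
      have : 2 / H * x + β = 2 / H * y + β := hxy
      exact mul_left_cancel₀ hα (by linarith)
  filter_upwards [hS.countable.ae_notMem volume] with x hx
  have hO : OffKnots (perfectKnot p) 0 (p + 1) (2 / H * x + β) := notMem_knotSet.1 hx
  by_cases hxI : x ∈ Icc (ξ j) (ξ (j + p + 1))
  swap
  · rw [iteratedDeriv_succ_dualKernel_eq_zero h hxI, abs_zero]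
    positivity
  have hdiff : DifferentiableAt ℝ (iteratedDeriv p fun x => transition p (2 / H * x + β)) x := by
    rw [iteratedDeriv_comp_affine]
    exact DifferentiableAt.const_mul (DifferentiableAt.comp (g := iteratedDeriv p (transition p)) x
      (differentiableAt_iteratedDeriv_transition hO) (by fun_prop)) _
  have hder := (PiecewiseSmooth.hasDerivAt_iteratedDeriv_mul hK.contDiff
    (contDiff_polynomial_eval (nodePoly ξ p j)) hdiff).deriv
  rw [← iteratedDeriv_succ] at hder
  rw [dualKernel_eq, ← hHdef, ← hβ, hder, Finset.sum_div]
  refine (Finset.abs_sum_le_sum_abs _ _).trans (Finset.sum_le_sum fun i hi => ?_)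
  rw [Finset.mem_range] at hi
  have bG : ∀ k ≤ p + 1, |iteratedDeriv k (fun x => transition p (2 / H * x + β)) x| * H ^ k
      ≤ 2 ^ k * C := by
    intro k hk
    rw [iteratedDeriv_comp_affine, abs_mul, abs_of_nonneg (by positivity)]
    calc (2 / H) ^ k * |iteratedDeriv k (transition p) (2 / H * x + β)| * H ^ k
        = (2 / H * H) ^ k * |iteratedDeriv k (transition p) (2 / H * x + β)| := by
          rw [mul_pow]; ring
      _ ≤ 2 ^ k * C := by
          rw [div_mul_cancel₀ _ hH.ne']
          gcongr
          exact hC k hk _ hO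
  have bφ : ∀ k ≤ p + 1, |iteratedDeriv k (fun x => (nodePoly ξ p j).eval x) x| * H ^ k
      ≤ ((p : ℝ) + 2) ^ p * H ^ p := by
    intro k hk
    rw [iteratedDeriv_polynomial_eval]
    exact abs_eval_iterate_derivative_nodePoly_le hs hxI hk
  have prod : ∀ k l, k + l = p + 1 → |iteratedDeriv k (fun x => transition p (2 / H * x + β)) x
      * iteratedDeriv l (fun x => (nodePoly ξ p j).eval x) x|
      ≤ 2 ^ k * (C * ((p : ℝ) + 2) ^ p) / H := by
    intro k l hkl
    rw [abs_mul]
    set A := |iteratedDeriv k (fun x => transition p (2 / H * x + β)) x|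
    set B := |iteratedDeriv l (fun x => (nodePoly ξ p j).eval x) x|
    have h1 : A * H ^ k * (B * H ^ l) ≤ 2 ^ k * C * (((p : ℝ) + 2) ^ p * H ^ p) :=
      mul_le_mul (bG k (by omega)) (bφ l (by omega)) (by positivity) (by positivity)
    have h2 : A * H ^ k * (B * H ^ l) = A * B * H * H ^ p := by
      rw [show A * H ^ k * (B * H ^ l) = A * B * H ^ (k + l) by ring, hkl]; ring
    rw [le_div_iff₀ hH]
    have hHp : 0 < H ^ p := by positivity
    refine le_of_mul_le_mul_right ?_ hHp
    rw [← h2]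
    refine h1.trans (le_of_eq (by ring))
  have t1 := prod (i + 1) (p - i) (by omega)
  have t2 := prod i (p - i + 1) (by omega)
  rw [mul_assoc, mul_assoc, ← mul_add, abs_mul, abs_of_nonneg (by positivity)]
  calc _ ≤ (p.choose i : ℝ) * (2 ^ (i + 1) * (C * ((p : ℝ) + 2) ^ p) / H
        + 2 ^ i * (C * ((p : ℝ) + 2) ^ p) / H) := by
        gcongr
        exact (abs_add_le _ _).trans (add_le_add t1 t2)
    _ = _ := by ring

/-! ### Biorthogonality -/

lemma intervalIntegrable_mul_dualKernel {ξ : ℕ → ℝ} {p j : ℕ} (hs : SortedKnots ξ j (j + p + 1))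
    (h : ξ j < ξ (j + p + 1)) {v : ℝ → ℝ} {a b : ℝ} (hv : IntervalIntegrable v volume a b) :
    IntervalIntegrable (fun x => v x * iteratedDeriv (p + 1) (dualKernel ξ p j) x) volume a b := by
  obtain ⟨C, -, hC⟩ := exists_dualKernel_bound p
  have hm : Measurable (iteratedDeriv (p + 1) (dualKernel ξ p j)) := by
    rw [iteratedDeriv_succ]; exact measurable_deriv _
  rw [intervalIntegrable_iff] at hv ⊢
  refine hv.mul_bdd (c := C / (ξ (j + p + 1) - ξ j)) hm.aestronglyMeasurable ?_
  exact ae_restrict_of_ae (hC ξ j hs h)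

lemma dualFunctional_bspline_of_ne {ξ : ℕ → ℝ} {p n : ℕ} (hs : SortedKnots ξ 0 (n + p)) {i j : ℕ}
    (hi : i < n) (hj : j < n) (h : ξ j < ξ (j + p + 1)) (hij : i ≠ j) :
    dualFunctional ξ p j (bspline ξ p i) = 0 := by
  have hsi : SortedKnots ξ i (i + p + 1) := hs.mono (by omega) (by omega)
  rw [dualFunctional, ← integral_eq_intervalIntegral_of_eq_zero h.le
    (fun x hx => by rw [iteratedDeriv_succ_dualKernel_eq_zero h hx, mul_zero])]
  have hψ := piecewiseSmooth_dualKernel h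
  rcases lt_or_gt_of_ne hij with hlt | hgt
  · refine integral_bspline_mul_iteratedDeriv_eq_zero hsi hψ fun a m ha ham hm he => ?_
    rcases le_or_gt (ξ a) (ξ j) with hc | hc
    · exact iteratedDeriv_dualKernel_of_le h hc hm
    · have : j + 1 ≤ a := by
        by_contra! hcc
        exact absurd (hs (Nat.zero_le a) (by omega : a ≤ j) (by omega)) (not_le.2 hc)
      exact iteratedDeriv_dualKernel_knot h this (by omega) (hs.mono (by omega) (by omega)) he
  · have hφ : ContDiff ℝ ∞ fun y => (nodePoly ξ p j).eval y := contDiff_polynomial_eval _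
    obtain ⟨hf, hae⟩ := hψ.sub hφ
    have e : ∫ x, bspline ξ p i x * iteratedDeriv (p + 1) (dualKernel ξ p j) x
        = ∫ x, bspline ξ p i x * iteratedDeriv (p + 1)
          (dualKernel ξ p j - fun y => (nodePoly ξ p j).eval y) x := by
      refine integral_congr_ae ?_
      filter_upwards [hae] with x hx
      rw [hx, iteratedDeriv_polynomial_eval, iterate_derivative_nodePoly_succ]
      simp
    rw [e]
    refine integral_bspline_mul_iteratedDeriv_eq_zero hsi hf fun a m ha ham hm he => ?_
    rw [iteratedDeriv_sub (hψ.contDiff.of_le (by exact_mod_cast hm)).contDiffAt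
      (contDiff_polynomial_eval _).contDiffAt, iteratedDeriv_polynomial_eval]
    simp only
    rcases le_or_gt (ξ (j + p + 1)) (ξ a) with hc | hc
    · rw [iteratedDeriv_dualKernel_of_ge h hc hm, sub_self]
    · have : a + m ≤ j + p := by
        by_contra! hcc
        exact absurd (hs (Nat.zero_le _) (by omega : j + p + 1 ≤ a + m) (by omega))
          (not_le.2 (he ▸ hc))
      rw [iteratedDeriv_dualKernel_knot h (by omega) this (hs.mono (by omega) (by omega)) he,
        eval_iterate_derivative_nodePoly_eq_zero (by omega) this (hs.mono (by omega) (by omega)) he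
          le_rfl, sub_self]

lemma dualFunctional_one {ξ : ℕ → ℝ} {p j : ℕ} (h : ξ j < ξ (j + p + 1)) :
    dualFunctional ξ p j (fun _ => 1) = 1 := by
  have hψ := piecewiseSmooth_dualKernel h
  obtain ⟨S, hS, hd⟩ := hψ.exists_finite
  rw [dualFunctional]
  simp only [one_mul]
  rw [integral_eq_of_hasDerivAt_off_countable_of_le (iteratedDeriv p (dualKernel ξ p j)) _ h.le
    hS.countable (hψ.contDiff.continuous_iteratedDeriv p le_rfl).continuousOn
    (fun x hx => by
      have := (hd x hx.2).hasDerivAt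
      rwa [← iteratedDeriv_succ] at this) (hψ.intervalIntegrable _ _),
    iteratedDeriv_dualKernel_of_le h le_rfl le_rfl, iteratedDeriv_dualKernel_of_ge h le_rfl le_rfl,
    eval_iterate_derivative_nodePoly, sub_zero]

lemma dualFunctional_congr {ξ : ℕ → ℝ} {p j : ℕ} (h : ξ j < ξ (j + p + 1)) {v w : ℝ → ℝ}
    (hvw : ∀ᵐ x, x ∈ Ioo (ξ j) (ξ (j + p + 1)) → v x = w x) :
    dualFunctional ξ p j v = dualFunctional ξ p j w := by
  refine intervalIntegral.integral_congr_ae ?_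
  filter_upwards [hvw, (Set.countable_singleton (ξ (j + p + 1))).ae_notMem volume] with x hx hx2 hx3
  rw [uIoc_of_le h.le] at hx3
  rw [hx ⟨hx3.1, lt_of_le_of_ne hx3.2 hx2⟩]

lemma dualFunctional_sum {ξ : ℕ → ℝ} {p n j : ℕ} (hs : SortedKnots ξ 0 (n + p)) (hj : j < n)
    (h : ξ j < ξ (j + p + 1)) (c : ℕ → ℝ) :
    dualFunctional ξ p j (fun x => ∑ i ∈ Finset.range n, c i * bspline ξ p i x)
      = ∑ i ∈ Finset.range n, c i * dualFunctional ξ p j (bspline ξ p i) := by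
  have hsj : SortedKnots ξ j (j + p + 1) := hs.mono (by omega) (by omega)
  simp only [dualFunctional, Finset.sum_mul]
  rw [intervalIntegral.integral_finsetSum]
  · refine Finset.sum_congr rfl fun i _ => ?_
    rw [← intervalIntegral.integral_const_mul]
    simp only [mul_assoc]
  · intro i hi
    rw [Finset.mem_range] at hi
    exact intervalIntegrable_mul_dualKernel hsj h
      ((intervalIntegrable_bspline (hs.mono (by omega) (by omega)) _ _).const_mul _)

/-! ### Open knot vectors -/

variable {p n : ℕ} {ξ : ℕ → ℝ}

lemma IsOpenKnotVector.sorted (h : IsOpenKnotVector p n ξ) : SortedKnots ξ 0 (n + p) :=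
  fun _ _ _ h2 h3 => h.mono _ _ h2 h3

lemma IsOpenKnotVector.sorted_sub (h : IsOpenKnotVector p n ξ) {j m : ℕ} (hj : m ≤ n + p) :
    SortedKnots ξ j m := h.sorted.mono (Nat.zero_le _) hj

lemma IsOpenKnotVector.lt (h : IsOpenKnotVector p n ξ) : p < n := by
  by_contra! hc
  have h1 := h.eq_zero n hc
  have h2 := h.eq_one n le_rfl (by omega)
  linarith

lemma IsOpenKnotVector.nonneg (h : IsOpenKnotVector p n ξ) {j : ℕ} (hj : j ≤ n + p) : 0 ≤ ξ j := by
  rw [← h.eq_zero 0 (Nat.zero_le _)]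
  exact h.mono _ _ (Nat.zero_le _) hj

lemma IsOpenKnotVector.le_one (h : IsOpenKnotVector p n ξ) {j : ℕ} (hj : j ≤ n + p) : ξ j ≤ 1 := by
  rw [← h.eq_one (n + p) (by omega) le_rfl]
  exact h.mono _ _ hj le_rfl

/-- A knot that is repeated `m + 1` times, in positions `j, …, j + m` and inside `(0,1)`, has
multiplicity at least `m + 1`. -/
lemma HasRegularity.lt_of_mem (h : IsOpenKnotVector p n ξ) {r : ℤ} (hr : HasRegularity p n ξ r)
    {j m : ℕ} (hj : j + m ≤ n + p) (h0 : 0 < ξ j) (h1 : ξ j < 1) (hm : (p : ℤ) - r ≤ m) :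
    ξ j < ξ (j + m) := by
  refine lt_of_le_of_ne (h.mono _ _ (by omega) hj) fun he => ?_
  have h2 := hr j (by omega) h0 h1
  have hsub : Icc j (j + m) ⊆ {k : ℕ | k ≤ n + p ∧ ξ k = ξ j} := by
    intro k hk
    refine ⟨hk.2.trans hj, le_antisymm ?_ (h.mono _ _ hk.1 (hk.2.trans hj))⟩
    rw [he]
    exact h.mono _ _ hk.2 hj
  have hfin : {k : ℕ | k ≤ n + p ∧ ξ k = ξ j}.Finite :=
    (finite_Iic (n + p)).subset fun k hk => hk.1
  have h3 := Set.ncard_le_ncard hsub hfin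
  rw [show Icc j (j + m) = ((Finset.Icc j (j + m) : Finset ℕ) : Set ℕ) by simp,
    Set.ncard_coe_finset, Nat.card_Icc] at h3
  rw [multiplicity] at h2
  omega

lemma IsOpenKnotVector.lt_support (h : IsOpenKnotVector p n ξ) {r : ℤ} (hr : HasRegularity p n ξ r)
    (hr1 : -1 ≤ r) {j : ℕ} (hj : j < n) : ξ j < ξ (j + p + 1) := by
  rcases (h.nonneg (by omega : j ≤ n + p)).eq_or_lt with h0 | h0
  · rw [← h0]
    exact h.pos _ (by omega) (by omega)
  · exact HasRegularity.lt_of_mem h hr (by omega : j + (p + 1) ≤ n + p) h0 (h.lt_one j hj)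
      (by push_cast; omega)

lemma dualFunctional_bspline_self (h : IsOpenKnotVector p n ξ) {r : ℤ} (hr : HasRegularity p n ξ r)
    (hr1 : -1 ≤ r) {j : ℕ} (hj : j < n) : dualFunctional ξ p j (bspline ξ p j) = 1 := by
  have hlt := h.lt_support hr hr1 hj
  have h1 := dualFunctional_sum h.sorted hj hlt fun _ => 1
  rw [Finset.sum_eq_single j] at h1
  · rw [one_mul] at h1
    rw [← h1]
    refine (dualFunctional_congr hlt (Filter.Eventually.of_forall fun x hx => ?_)).trans
      (dualFunctional_one hlt)
    simp only [one_mul]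
    refine sum_bspline h.sorted ⟨?_, ?_⟩
    · rw [h.eq_zero p le_rfl]
      exact (h.nonneg (by omega)).trans hx.1.le
    · rw [h.eq_one n le_rfl (by omega)]
      exact hx.2.trans_le (h.le_one (by omega))
  · intro i hi hij
    rw [dualFunctional_bspline_of_ne h.sorted (Finset.mem_range.1 hi) hj hlt hij, mul_zero]
  · intro hc
    exact absurd (Finset.mem_range.2 hj) hc

lemma proj_sum (h : IsOpenKnotVector p n ξ) {r : ℤ} (hr : HasRegularity p n ξ r) (hr1 : -1 ≤ r)
    (c : ℕ → ℝ) : proj ξ p n (fun x => ∑ i ∈ Finset.range n, c i * bspline ξ p i x)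
      = fun x => ∑ i ∈ Finset.range n, c i * bspline ξ p i x := by
  funext x
  rw [proj]
  refine Finset.sum_congr rfl fun j hj => ?_
  rw [Finset.mem_range] at hj
  have hlt := h.lt_support hr hr1 hj
  rw [dualFunctional_sum h.sorted hj hlt, Finset.sum_eq_single j,
    dualFunctional_bspline_self h hr hr1 hj, mul_one]
  · intro i hi hij
    rw [dualFunctional_bspline_of_ne h.sorted (Finset.mem_range.1 hi) hj hlt hij, mul_zero]
  · intro hc
    exact absurd (Finset.mem_range.2 hj) hc

lemma mem_splineSpace_iff {s : ℝ → ℝ} : s ∈ splineSpace ξ p n ↔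
    ∃ c : ℕ → ℝ, s = fun x => ∑ i ∈ Finset.range n, c i * bspline ξ p i x := by
  constructor
  · intro hs
    refine Submodule.span_induction (p := fun s _ => ∃ c : ℕ → ℝ, s = fun x =>
      ∑ i ∈ Finset.range n, c i * bspline ξ p i x) ?_ ?_ ?_ ?_ hs
    · rintro _ ⟨j, hj, rfl⟩
      refine ⟨fun i => if i = j then 1 else 0, ?_⟩
      funext x
      simp [hj]
    · exact ⟨0, by funext x; simp⟩
    · rintro _ _ _ _ ⟨c, rfl⟩ ⟨d, rfl⟩
      refine ⟨c + d, ?_⟩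
      funext x
      simp [add_mul, Finset.sum_add_distrib]
    · rintro a _ _ ⟨c, rfl⟩
      refine ⟨fun i => a * c i, ?_⟩
      funext x
      simp [Finset.mul_sum, mul_assoc]
  · rintro ⟨c, rfl⟩
    have : (fun x => ∑ i ∈ Finset.range n, c i * bspline ξ p i x)
        = ∑ i ∈ Finset.range n, c i • bspline ξ p i := by
      funext x
      simp [Finset.sum_apply]
    rw [this]
    exact Submodule.sum_mem _ fun i hi => Submodule.smul_mem _ _
      (Submodule.subset_span ⟨i, Finset.mem_range.1 hi, rfl⟩)

lemma proj_mem_splineSpace (v : ℝ → ℝ) : proj ξ p n v ∈ splineSpace ξ p n :=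
  mem_splineSpace_iff.2 ⟨_, rfl⟩

lemma proj_eq_self (h : IsOpenKnotVector p n ξ) {r : ℤ} (hr : HasRegularity p n ξ r)
    (hr1 : -1 ≤ r) {s : ℝ → ℝ} (hs : s ∈ splineSpace ξ p n) : proj ξ p n s = s := by
  obtain ⟨c, rfl⟩ := mem_splineSpace_iff.1 hs
  exact proj_sum h hr hr1 c

end UnivariateSpline

namespace UnivariateSpline

/-! ### Weak derivatives -/

lemma iteratedDeriv_eq_zero_of_notMem_tsupport {φ : ℝ → ℝ} {x : ℝ} (hx : x ∉ tsupport φ) (k : ℕ) :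
    iteratedDeriv k φ x = 0 := by
  rw [(notMem_tsupport_iff_eventuallyEq.1 hx).iteratedDeriv_eq]
  exact iteratedDeriv_const_zero

/-- `φ` is a test function on `Ω`. -/
structure IsTest (Ω : Set ℝ) (φ : ℝ → ℝ) : Prop where
  smooth : ContDiff ℝ ∞ φ
  compact : HasCompactSupport φ
  subset : tsupport φ ⊆ Ω

variable {Ω : Set ℝ} {v g w φ : ℝ → ℝ} {k l : ℕ}

lemma HasWeakDeriv.eq (h : HasWeakDeriv Ω k v g) (hφ : IsTest Ω φ) :
    ∫ x in Ω, v x * iteratedDeriv k φ x = (-1) ^ k * ∫ x in Ω, g x * φ x :=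
  h.2.2 φ hφ.smooth hφ.compact hφ.subset

lemma IsTest.mono {Ω' : Set ℝ} (hφ : IsTest Ω φ) (h : Ω ⊆ Ω') : IsTest Ω' φ :=
  ⟨hφ.smooth, hφ.compact, hφ.subset.trans h⟩

lemma tsupport_iteratedDeriv_subset_tsupport (φ : ℝ → ℝ) (k : ℕ) :
    tsupport (iteratedDeriv k φ) ⊆ tsupport φ := by
  refine closure_minimal (fun x hx => ?_) (isClosed_tsupport φ)
  by_contra hc
  exact hx (iteratedDeriv_eq_zero_of_notMem_tsupport hc k)

lemma IsTest.iteratedDeriv (hφ : IsTest Ω φ) (k : ℕ) : IsTest Ω (iteratedDeriv k φ) where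
  smooth := by
    rw [iteratedDeriv_eq_iterate]
    exact hφ.smooth.iterate_deriv k
  compact := hφ.compact.mono' ((subset_tsupport _).trans (tsupport_iteratedDeriv_subset_tsupport φ k))
  subset := (tsupport_iteratedDeriv_subset_tsupport φ k).trans hφ.subset

lemma IsTest.setIntegral (hφ : IsTest Ω φ) (v : ℝ → ℝ) :
    ∫ x in Ω, v x * φ x = ∫ x, v x * φ x :=
  setIntegral_eq_integral_of_forall_compl_eq_zero fun x hx => by
    rw [image_eq_zero_of_notMem_tsupport fun hc => hx (hφ.subset hc), mul_zero]

lemma IsTest.integrable (hφ : IsTest Ω φ) (hv : LocallyIntegrableOn v Ω) :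
    Integrable fun x => v x * φ x := by
  have h1 : IntegrableOn v (tsupport φ) := hv.integrableOn_compact_subset hφ.subset hφ.compact
  have h2 := h1.mul_continuousOn hφ.smooth.continuous.continuousOn hφ.compact
  refine (integrableOn_iff_integrable_of_support_subset fun x hx => ?_).1 h2
  by_contra hc
  exact hx (by simp [image_eq_zero_of_notMem_tsupport hc])

lemma HasWeakDeriv.restrict {Ω' : Set ℝ} (h : HasWeakDeriv Ω k v g) (hsub : Ω' ⊆ Ω) :
    HasWeakDeriv Ω' k v g := by
  refine ⟨h.1.mono_set hsub, h.2.1.mono_set hsub, fun φ h1 h2 h3 => ?_⟩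
  have hφ : IsTest Ω' φ := ⟨h1, h2, h3⟩
  have := h.eq (hφ.mono hsub)
  rwa [((hφ.mono hsub).iteratedDeriv k).setIntegral, (hφ.mono hsub).setIntegral,
    ← (hφ.iteratedDeriv k).setIntegral, ← hφ.setIntegral] at this

lemma ae_eq_of_integral_test_eq (hΩ : IsOpen Ω) (hv : LocallyIntegrableOn v Ω)
    (hg : LocallyIntegrableOn g Ω)
    (h : ∀ φ, IsTest Ω φ → ∫ x in Ω, v x * φ x = ∫ x in Ω, g x * φ x) :
    v =ᵐ[volume.restrict Ω] g := by
  have key := hΩ.ae_eq_zero_of_integral_contDiff_smul_eq_zero (μ := volume) (hv.sub hg)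
    (fun φ h1 h2 h3 => by
      have hφ : IsTest Ω φ := ⟨h1, h2, h3⟩
      have e := h φ hφ
      rw [hφ.setIntegral, hφ.setIntegral] at e
      have : ∀ x, φ x • (v - g) x = v x * φ x - g x * φ x := fun x => by
        simp only [Pi.sub_apply, smul_eq_mul]; ring
      simp only [this]
      rw [integral_sub (hφ.integrable hv) (hφ.integrable hg), e, sub_self])
  rw [Filter.EventuallyEq, ae_restrict_iff' hΩ.measurableSet]
  filter_upwards [key] with x hx hxΩ
  have := hx hxΩ
  simp only [Pi.sub_apply] at this
  linarith

lemma HasWeakDeriv.unique (hΩ : IsOpen Ω) (h : HasWeakDeriv Ω k v g) (h' : HasWeakDeriv Ω k v w) :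
    g =ᵐ[volume.restrict Ω] w := by
  refine ae_eq_of_integral_test_eq hΩ h.2.1 h'.2.1 fun φ hφ => ?_
  have := (h.eq hφ).symm.trans (h'.eq hφ)
  exact mul_left_cancel₀ (pow_ne_zero k (by norm_num)) this

lemma HasWeakDeriv.sobolevSeminorm_eq (hΩ : IsOpen Ω) (h : HasWeakDeriv Ω k v g) :
    sobolevSeminorm Ω k v = eLpNorm g 2 (volume.restrict Ω) := by
  refine le_antisymm (iInf₂_le g h) (le_iInf₂ fun w hw => ?_)
  exact (eLpNorm_congr_ae (h.unique hΩ hw)).le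

lemma HasWeakDeriv.comp {v' : ℝ → ℝ} (h : HasWeakDeriv Ω 1 v v') (h' : HasWeakDeriv Ω l v' g) :
    HasWeakDeriv Ω (l + 1) v g := by
  refine ⟨h.1, h'.2.1, fun φ h1 h2 h3 => ?_⟩
  have hφ : IsTest Ω φ := ⟨h1, h2, h3⟩
  have e1 := h.eq (hφ.iteratedDeriv l)
  rw [iteratedDeriv_one, ← iteratedDeriv_succ, h'.eq hφ] at e1
  rw [e1]
  ring

lemma hasWeakDeriv_one_of_hasDerivAt (hΩ : IsOpen Ω) {F F' : ℝ → ℝ} (hF : ContinuousOn F Ω)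
    {S : Set ℝ} (hS : S.Countable) (hd : ∀ x ∈ Ω \ S, HasDerivAt F (F' x) x)
    (hF' : LocallyIntegrableOn F' Ω) : HasWeakDeriv Ω 1 F F' := by
  have hFl : LocallyIntegrableOn F Ω := hF.locallyIntegrableOn hΩ.measurableSet
  refine ⟨hFl, hF', fun φ h1 h2 h3 => ?_⟩
  have hφ : IsTest Ω φ := ⟨h1, h2, h3⟩
  rw [(hφ.iteratedDeriv 1).setIntegral, hφ.setIntegral]
  obtain ⟨R, hR⟩ := h2.isBounded.subset_closedBall 0
  have hI1 := hφ.integrable hF'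
  have hI2 := (hφ.iteratedDeriv 1).integrable hFl
  have hz : ∀ x, R < |x| → x ∉ tsupport φ := fun x hx hc => by
    have := hR hc
    rw [mem_closedBall_zero_iff, Real.norm_eq_abs] at this
    linarith
  set A := |R| + 1 with hA
  have hRA : R < A := by have := le_abs_self R; linarith
  have hA0 : 0 < A := by positivity
  have hend : ∀ x, |x| = A → φ x = 0 := fun x hx =>
    image_eq_zero_of_notMem_tsupport (hz x (by rw [hx]; exact hRA))
  have hcont : Continuous fun x => F x * φ x := by
    refine continuous_iff_continuousAt.2 fun x => ?_
    by_cases hx : x ∈ tsupport φ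
    · exact (hF.continuousAt (hΩ.mem_nhds (h3 hx))).mul h1.continuous.continuousAt
    · refine (continuousAt_const (y := (0 : ℝ))).congr ?_
      filter_upwards [notMem_tsupport_iff_eventuallyEq.1 hx] with y hy
      rw [hy]; simp
  have key := integral_eq_of_hasDerivAt_off_countable_of_le (fun x => F x * φ x)
    (fun x => F' x * φ x + F x * iteratedDeriv 1 φ x) (by linarith : -A ≤ A) hS
    hcont.continuousOn (fun x hx => by
      by_cases hxs : x ∈ tsupport φ
      · rw [iteratedDeriv_one]
        exact (hd x ⟨h3 hxs, hx.2⟩).mul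
          (h1.differentiable (by simp) x).hasDerivAt
      · rw [image_eq_zero_of_notMem_tsupport hxs, iteratedDeriv_eq_zero_of_notMem_tsupport hxs]
        simp only [mul_zero, add_zero]
        refine (hasDerivAt_const x (0 : ℝ)).congr_of_eventuallyEq ?_
        filter_upwards [notMem_tsupport_iff_eventuallyEq.1 hxs] with y hy
        rw [hy]; simp)
    (hI1.add hI2).intervalIntegrable
  rw [← integral_eq_intervalIntegral_of_eq_zero (by linarith : -A ≤ A)] at key
  · rw [integral_add hI1 hI2, hend A (abs_of_pos hA0), hend (-A) (by rw [abs_neg, abs_of_pos hA0])]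
      at key
    linarith
  · intro x hx
    have : x ∉ tsupport φ := hz x (by
      by_contra! hc
      exact hx (abs_le.1 (hc.trans hRA.le)))
    rw [image_eq_zero_of_notMem_tsupport this, iteratedDeriv_eq_zero_of_notMem_tsupport this]
    simp

lemma hasWeakDeriv_of_contDiffAt (hΩ : IsOpen Ω) {f : ℝ → ℝ} (hf : ∀ x ∈ Ω, ContDiffAt ℝ ∞ f x)
    (l : ℕ) : HasWeakDeriv Ω l f (iteratedDeriv l f) := by
  induction l generalizing f with
  | zero =>
    have : ContinuousOn f Ω := fun x hx => (hf x hx).continuousAt.continuousWithinAt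
    rw [iteratedDeriv_zero]
    exact ⟨this.locallyIntegrableOn hΩ.measurableSet, this.locallyIntegrableOn hΩ.measurableSet,
      fun φ _ _ _ => by simp⟩
  | succ l ih =>
    have hd : ∀ x ∈ Ω, ContDiffAt ℝ ∞ (deriv f) x := fun x hx =>
      ((hf x hx).fderiv_right (m := ∞) le_rfl).clm_apply contDiffAt_const
    rw [iteratedDeriv_succ']
    refine HasWeakDeriv.comp (hasWeakDeriv_one_of_hasDerivAt hΩ
      (fun x hx => (hf x hx).continuousAt.continuousWithinAt) countable_empty
      (fun x hx => ((hf x hx.1).differentiableAt (by simp)).hasDerivAt) ?_) (ih hd)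
    have : ContinuousOn (deriv f) Ω := fun x hx => (hd x hx).continuousAt.continuousWithinAt
    exact this.locallyIntegrableOn hΩ.measurableSet

lemma hasWeakDeriv_primitive {a b : ℝ} (hab : a ≤ b) (hg : IntegrableOn g (Ioo a b)) :
    HasWeakDeriv (Ioo a b) 1 (fun x => ∫ t in a..x, g t) g := by
  have hgi : IntervalIntegrable g volume a b := by
    rwa [intervalIntegrable_iff_integrableOn_Ioo_of_le hab]
  have hAC := hgi.absolutelyContinuousOnInterval_intervalIntegral (c := a) left_mem_uIcc
  have hc : ContinuousOn (fun x => ∫ t in a..x, g t) (Ioo a b) := by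
    have := hAC.continuousOn
    rw [uIcc_of_le hab] at this
    exact this.mono Ioo_subset_Icc_self
  refine ⟨hc.locallyIntegrableOn measurableSet_Ioo, hg.locallyIntegrableOn, fun φ h1 h2 h3 => ?_⟩
  have key := hAC.integral_mul_deriv_eq_deriv_mul (g := φ)
    (ContDiffOn.absolutelyContinuousOnInterval (h1.of_le (by simp)).contDiffOn)
  have za : φ a = 0 := image_eq_zero_of_notMem_tsupport fun hc => lt_irrefl _ (h3 hc).1
  have zb : φ b = 0 := image_eq_zero_of_notMem_tsupport fun hc => lt_irrefl _ (h3 hc).2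
  rw [za, zb, mul_zero, mul_zero, sub_zero, zero_sub] at key
  rw [← integral_Ioc_eq_integral_Ioo, ← integral_Ioc_eq_integral_Ioo,
    ← intervalIntegral.integral_of_le hab, ← intervalIntegral.integral_of_le hab, iteratedDeriv_one,
    key, pow_one, neg_one_mul]
  congr 1
  refine intervalIntegral.integral_congr_ae ?_
  filter_upwards [hgi.ae_hasDerivAt_integral] with x hx hx2
  rw [(hx (uIoc_subset_uIcc hx2) a left_mem_uIcc).deriv]

lemma exists_Icc_of_isCompact {K : Set ℝ} (hK : IsCompact K) {a b : ℝ} (hab : a < b)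
    (hsub : K ⊆ Ioo a b) : ∃ α β, a < α ∧ β < b ∧ K ⊆ Icc α β := by
  rcases K.eq_empty_or_nonempty with rfl | hne
  · obtain ⟨c, h1, h2⟩ := exists_between hab
    exact ⟨c, c, h1, h2, empty_subset _⟩
  · exact ⟨sInf K, sSup K, (hsub (hK.sInf_mem hne)).1, (hsub (hK.sSup_mem hne)).2, fun x hx =>
      ⟨csInf_le hK.bddBelow hx, le_csSup hK.bddAbove hx⟩⟩

lemma IsTest.sub (hv : IsTest Ω v) (hw : IsTest Ω w) : IsTest Ω (v - w) where
  smooth := hv.smooth.sub hw.smooth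
  compact := hv.compact.sub hw.compact
  subset := (tsupport_sub v w).trans (union_subset hv.subset hw.subset)

lemma IsTest.const_mul (hv : IsTest Ω v) (c : ℝ) : IsTest Ω (fun x => c * v x) where
  smooth := contDiff_const.mul hv.smooth
  compact := hv.compact.mul_left
  subset := (tsupport_mul_subset_right (f := fun _ => c)).trans hv.subset

/-- A test function on an interval with vanishing integral is the derivative of a test function. -/
lemma IsTest.exists_primitive {a b : ℝ} (hab : a < b) (hφ : IsTest (Ioo a b) φ)
    (h0 : ∫ x, φ x = 0) : ∃ θ, IsTest (Ioo a b) θ ∧ deriv θ = φ := by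
  obtain ⟨α, β, hα, hβ, hsub⟩ := exists_Icc_of_isCompact hφ.compact hab hφ.subset
  have hφc := hφ.smooth.continuous
  have hd : ∀ x, HasDerivAt (fun x => ∫ t in a..x, φ t) (φ x) x := fun x =>
    intervalIntegral.integral_hasDerivAt_right (hφc.intervalIntegrable _ _)
      (hφc.stronglyMeasurableAtFilter _ _) hφc.continuousAt
  have hz : ∀ x ∉ Icc α β, φ x = 0 := fun x hx =>
    image_eq_zero_of_notMem_tsupport fun hc => hx (hsub hc)
  have hsupp : Function.support (fun x => ∫ t in a..x, φ t) ⊆ Icc α β := by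
    intro x hx
    by_contra hc
    refine hx ?_
    rcases lt_or_ge x α with h1 | h1
    · refine intervalIntegral.integral_zero_ae (Filter.Eventually.of_forall fun t ht => hz t ?_)
      intro hcc
      have := ht.2
      have := le_sup_iff.1 this
      rcases this with h | h <;> linarith [hcc.1]
    · have h2 : β < x := by
        by_contra! h2
        exact hc ⟨h1, h2⟩
      rcases le_or_gt a x with h3 | h3
      · simp only
        rw [← integral_eq_intervalIntegral_of_eq_zero h3, h0]
        intro t ht
        exact hz t fun hcc => ht ⟨by linarith [hcc.1], by linarith [hcc.2]⟩
      · linarith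
  have hts : tsupport (fun x => ∫ t in a..x, φ t) ⊆ Icc α β :=
    closure_minimal hsupp isClosed_Icc
  have hder : deriv (fun x => ∫ t in a..x, φ t) = φ := funext fun x => (hd x).deriv
  refine ⟨_, ⟨?_, ?_, ?_⟩, hder⟩
  · rw [contDiff_infty_iff_deriv, hder]
    exact ⟨fun x => (hd x).differentiableAt, hφ.smooth⟩
  · exact isCompact_Icc.of_isClosed_subset (isClosed_tsupport _) hts
  · exact hts.trans fun x hx => ⟨hα.trans_le hx.1, hx.2.trans_lt hβ⟩

lemma exists_isTest_integral_eq_one {a b : ℝ} (hab : a < b) :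
    ∃ η, IsTest (Ioo a b) η ∧ ∫ x, η x = 1 := by
  let f : ContDiffBump ((a + b) / 2) := ⟨(b - a) / 8, (b - a) / 4, by linarith, by linarith⟩
  refine ⟨f.normed volume, ⟨f.contDiff_normed, f.hasCompactSupport_normed, ?_⟩, f.integral_normed⟩
  rw [f.tsupport_normed_eq, Real.closedBall_eq_Icc]
  intro x hx
  have h1 : (a + b) / 2 - (b - a) / 4 ≤ x := hx.1
  have h2 : x ≤ (a + b) / 2 + (b - a) / 4 := hx.2
  constructor <;> linarith

/-- A locally integrable function on an interval whose weak derivative of order `l` vanishes is a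
polynomial of degree less than `l`. -/
lemma exists_polynomial_of_integral_iteratedDeriv_eq_zero {a b : ℝ} (hab : a < b)
    (hw : LocallyIntegrableOn w (Ioo a b))
    (h : ∀ φ, IsTest (Ioo a b) φ → ∫ x in Ioo a b, w x * iteratedDeriv l φ x = 0) :
    ∃ q : Polynomial ℝ, q.degree < l ∧ ∀ᵐ x, x ∈ Ioo a b → w x = q.eval x := by
  induction l generalizing w with
  | zero =>
    refine ⟨0, by simp, ?_⟩
    have := ae_eq_of_integral_test_eq isOpen_Ioo hw (g := fun _ => 0) locallyIntegrableOn_zero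
      (fun φ hφ => by
        have := h φ hφ
        rw [iteratedDeriv_zero] at this
        rw [this]
        simp)
    rw [Filter.EventuallyEq, ae_restrict_iff' measurableSet_Ioo] at this
    simpa using this
  | succ l ih =>
    obtain ⟨η, hη, hη1⟩ := exists_isTest_integral_eq_one hab
    set K := ∫ x in Ioo a b, w x * iteratedDeriv l η x with hK
    have htest : ∀ φ, IsTest (Ioo a b) φ →
        ∫ x in Ioo a b, w x * iteratedDeriv l φ x = K * ∫ x, φ x := by
      intro φ hφ
      have hηi : Integrable η := hη.smooth.continuous.integrable_of_hasCompactSupport hη.compact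
      have hφi : Integrable φ := hφ.smooth.continuous.integrable_of_hasCompactSupport hφ.compact
      obtain ⟨θ, hθ, hθd⟩ := (hφ.sub (hη.const_mul (∫ x, φ x))).exists_primitive hab (by
        simp only [Pi.sub_apply]
        rw [integral_sub hφi (hηi.const_mul _), integral_const_mul, hη1, mul_one, sub_self])
      have e := h θ hθ
      rw [iteratedDeriv_succ', hθd] at e
      have e2 : ∀ x, iteratedDeriv l (φ - fun x => (∫ x, φ x) * η x) x
          = iteratedDeriv l φ x - (∫ x, φ x) * iteratedDeriv l η x := by
        intro x
        rw [iteratedDeriv_sub (hφ.smooth.of_le (by exact_mod_cast le_top)).contDiffAt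
          ((hη.const_mul _).smooth.of_le (by exact_mod_cast le_top)).contDiffAt,
          iteratedDeriv_const_mul_field]
      have e3 : ∀ x, w x * (iteratedDeriv l φ x - (∫ x, φ x) * iteratedDeriv l η x)
          = w x * iteratedDeriv l φ x - (∫ x, φ x) * (w x * iteratedDeriv l η x) := by
        intro x; ring
      simp only [e2, e3] at e
      rw [integral_sub ((hφ.iteratedDeriv l).integrable hw).integrableOn
        (((hη.iteratedDeriv l).integrable hw).integrableOn.const_mul _), integral_const_mul] at e
      linarith
    set κ := (-1) ^ l * K / (l.factorial : ℝ) with hκ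
    set q₀ : Polynomial ℝ := Polynomial.C κ * Polynomial.X ^ l with hq₀
    have hq₀w := hasWeakDeriv_of_contDiffAt (isOpen_Ioo (a := a) (b := b))
      (f := fun x => q₀.eval x) (fun x _ => (contDiff_polynomial_eval q₀).contDiffAt) l
    have hq₀d : iteratedDeriv l (fun x => q₀.eval x) = fun _ => (-1) ^ l * K := by
      rw [iteratedDeriv_polynomial_eval]
      funext x
      rw [hq₀, Polynomial.iterate_derivative_C_mul, Polynomial.iterate_derivative_X_pow_eq_natCast_mul,
        Nat.descFactorial_self]
      simp only [Nat.sub_self, pow_zero, mul_one, Polynomial.eval_mul, Polynomial.eval_C,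
        Polynomial.eval_natCast, hκ]
      have : (l.factorial : ℝ) ≠ 0 := by exact_mod_cast l.factorial_ne_zero
      field_simp
    rw [hq₀d] at hq₀w
    obtain ⟨q₁, hq₁, hae⟩ := ih (w := fun x => w x - q₀.eval x) (hw.sub hq₀w.1) (fun φ hφ => by
      have e4 : ∀ x, (w x - q₀.eval x) * iteratedDeriv l φ x
          = w x * iteratedDeriv l φ x - q₀.eval x * iteratedDeriv l φ x := fun x => by ring
      simp only [e4]
      rw [integral_sub ((hφ.iteratedDeriv l).integrable hw).integrableOn
        ((hφ.iteratedDeriv l).integrable hq₀w.1).integrableOn, htest φ hφ, hq₀w.eq hφ,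
        integral_const_mul]
      have e5 : ∫ x in Ioo a b, φ x = ∫ x, φ x := by
        have := hφ.setIntegral fun _ => 1
        simpa using this
      rw [e5]
      have h1 : ((-1 : ℝ) ^ l) * (-1) ^ l = 1 := by rw [← mul_pow]; simp
      linear_combination (-K * ∫ x, φ x) * h1)
    refine ⟨q₁ + q₀, ?_, ?_⟩
    · refine lt_of_le_of_lt (Polynomial.degree_add_le _ _) (max_lt ?_ ?_)
      · exact hq₁.trans (by exact_mod_cast Nat.lt_succ_self l)
      · exact lt_of_le_of_lt (Polynomial.degree_C_mul_X_pow_le l κ)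
          (by exact_mod_cast Nat.lt_succ_self l)
    · filter_upwards [hae] with x hx hxI
      rw [Polynomial.eval_add, ← hx hxI]
      ring

end UnivariateSpline

namespace UnivariateSpline

variable {p n : ℕ} {ξ : ℕ → ℝ} {r : ℤ}

lemma IsOpenKnotVector.shift (h : IsOpenKnotVector (p + 1) n ξ) :
    IsOpenKnotVector p (n - 1) (fun j => ξ (j + 1)) where
  mono i j hij hj := h.mono _ _ (by omega) (by omega)
  eq_zero j hj := h.eq_zero _ (by omega)
  pos j hj hj2 := h.pos _ (by omega) (by omega)
  lt_one j hj := h.lt_one _ (by omega)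
  eq_one j hj hj2 := h.eq_one _ (by omega) (by omega)

lemma HasRegularity.shift (hr : HasRegularity (p + 1) n ξ r) (hn : 1 ≤ n) :
    HasRegularity p (n - 1) (fun j => ξ (j + 1)) (r - 1) := by
  intro j hj h0 h1
  have h2 := hr (j + 1) (by omega) h0 h1
  have h3 : multiplicity p (n - 1) (fun j => ξ (j + 1)) (ξ (j + 1))
      ≤ multiplicity (p + 1) n ξ (ξ (j + 1)) := by
    refine Set.ncard_le_ncard_of_injOn (fun k => k + 1) ?_ ?_ ?_
    · rintro k ⟨hk1, hk2⟩
      exact ⟨by omega, hk2⟩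
    · intro a _ b _ hab
      exact Nat.add_right_cancel hab
    · exact (finite_Iic (n + (p + 1))).subset fun k hk => hk.1
  push_cast at h2
  change (multiplicity p (n - 1) (fun j => ξ (j + 1)) (ξ (j + 1)) : ℤ) ≤ _
  omega

lemma mem_reducedSplineSpace_iff {k : ℕ} {s : ℝ → ℝ} : s ∈ reducedSplineSpace k ξ p n ↔
    ∃ c : ℕ → ℝ, s = fun x => ∑ i ∈ Finset.range (n - k),
      c i * bspline (fun j => ξ (j + k)) (p - k) i x := mem_splineSpace_iff

/-- The coefficients of the derivative of the spline with the coefficients `c`. -/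
noncomputable def derivCoeff (ξ : ℕ → ℝ) (p : ℕ) (c : ℕ → ℝ) (i : ℕ) : ℝ :=
  ((p : ℝ) + 1) * (c (i + 1) - c i) / (ξ (i + p + 2) - ξ (i + 1))

lemma hasDerivAt_spline (h : IsOpenKnotVector (p + 1) n ξ) (c : ℕ → ℝ) {x : ℝ}
    (hd : ∀ i < n, HasDerivAt (bspline ξ (p + 1) i) (bsplineDeriv ξ p i x) x) :
    HasDerivAt (fun x => ∑ i ∈ Finset.range n, c i * bspline ξ (p + 1) i x)
      (∑ i ∈ Finset.range (n - 1), derivCoeff ξ p c i * bspline (fun j => ξ (j + 1)) p i x) x := by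
  have h1 : HasDerivAt (fun x => ∑ i ∈ Finset.range n, c i * bspline ξ (p + 1) i x)
      (∑ i ∈ Finset.range n, c i * bsplineDeriv ξ p i x) x :=
    HasDerivAt.fun_sum fun i hi => (hd i (Finset.mem_range.1 hi)).const_mul _
  refine h1.congr_deriv ?_
  obtain ⟨N, rfl⟩ : ∃ N, n = N + 1 := ⟨n - 1, by have := h.lt; omega⟩
  rw [Nat.add_sub_cancel]
  set b : ℕ → ℝ := fun i => bspline ξ p i x / (ξ (i + p + 1) - ξ i) with hb
  have b0 : b 0 = 0 := by
    simp only [hb]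
    rw [bspline_eq_zero_of_eq (h.sorted_sub (by omega))
      (by rw [h.eq_zero _ (by omega), h.eq_zero _ (by omega)]), zero_div]
  have bN : b (N + 1) = 0 := by
    simp only [hb]
    rw [bspline_eq_zero_of_eq (h.sorted_sub (by omega))
      (by rw [h.eq_one _ (by omega) (by omega), h.eq_one _ (by omega) (by omega)]), zero_div]
  have e1 : ∀ i, c i * bsplineDeriv ξ p i x = ((p : ℝ) + 1) * (c i * b i - c i * b (i + 1)) := by
    intro i
    simp only [bsplineDeriv, hb, show i + 1 + p + 1 = i + p + 2 by omega]
    ring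
  have e2 : ∀ i, derivCoeff ξ p c i * bspline (fun j => ξ (j + 1)) p i x
      = ((p : ℝ) + 1) * (c (i + 1) * b (i + 1) - c i * b (i + 1)) := by
    intro i
    simp only [derivCoeff, hb, bspline_shift, show i + 1 + p + 1 = i + p + 2 by omega]
    ring
  simp only [e1, e2]
  rw [← Finset.mul_sum, ← Finset.mul_sum, Finset.sum_sub_distrib, Finset.sum_sub_distrib,
    Finset.sum_range_succ' (fun i => c i * b i), Finset.sum_range_succ (fun i => c i * b (i + 1)),
    b0, bN]
  ring

lemma hasDerivAt_spline_of_offKnots (h : IsOpenKnotVector (p + 1) n ξ) (c : ℕ → ℝ) {x : ℝ}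
    (hx : OffKnots ξ 0 (n + p + 1) x) :
    HasDerivAt (fun x => ∑ i ∈ Finset.range n, c i * bspline ξ (p + 1) i x)
      (∑ i ∈ Finset.range (n - 1), derivCoeff ξ p c i * bspline (fun j => ξ (j + 1)) p i x) x :=
  hasDerivAt_spline h c fun _ hi => hasDerivAt_bspline (h.sorted_sub (by omega))
    (hx.mono (by omega) (by omega))

lemma continuousAt_bspline_of_regularity (h : IsOpenKnotVector p n ξ) (hr : HasRegularity p n ξ r)
    {q j : ℕ} (hq : (p : ℤ) - r ≤ q) (hj : j + q + 1 ≤ n + p) {x : ℝ} (hx : x ∈ Ioo (0 : ℝ) 1) :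
    ContinuousAt (bspline ξ q j) x := by
  refine continuousAt_bspline (h.sorted_sub hj) ?_ ?_
  · rintro ⟨h1, h2⟩
    exact (HasRegularity.lt_of_mem h hr (j := j) (m := q) (by omega) (h1 ▸ hx.1) (h1 ▸ hx.2) hq).ne
      (h1.trans h2.symm)
  · rintro ⟨h1, h2⟩
    refine (HasRegularity.lt_of_mem h hr (j := j + 1) (m := q) (by omega) (h1 ▸ hx.1) (h1 ▸ hx.2)
      hq).ne ?_
    rw [h1, show j + 1 + q = j + q + 1 by omega, h2]

lemma continuousOn_spline (h : IsOpenKnotVector p n ξ) (hr : HasRegularity p n ξ r) (hr0 : 0 ≤ r)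
    (c : ℕ → ℝ) :
    ContinuousOn (fun x => ∑ i ∈ Finset.range n, c i * bspline ξ p i x) (Ioo 0 1) := by
  refine continuousOn_finsetSum _ fun i hi x hx => ?_
  rw [Finset.mem_range] at hi
  exact (continuousAt_const.mul (continuousAt_bspline_of_regularity h hr (by omega) (by omega)
    hx)).continuousWithinAt

lemma hasDerivAt_spline_of_regularity (h : IsOpenKnotVector (p + 2) n ξ)
    (hr : HasRegularity (p + 2) n ξ r) (hr1 : 1 ≤ r) (c : ℕ → ℝ) {x : ℝ} (hx : x ∈ Ioo (0 : ℝ) 1) :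
    HasDerivAt (fun x => ∑ i ∈ Finset.range n, c i * bspline ξ (p + 2) i x)
      (∑ i ∈ Finset.range (n - 1), derivCoeff ξ (p + 1) c i
        * bspline (fun j => ξ (j + 1)) (p + 1) i x) x :=
  hasDerivAt_spline h c fun i hi => hasDerivAt_bspline_of_continuousAt (h.sorted_sub (by omega))
    (continuousAt_bspline_of_regularity h hr (by push_cast; omega) (by omega) hx)
    (continuousAt_bspline_of_regularity h hr (by push_cast; omega) (by omega) hx)
    (continuousAt_bspline_of_regularity h hr (by push_cast; omega) (by omega) hx)

lemma intervalIntegrable_spline (h : IsOpenKnotVector p n ξ) (c : ℕ → ℝ) (a b : ℝ) :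
    IntervalIntegrable (fun x => ∑ i ∈ Finset.range n, c i * bspline ξ p i x) volume a b := by
  have := IntervalIntegrable.sum (μ := volume) (a := a) (b := b) (Finset.range n)
    (f := fun i x => c i * bspline ξ p i x) fun i hi =>
      (intervalIntegrable_bspline (h.sorted_sub
        (by rw [Finset.mem_range] at hi; omega)) a b).const_mul _
  simpa only [Finset.sum_fn] using this

lemma lt_reduced_support (h : IsOpenKnotVector (p + 1) n ξ) (hr : HasRegularity (p + 1) n ξ r)
    (hr0 : 0 ≤ r) {i : ℕ} (hi : i < n - 1) : ξ (i + 1) < ξ (i + p + 2) := by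
  rcases (h.nonneg (by omega : i + 1 ≤ n + (p + 1))).eq_or_lt with h0 | h0
  · rw [← h0]
    exact h.pos _ (by omega) (by omega)
  · have := HasRegularity.lt_of_mem h hr (j := i + 1) (m := p + 1) (by omega) h0
      (h.lt_one _ (by omega)) (by push_cast; omega)
    rwa [show i + 1 + (p + 1) = i + p + 2 by omega] at this

/-- Splines of the reduced space have antiderivatives in the spline space. -/
lemma exists_antideriv_eq (h : IsOpenKnotVector (p + 1) n ξ) (hr : HasRegularity (p + 1) n ξ r)
    (hr0 : 0 ≤ r) (d : ℕ → ℝ) :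
    ∃ c : ℕ → ℝ, (∀ i < n - 1, derivCoeff ξ p c i = d i) ∧ ∀ x ∈ Ico (0 : ℝ) 1,
      ∑ i ∈ Finset.range n, c i * bspline ξ (p + 1) i x
        = antideriv (fun x => ∑ i ∈ Finset.range (n - 1),
          d i * bspline (fun j => ξ (j + 1)) p i x) x := by
  let c : ℕ → ℝ := fun i => ∑ k ∈ Finset.range i, d k * (ξ (k + p + 2) - ξ (k + 1)) / ((p : ℝ) + 1)
  have hp : (p : ℝ) + 1 ≠ 0 := by positivity
  have hc : ∀ i < n - 1, derivCoeff ξ p c i = d i := by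
    intro i hi
    have := lt_reduced_support h hr hr0 hi
    have hne : ξ (i + p + 2) - ξ (i + 1) ≠ 0 := by linarith
    simp only [derivCoeff, c, Finset.sum_range_succ, add_sub_cancel_left]
    field_simp
  have hc0 : c 0 = 0 := by simp [c]
  refine ⟨c, hc, fun x hx => ?_⟩
  set S : ℝ → ℝ := fun x => ∑ i ∈ Finset.range n, c i * bspline ξ (p + 1) i x with hS
  have hS0 : S 0 = 0 := by
    refine Finset.sum_eq_zero fun i hi => ?_
    rw [Finset.mem_range] at hi
    have hsi : SortedKnots ξ i (i + (p + 1) + 1) := h.sorted_sub (by omega)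
    rcases Nat.eq_zero_or_pos i with rfl | hi0
    · rw [hc0, zero_mul]
    · have hlt : 0 < ξ (i + (p + 1)) := h.pos _ (by omega) (by omega)
      rcases (h.nonneg (by omega : i ≤ n + (p + 1))).eq_or_lt with h0 | h0
      · have := bspline_left_endpoint hsi (h0 ▸ hlt)
        rw [← h0] at this
        rw [this, mul_zero]
      · rw [bspline_eq_zero_of_lt hsi h0, mul_zero]
  have hcont : ContinuousOn S (Icc 0 x) := by
    refine continuousOn_finsetSum _ fun i hi y hy => ?_
    rw [Finset.mem_range] at hi
    rcases hy.1.eq_or_lt with h0 | h0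
    · subst h0
      rcases Nat.eq_zero_or_pos i with rfl | hi0
      · simp only [hc0, zero_mul]; exact continuousWithinAt_const
      · have h1 : 0 < ξ (i + (p + 1)) := h.pos _ (by omega) (by omega)
        have h2 : 0 < ξ (i + (p + 1) + 1) := h.pos _ (by omega) (by omega)
        exact (continuousAt_const.mul (continuousAt_bspline (h.sorted_sub (by omega))
          (fun hcc => h1.ne' hcc.2) (fun hcc => h2.ne' hcc.2))).continuousWithinAt
    · exact (continuousAt_const.mul (continuousAt_bspline_of_regularity h hr (by push_cast; omega)
        (by omega) ⟨h0, hy.2.trans_lt hx.2⟩)).continuousWithinAt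
  have key := integral_eq_of_hasDerivAt_off_countable_of_le S (fun x => ∑ i ∈ Finset.range (n - 1),
    d i * bspline (fun j => ξ (j + 1)) p i x) hx.1 (finite_knotSet ξ 0 (n + p + 1)).countable hcont
    (fun y hy => by
      refine (hasDerivAt_spline_of_offKnots h c (notMem_knotSet.1 hy.2)).congr_deriv ?_
      refine Finset.sum_congr rfl fun i hi => ?_
      rw [hc i (Finset.mem_range.1 hi)])
    (intervalIntegrable_spline h.shift d 0 x)
  rw [hS0, sub_zero] at key
  exact key.symm

lemma IsOpenKnotVector.support_subset (h : IsOpenKnotVector p n ξ) {j : ℕ} (hj : j < n) :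
    Ioo (ξ j) (ξ (j + p + 1)) ⊆ Ioo 0 1 := fun _ hx =>
  ⟨(h.nonneg (by omega)).trans_lt hx.1, hx.2.trans_le (h.le_one (by omega))⟩

lemma proj_congr (h : IsOpenKnotVector p n ξ) (hr : HasRegularity p n ξ r) (hr1 : -1 ≤ r)
    {v w : ℝ → ℝ} (hvw : ∀ᵐ x, x ∈ Ioo (0 : ℝ) 1 → v x = w x) : proj ξ p n v = proj ξ p n w := by
  funext x
  refine Finset.sum_congr rfl fun j hj => ?_
  rw [Finset.mem_range] at hj
  congr 1
  refine dualFunctional_congr (h.lt_support hr hr1 hj) ?_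
  filter_upwards [hvw] with y hy hy2 using hy (h.support_subset hj hy2)

lemma dualFunctional_add {ξ : ℕ → ℝ} {p j : ℕ} (hs : SortedKnots ξ j (j + p + 1))
    (h : ξ j < ξ (j + p + 1)) {v w : ℝ → ℝ}
    (hv : IntervalIntegrable v volume (ξ j) (ξ (j + p + 1)))
    (hw : IntervalIntegrable w volume (ξ j) (ξ (j + p + 1))) :
    dualFunctional ξ p j (fun x => v x + w x)
      = dualFunctional ξ p j v + dualFunctional ξ p j w := by
  simp only [dualFunctional, add_mul]
  exact intervalIntegral.integral_add (intervalIntegrable_mul_dualKernel hs h hv)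
    (intervalIntegrable_mul_dualKernel hs h hw)

lemma proj_polynomial (h : IsOpenKnotVector p n ξ) (hr : HasRegularity p n ξ r) (hr1 : -1 ≤ r)
    {q : Polynomial ℝ} (hq : q.natDegree ≤ p) {x : ℝ} (hx : x ∈ Ico (0 : ℝ) 1) :
    proj ξ p n (fun y => q.eval y) x = q.eval x := by
  obtain ⟨c, hc⟩ := exists_eq_sum_bspline ξ p n h.sorted q hq
  rw [h.eq_zero p le_rfl, h.eq_one n le_rfl (by omega)] at hc
  rw [proj_congr h hr hr1 (w := fun x => ∑ i ∈ Finset.range n, c i * bspline ξ p i x)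
    (Filter.Eventually.of_forall fun y hy => (hc y ⟨hy.1.le, hy.2⟩).symm), proj_sum h hr hr1]
  exact hc x hx

lemma proj_add_polynomial (h : IsOpenKnotVector p n ξ) (hr : HasRegularity p n ξ r) (hr1 : -1 ≤ r)
    {w : ℝ → ℝ} (hw : IntegrableOn w (Ioo 0 1)) {q : Polynomial ℝ} (hq : q.natDegree ≤ p) {x : ℝ}
    (hx : x ∈ Ico (0 : ℝ) 1) :
    proj ξ p n (fun y => w y + q.eval y) x = proj ξ p n w x + q.eval x := by
  rw [← proj_polynomial h hr hr1 hq hx, proj, proj, proj, ← Finset.sum_add_distrib]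
  refine Finset.sum_congr rfl fun j hj => ?_
  rw [Finset.mem_range] at hj
  have hlt := h.lt_support hr hr1 hj
  rw [dualFunctional_add (h.sorted_sub (by omega)) hlt, add_mul]
  · rw [intervalIntegrable_iff_integrableOn_Ioo_of_le hlt.le]
    exact hw.mono_set (h.support_subset hj)
  · exact (contDiff_polynomial_eval q (n := 0)).continuous.intervalIntegrable _ _

/-- Functions with the same weak derivative differ by a polynomial. -/
lemma HasWeakDeriv.exists_polynomial {a b : ℝ} (hab : a < b) {v w g : ℝ → ℝ} {l : ℕ}
    (hv : HasWeakDeriv (Ioo a b) l v g) (hw : HasWeakDeriv (Ioo a b) l w g) :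
    ∃ q : Polynomial ℝ, q.degree < l ∧ ∀ᵐ x, x ∈ Ioo a b → v x = w x + q.eval x := by
  obtain ⟨q, hq, hae⟩ := exists_polynomial_of_integral_iteratedDeriv_eq_zero (l := l)
    (w := fun x => v x - w x) hab (hv.1.sub hw.1) (fun φ hφ => by
      simp only [sub_mul]
      rw [integral_sub ((hφ.iteratedDeriv l).integrable hv.1).integrableOn
        ((hφ.iteratedDeriv l).integrable hw.1).integrableOn, hv.eq hφ, hw.eq hφ, sub_self])
  refine ⟨q, hq, ?_⟩
  filter_upwards [hae] with x hx hxI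
  rw [← hx hxI]
  ring

lemma hasWeakDeriv_antideriv {g : ℝ → ℝ} (hg : IntegrableOn g (Ioo 0 1)) :
    HasWeakDeriv (Ioo 0 1) 1 (antideriv g) g := hasWeakDeriv_primitive zero_le_one hg

lemma integrableOn_primitive {a b : ℝ} (hab : a ≤ b) {g : ℝ → ℝ} (hg : IntegrableOn g (Ioo a b)) :
    IntegrableOn (fun x => ∫ t in a..x, g t) (Ioo a b) := by
  have hgi : IntervalIntegrable g volume a b := by
    rwa [intervalIntegrable_iff_integrableOn_Ioo_of_le hab]
  have hAC := (hgi.absolutelyContinuousOnInterval_intervalIntegral (c := a)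
    left_mem_uIcc).continuousOn
  have := hAC.intervalIntegrable (μ := volume)
  rwa [intervalIntegrable_iff_integrableOn_Ioo_of_le hab] at this

lemma integrableOn_antideriv {g : ℝ → ℝ} (hg : IntegrableOn g (Ioo 0 1)) :
    IntegrableOn (antideriv g) (Ioo 0 1) := integrableOn_primitive zero_le_one hg

lemma integrableOn_of_memLp {g : ℝ → ℝ} (hg : MemLp g 2 (volume.restrict (Ioo 0 1))) :
    IntegrableOn g (Ioo 0 1) := hg.integrable one_le_two

/-- Any weak derivative of a Sobolev function is square integrable. -/
lemma MemSobolev.memLp {l k : ℕ} {v g : ℝ → ℝ} (hv : MemSobolev (Ioo 0 1) l v) (hk : k ≤ l)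
    (hg : HasWeakDeriv (Ioo 0 1) k v g) : MemLp g 2 (volume.restrict (Ioo 0 1)) := by
  obtain ⟨w, hw, hw2⟩ := hv k hk
  exact hw2.ae_eq (hw.unique isOpen_Ioo hg)

lemma ae_restrict_of_offKnots {P : ℝ → Prop}
    (hP : ∀ x ∈ Ioo (0 : ℝ) 1, OffKnots ξ 0 (n + p) x → P x) :
    ∀ᵐ x ∂(volume.restrict (Ioo (0 : ℝ) 1)), P x := by
  rw [ae_restrict_iff' measurableSet_Ioo]
  filter_upwards [ae_offKnots ξ 0 (n + p)] with x hx hxI using hP x hxI hx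

/-! ### The first commuting projection -/

lemma deriv_proj_of_offKnots (h : IsOpenKnotVector (p + 1) n ξ) (v : ℝ → ℝ) {x : ℝ}
    (hx : OffKnots ξ 0 (n + p + 1) x) : deriv (proj ξ (p + 1) n v) x
      = ∑ i ∈ Finset.range (n - 1), derivCoeff ξ p (fun i => dualFunctional ξ (p + 1) i v) i
        * bspline (fun j => ξ (j + 1)) p i x :=
  (hasDerivAt_spline_of_offKnots h _ hx).deriv

lemma exists_projC1_ae_eq (h : IsOpenKnotVector (p + 1) n ξ) (v : ℝ → ℝ) :
    ∃ s ∈ reducedSplineSpace 1 ξ (p + 1) n,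
      projC1 ξ (p + 1) n v =ᵐ[volume.restrict (Ioo 0 1)] s :=
  ⟨_, mem_reducedSplineSpace_iff.2 ⟨_, rfl⟩,
    ae_restrict_of_offKnots fun _ _ hx => deriv_proj_of_offKnots h _ hx⟩

lemma projC1_eq_self (h : IsOpenKnotVector (p + 1) n ξ) (hr : HasRegularity (p + 1) n ξ r)
    (hr0 : 0 ≤ r) {s : ℝ → ℝ} (hs : s ∈ reducedSplineSpace 1 ξ (p + 1) n) :
    projC1 ξ (p + 1) n s =ᵐ[volume.restrict (Ioo 0 1)] s := by
  obtain ⟨d, rfl⟩ := mem_reducedSplineSpace_iff.1 hs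
  obtain ⟨c, hc, hcs⟩ := exists_antideriv_eq h hr hr0 d
  have e : proj ξ (p + 1) n (antideriv fun x => ∑ i ∈ Finset.range (n - 1),
      d i * bspline (fun j => ξ (j + 1)) p i x)
      = fun x => ∑ i ∈ Finset.range n, c i * bspline ξ (p + 1) i x := by
    rw [← proj_sum h hr (by omega) c]
    exact proj_congr h hr (by omega) (Filter.Eventually.of_forall fun x hx =>
      (hcs x ⟨hx.1.le, hx.2⟩).symm)
  refine ae_restrict_of_offKnots (ξ := ξ) (n := n) (p := p + 1) fun x _ hx => ?_
  rw [projC1, Nat.add_sub_cancel, e, (hasDerivAt_spline_of_offKnots h c hx).deriv]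
  exact Finset.sum_congr rfl fun i hi => by rw [hc i (Finset.mem_range.1 hi)]

/-- Commutation of the projections with the derivative. -/
lemma projC1_eq_deriv_proj (h : IsOpenKnotVector (p + 1) n ξ) (hr : HasRegularity (p + 1) n ξ r)
    (hr0 : 0 ≤ r) {v v' : ℝ → ℝ} (hv : HasWeakDeriv (Ioo 0 1) 1 v v')
    (hv' : IntegrableOn v' (Ioo 0 1)) {x : ℝ} (hx : x ∈ Ioo (0 : ℝ) 1) :
    projC1 ξ (p + 1) n v' x = deriv (proj ξ (p + 1) n v) x := by
  obtain ⟨q, hq, hae⟩ := hv.exists_polynomial zero_lt_one (hasWeakDeriv_antideriv hv')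
  have hq0 : q.natDegree = 0 := by
    rw [Polynomial.natDegree_eq_zero_iff_degree_le_zero]
    exact Order.lt_succ_iff.1 (by exact_mod_cast hq)
  rw [proj_congr h hr (by omega) hae, projC1]
  have : proj ξ (p + 1) n (fun y => antideriv v' y + q.eval y) =ᶠ[nhds x]
      fun y => proj ξ (p + 1) n (antideriv v') y + q.coeff 0 := by
    filter_upwards [isOpen_Ioo.mem_nhds hx] with y hy
    rw [proj_add_polynomial h hr (by omega) (integrableOn_antideriv hv') (by omega)
      ⟨hy.1.le, hy.2⟩]
    congr 1
    conv_lhs => rw [Polynomial.eq_C_of_natDegree_eq_zero hq0, Polynomial.eval_C]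
  rw [this.deriv_eq, deriv_add_const]

lemma integrableOn_spline (h : IsOpenKnotVector p n ξ) (c : ℕ → ℝ) :
    IntegrableOn (fun x => ∑ i ∈ Finset.range n, c i * bspline ξ p i x) (Ioo 0 1) := by
  have := intervalIntegrable_spline h c 0 1
  rwa [intervalIntegrable_iff_integrableOn_Ioo_of_le zero_le_one] at this

lemma hasWeakDeriv_proj (h : IsOpenKnotVector (p + 1) n ξ) (hr : HasRegularity (p + 1) n ξ r)
    (hr0 : 0 ≤ r) {v w : ℝ → ℝ} (hw : ∀ x ∈ Ioo (0 : ℝ) 1, w x = deriv (proj ξ (p + 1) n v) x) :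
    HasWeakDeriv (Ioo 0 1) 1 (proj ξ (p + 1) n v) w := by
  refine hasWeakDeriv_one_of_hasDerivAt isOpen_Ioo (continuousOn_spline h hr hr0 _)
    (finite_knotSet ξ 0 (n + p + 1)).countable (fun x hx => ?_) ?_
  · rw [hw x hx.1]
    exact (hasDerivAt_spline_of_offKnots h _
      (notMem_knotSet.1 hx.2)).differentiableAt.hasDerivAt
  · refine IntegrableOn.locallyIntegrableOn ((integrableOn_spline h.shift
      (derivCoeff ξ p fun i => dualFunctional ξ (p + 1) i v)).congr ?_)
    refine ae_restrict_of_offKnots (ξ := ξ) (n := n) (p := p + 1) fun x hxI hx => ?_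
    rw [hw x hxI, deriv_proj_of_offKnots h v hx]

/-! ### The second commuting projection -/

lemma deriv_proj_of_regularity (h : IsOpenKnotVector (p + 2) n ξ)
    (hr : HasRegularity (p + 2) n ξ r) (hr1 : 1 ≤ r) (v : ℝ → ℝ) {x : ℝ} (hx : x ∈ Ioo (0 : ℝ) 1) :
    HasDerivAt (proj ξ (p + 2) n v)
      (∑ i ∈ Finset.range (n - 1), derivCoeff ξ (p + 1) (fun i => dualFunctional ξ (p + 2) i v) i
        * bspline (fun j => ξ (j + 1)) (p + 1) i x) x :=
  hasDerivAt_spline_of_regularity h hr hr1 _ hx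

lemma hasDerivAt_deriv_proj (h : IsOpenKnotVector (p + 2) n ξ)
    (hr : HasRegularity (p + 2) n ξ r) (hr1 : 1 ≤ r) (v : ℝ → ℝ) {x : ℝ} (hxI : x ∈ Ioo (0 : ℝ) 1)
    (hx : OffKnots ξ 0 (n + (p + 2)) x) :
    HasDerivAt (deriv (proj ξ (p + 2) n v))
      (∑ i ∈ Finset.range (n - 2), derivCoeff (fun j => ξ (j + 1)) p
        (derivCoeff ξ (p + 1) fun i => dualFunctional ξ (p + 2) i v) i
        * bspline (fun j => ξ (j + 2)) p i x) x := by
  have h1 := hasDerivAt_spline_of_offKnots h.shift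
    (derivCoeff ξ (p + 1) fun i => dualFunctional ξ (p + 2) i v) (x := x)
    (fun k _ hk => hx (k + 1) (by omega) (by omega))
  refine h1.congr_of_eventuallyEq ?_
  filter_upwards [isOpen_Ioo.mem_nhds hxI] with y hy
  exact (deriv_proj_of_regularity h hr hr1 v hy).deriv

lemma exists_projC2_ae_eq (h : IsOpenKnotVector (p + 2) n ξ) (hr : HasRegularity (p + 2) n ξ r)
    (hr1 : 1 ≤ r) (v : ℝ → ℝ) : ∃ s ∈ reducedSplineSpace 2 ξ (p + 2) n,
      projC2 ξ (p + 2) n v =ᵐ[volume.restrict (Ioo 0 1)] s :=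
  ⟨_, mem_reducedSplineSpace_iff.2 ⟨_, rfl⟩,
    ae_restrict_of_offKnots fun _ hxI hx => (hasDerivAt_deriv_proj h hr hr1 _ hxI hx).deriv⟩

lemma projC2_eq_self (h : IsOpenKnotVector (p + 2) n ξ) (hr : HasRegularity (p + 2) n ξ r)
    (hr1 : 1 ≤ r) {s : ℝ → ℝ} (hs : s ∈ reducedSplineSpace 2 ξ (p + 2) n) :
    projC2 ξ (p + 2) n s =ᵐ[volume.restrict (Ioo 0 1)] s := by
  have hn : 1 ≤ n := by have := h.lt; omega
  obtain ⟨d, rfl⟩ := mem_reducedSplineSpace_iff.1 hs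
  rw [Nat.add_sub_cancel]
  set s : ℝ → ℝ := fun x => ∑ i ∈ Finset.range (n - 2),
    d i * bspline (fun j => ξ (j + 2)) p i x with hsdef
  obtain ⟨d', hd', hds⟩ := exists_antideriv_eq h.shift (hr.shift hn) (by omega) d
  obtain ⟨c, hc, hcs⟩ := exists_antideriv_eq h hr (by omega) d'
  have e1 : ∀ x ∈ Ico (0 : ℝ) 1, ∑ i ∈ Finset.range n, c i * bspline ξ (p + 2) i x
      = antideriv (antideriv s) x := by
    intro x hx
    rw [hcs x hx]
    refine intervalIntegral.integral_congr fun y hy => ?_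
    rw [uIcc_of_le hx.1] at hy
    exact hds y ⟨hy.1, hy.2.trans_lt hx.2⟩
  have e : proj ξ (p + 2) n (antideriv (antideriv s))
      = fun x => ∑ i ∈ Finset.range n, c i * bspline ξ (p + 2) i x := by
    rw [← proj_sum h hr (by omega) c]
    exact proj_congr h hr (by omega) (Filter.Eventually.of_forall fun x hx =>
      (e1 x ⟨hx.1.le, hx.2⟩).symm)
  refine ae_restrict_of_offKnots (ξ := ξ) (n := n) (p := p + 2) fun x hxI hx => ?_
  have h1 := hasDerivAt_spline_of_offKnots h.shift (derivCoeff ξ (p + 1) c) (x := x)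
    (fun k _ hk => hx (k + 1) (by omega) (by omega))
  have h2 : deriv (fun x => ∑ i ∈ Finset.range n, c i * bspline ξ (p + 2) i x) =ᶠ[nhds x]
      fun x => ∑ i ∈ Finset.range (n - 1), derivCoeff ξ (p + 1) c i
        * bspline (fun j => ξ (j + 1)) (p + 1) i x := by
    filter_upwards [isOpen_Ioo.mem_nhds hxI] with y hy
    exact (hasDerivAt_spline_of_regularity h hr hr1 c hy).deriv
  rw [projC2, e, h2.deriv_eq, h1.deriv]
  refine Finset.sum_congr rfl fun i hi => ?_
  rw [Finset.mem_range] at hi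
  congr 1
  rw [← hd' i hi, derivCoeff, hc _ (by omega), hc _ (by omega)]
  rfl

lemma projC2_eq_deriv_deriv_proj (h : IsOpenKnotVector (p + 2) n ξ)
    (hr : HasRegularity (p + 2) n ξ r) (hr1 : 1 ≤ r) {v v'' : ℝ → ℝ}
    (hv : HasWeakDeriv (Ioo 0 1) 2 v v'') (hv'' : IntegrableOn v'' (Ioo 0 1)) {x : ℝ}
    (hx : x ∈ Ioo (0 : ℝ) 1) :
    projC2 ξ (p + 2) n v'' x = deriv (deriv (proj ξ (p + 2) n v)) x := by
  have hA := integrableOn_antideriv hv''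
  obtain ⟨q, hq, hae⟩ := hv.exists_polynomial zero_lt_one
    ((hasWeakDeriv_antideriv hA).comp (hasWeakDeriv_antideriv hv''))
  have hq1 : q.natDegree ≤ 1 := by
    rw [Polynomial.natDegree_le_iff_degree_le]
    exact Order.lt_succ_iff.1 (by exact_mod_cast hq)
  rw [proj_congr h hr (by omega) hae, projC2]
  have e : ∀ y ∈ Ioo (0 : ℝ) 1, proj ξ (p + 2) n (fun y => antideriv (antideriv v'') y + q.eval y)
      =ᶠ[nhds y] fun y => proj ξ (p + 2) n (antideriv (antideriv v'')) y + q.eval y := by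
    intro y hy
    filter_upwards [isOpen_Ioo.mem_nhds hy] with z hz
    exact proj_add_polynomial h hr (by omega) (integrableOn_antideriv hA) (by omega)
      ⟨hz.1.le, hz.2⟩
  have hqd : q.derivative.natDegree = 0 := by
    have := Polynomial.natDegree_derivative_le q
    omega
  have e2 : deriv (proj ξ (p + 2) n fun y => antideriv (antideriv v'') y + q.eval y) =ᶠ[nhds x]
      fun y => deriv (proj ξ (p + 2) n (antideriv (antideriv v''))) y + q.derivative.coeff 0 := by
    filter_upwards [isOpen_Ioo.mem_nhds hx] with y hy
    rw [(e y hy).deriv_eq, deriv_fun_add (deriv_proj_of_regularity h hr hr1 _ hy).differentiableAt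
      q.differentiable.differentiableAt, q.deriv]
    congr 1
    conv_lhs => rw [Polynomial.eq_C_of_natDegree_eq_zero hqd, Polynomial.eval_C]
  rw [e2.deriv_eq, deriv_add_const]

lemma hasWeakDeriv_deriv_proj (h : IsOpenKnotVector (p + 2) n ξ)
    (hr : HasRegularity (p + 2) n ξ r) (hr1 : 1 ≤ r) {v w u : ℝ → ℝ}
    (hw : ∀ x ∈ Ioo (0 : ℝ) 1, w x = deriv (proj ξ (p + 2) n v) x)
    (hu : ∀ x ∈ Ioo (0 : ℝ) 1, u x = deriv (deriv (proj ξ (p + 2) n v)) x) :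
    HasWeakDeriv (Ioo 0 1) 1 w u := by
  have hn : 1 ≤ n := by have := h.lt; omega
  refine hasWeakDeriv_one_of_hasDerivAt isOpen_Ioo ?_
    (finite_knotSet ξ 0 (n + (p + 2))).countable (fun x hx => ?_) ?_
  · refine (continuousOn_spline h.shift (hr.shift hn) (by omega)
      (derivCoeff ξ (p + 1) fun i => dualFunctional ξ (p + 2) i v)).congr fun x hx => ?_
    rw [hw x hx, (deriv_proj_of_regularity h hr hr1 v hx).deriv]
  · rw [hu x hx.1]
    refine (hasDerivAt_deriv_proj h hr hr1 v hx.1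
      (notMem_knotSet.1 hx.2)).differentiableAt.hasDerivAt.congr_of_eventuallyEq ?_
    filter_upwards [isOpen_Ioo.mem_nhds hx.1] with y hy using hw y hy
  · refine IntegrableOn.locallyIntegrableOn ((integrableOn_spline h.shift.shift
      (derivCoeff (fun j => ξ (j + 1)) p
        (derivCoeff ξ (p + 1) fun i => dualFunctional ξ (p + 2) i v))).congr ?_)
    refine ae_restrict_of_offKnots (ξ := ξ) (n := n) (p := p + 2) fun x hxI hx => ?_
    rw [hu x hxI, (hasDerivAt_deriv_proj h hr hr1 v hxI hx).deriv]
    rfl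

end UnivariateSpline

namespace UnivariateSpline

variable {p n : ℕ} {ξ : ℕ → ℝ} {r : ℤ}

/-! ### Iterated primitives -/

/-- The `l`-fold iterated primitive with base point `a`. -/
noncomputable def iterPrimitive (a : ℝ) (g : ℝ → ℝ) : ℕ → ℝ → ℝ
  | 0 => g
  | l + 1 => fun x => ∫ t in a..x, iterPrimitive a g l t

lemma integrableOn_iterPrimitive {a b : ℝ} (hab : a ≤ b) {g : ℝ → ℝ}
    (hg : IntegrableOn g (Ioo a b)) (l : ℕ) : IntegrableOn (iterPrimitive a g l) (Ioo a b) := by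
  induction l with
  | zero => exact hg
  | succ l ih => exact integrableOn_primitive hab ih

lemma hasWeakDeriv_iterPrimitive {a b : ℝ} (hab : a ≤ b) {g : ℝ → ℝ}
    (hg : IntegrableOn g (Ioo a b)) (l : ℕ) :
    HasWeakDeriv (Ioo a b) l (iterPrimitive a g l) g := by
  induction l with
  | zero => exact ⟨hg.locallyIntegrableOn, hg.locallyIntegrableOn, fun φ _ _ _ => by
      simp [iterPrimitive]⟩
  | succ l ih =>
    exact (hasWeakDeriv_primitive hab (integrableOn_iterPrimitive hab hg l)).comp ih

lemma integral_abs_iterPrimitive_le {a b : ℝ} (hab : a ≤ b) {g : ℝ → ℝ}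
    (hg : IntegrableOn g (Ioo a b)) (l : ℕ) :
    ∫ x in Ioo a b, |iterPrimitive a g l x| ≤ (b - a) ^ l * ∫ x in Ioo a b, |g x| := by
  induction l with
  | zero => simp [iterPrimitive]
  | succ l ih =>
    have hi := integrableOn_iterPrimitive hab hg l
    have hpt : ∀ x ∈ Ioo a b, |iterPrimitive a g (l + 1) x|
        ≤ ∫ t in Ioo a b, |iterPrimitive a g l t| := by
      intro x hx
      change |∫ t in a..x, iterPrimitive a g l t| ≤ _
      rw [intervalIntegral.integral_of_le hx.1.le, ← Real.norm_eq_abs]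
      refine (norm_integral_le_integral_norm _).trans ?_
      rw [← integral_Ioc_eq_integral_Ioo]
      refine setIntegral_mono_set ?_ (Filter.Eventually.of_forall fun t => abs_nonneg _)
        (Ioc_subset_Ioc_right hx.2.le).eventuallyLE
      have h1 : IntegrableOn (fun t => |iterPrimitive a g l t|) (Ioo a b) := hi.norm
      exact h1.congr_set_ae Ioo_ae_eq_Ioc.symm
    calc ∫ x in Ioo a b, |iterPrimitive a g (l + 1) x|
        ≤ ∫ _ in Ioo a b, ∫ t in Ioo a b, |iterPrimitive a g l t| :=
          setIntegral_mono_on (integrableOn_iterPrimitive hab hg (l + 1)).norm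
            (integrableOn_const (by simp)) measurableSet_Ioo hpt
      _ = (b - a) * ∫ t in Ioo a b, |iterPrimitive a g l t| := by
          rw [setIntegral_const, smul_eq_mul, Measure.real, Real.volume_Ioo,
            ENNReal.toReal_ofReal (by linarith)]
      _ ≤ (b - a) * ((b - a) ^ l * ∫ x in Ioo a b, |g x|) := by
          have : 0 ≤ b - a := by linarith
          gcongr
      _ = _ := by ring

/-! ### Elements -/

lemma IsElement.le (h : IsOpenKnotVector p n ξ) {i : ℕ} (hi : IsElement p n ξ i) : p ≤ i := by
  by_contra! hc
  have := hi.2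
  rw [h.eq_zero i (by omega), h.eq_zero (i + 1) (by omega)] at this
  exact lt_irrefl _ this

lemma IsElement.lt (h : IsOpenKnotVector p n ξ) {i : ℕ} (hi : IsElement p n ξ i) : i < n := by
  by_contra! hc
  have := hi.2
  have h1 := hi.1
  rw [h.eq_one i hc (by omega), h.eq_one (i + 1) (by omega) h1] at this
  exact lt_irrefl _ this

lemma offKnots_of_mem_element (h : IsOpenKnotVector p n ξ) {i : ℕ} {x : ℝ} (hx : x ∈ element ξ i)
    {a b : ℕ} (hb : b ≤ n + p) (hi : i + 1 ≤ n + p) : OffKnots ξ a b x := by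
  intro k _ hk2
  rcases Nat.lt_or_ge i k with hik | hik
  · exact (hx.2.trans_le (h.mono _ _ hik (by omega))).ne
  · exact ((h.mono _ _ hik (by omega)).trans_lt hx.1).ne'

lemma abs_iteratedDeriv_bspline_le_of_mem_element (h : IsOpenKnotVector p n ξ) {i : ℕ}
    (hi : IsElement p n ξ i) {x : ℝ} (hx : x ∈ element ξ i) {j : ℕ} (hj : j < n) (l : ℕ) :
    |iteratedDeriv l (bspline ξ p j) x| * (ξ (i + 1) - ξ i) ^ l ≤ 2 ^ p * (2 * (p : ℝ)) ^ l := by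
  have h1 := hi.1
  refine abs_iteratedDeriv_bspline_le l (h.sorted_sub (by omega))
    (offKnots_of_mem_element h hx (by omega) h1) (by linarith [hi.2]) fun a b ha hab hb hax hxb => ?_
  have h2 : ξ a ≤ ξ i := by
    by_contra! hc
    have : i + 1 ≤ a := by
      by_contra! hcc
      exact absurd (h.mono a i (by omega) (by omega)) (not_le.2 hc)
    linarith [h.mono _ _ this (by omega), hx.2]
  have h3 : ξ (i + 1) ≤ ξ b := by
    by_contra! hc
    have : b ≤ i := by
      by_contra! hcc
      exact absurd (h.mono (i + 1) b (by omega) (by omega)) (not_le.2 hc)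
    linarith [h.mono _ _ this (by omega), hx.1]
  linarith

lemma bspline_eq_zero_of_mem_element (h : IsOpenKnotVector p n ξ) {i : ℕ}
    (hi : IsElement p n ξ i) {x : ℝ} (hx : x ∈ element ξ i) {j : ℕ} (hj : j < n)
    (hij : ¬ (j ≤ i ∧ i ≤ j + p)) : bspline ξ p j x = 0 := by
  have h1 := hi.1
  rcases Nat.lt_or_ge i j with hc | hc
  · exact bspline_eq_zero_of_lt (h.sorted_sub (by omega))
      (hx.2.trans_le (h.mono _ _ hc (by omega)))
  · exact bspline_eq_zero_of_ge (h.sorted_sub (by omega))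
      ((h.mono (j + p + 1) i (by omega) (by omega)).trans hx.1.le)

lemma contDiffAt_proj (h : IsOpenKnotVector p n ξ) {i : ℕ} (hi : IsElement p n ξ i) (v : ℝ → ℝ)
    {x : ℝ} (hx : x ∈ element ξ i) : ContDiffAt ℝ ∞ (proj ξ p n v) x := by
  refine ContDiffAt.sum fun j hj => contDiffAt_const.mul (contDiffAt_bspline ?_)
  rw [Finset.mem_range] at hj
  exact offKnots_of_mem_element h hx (by omega) hi.1

lemma supportExtension_subset (h : IsOpenKnotVector p n ξ) {i : ℕ} (hi : IsElement p n ξ i) :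
    supportExtension ξ p i ⊆ Ioo 0 1 := by
  have h1 := hi.lt h
  exact fun x hx => ⟨(h.nonneg (by omega)).trans_lt hx.1, hx.2.trans_le (h.le_one (by omega))⟩

lemma element_subset (h : IsOpenKnotVector p n ξ) {i : ℕ} (hi : IsElement p n ξ i) :
    element ξ i ⊆ Ioo 0 1 :=
  fun _ hx => ⟨(h.nonneg (by have := hi.1; omega)).trans_lt hx.1, hx.2.trans_le (h.le_one hi.1)⟩

/-- The dual functionals are bounded by the mean over the support. -/
lemma exists_abs_dualFunctional_le (p : ℕ) : ∃ C : ℝ, 0 ≤ C ∧ ∀ (ξ : ℕ → ℝ) (j : ℕ),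
    SortedKnots ξ j (j + p + 1) → ξ j < ξ (j + p + 1) → ∀ w : ℝ → ℝ,
    IntegrableOn w (Ioo (ξ j) (ξ (j + p + 1))) →
    |dualFunctional ξ p j w| * (ξ (j + p + 1) - ξ j)
      ≤ C * ∫ x in Ioo (ξ j) (ξ (j + p + 1)), |w x| := by
  obtain ⟨C, hC0, hC⟩ := exists_dualKernel_bound p
  refine ⟨C, hC0, fun ξ j hs h w hw => ?_⟩
  have hH : 0 < ξ (j + p + 1) - ξ j := by linarith
  rw [← le_div_iff₀ hH, dualFunctional, intervalIntegral.integral_of_le h.le,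
    integral_Ioc_eq_integral_Ioo, mul_div_right_comm, ← integral_const_mul, ← Real.norm_eq_abs]
  refine (norm_integral_le_integral_norm _).trans ?_
  refine integral_mono_of_nonneg (Filter.Eventually.of_forall fun x => norm_nonneg _)
    (hw.norm.const_mul _) (ae_restrict_of_ae ?_)
  filter_upwards [hC ξ j hs h] with x hx
  rw [norm_mul, Real.norm_eq_abs, Real.norm_eq_abs, mul_comm]
  gcongr

/-- The local estimate in terms of the `L¹`-norm of a weak derivative. -/
lemma exists_abs_iteratedDeriv_proj_le (p : ℕ) : ∃ C : ℝ, 0 ≤ C ∧ ∀ (n : ℕ) (ξ : ℕ → ℝ) (r : ℤ),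
    IsOpenKnotVector p n ξ → HasRegularity p n ξ r → -1 ≤ r → ∀ i, IsElement p n ξ i →
    ∀ l ≤ p + 1, ∀ v g : ℝ → ℝ, HasWeakDeriv (supportExtension ξ p i) l v g →
    IntegrableOn g (supportExtension ξ p i) → ∀ x ∈ element ξ i,
    |iteratedDeriv l (proj ξ p n v) x| * (ξ (i + 1) - ξ i) ^ (l + 1)
      ≤ C * ((ξ (i + p + 1) - ξ (i - p)) ^ l * ∫ x in supportExtension ξ p i, |g x|) := by
  obtain ⟨C, hC0, hC⟩ := exists_abs_dualFunctional_le p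
  refine ⟨∑ _j ∈ Finset.Icc 0 p, C * (2 ^ p * (2 * (p : ℝ) + 1) ^ (p + 1)), by positivity,
    fun n ξ r h hr hr1 i hi l hl v g hv hg x hx => ?_⟩
  have hpi := hi.le h
  have hin := hi.lt h
  set a := ξ (i - p) with ha
  set b := ξ (i + p + 1) with hb
  have hai : a ≤ ξ i := h.mono _ _ (by omega) (by omega)
  have hib : ξ (i + 1) ≤ b := h.mono _ _ (by omega) (by omega)
  have hab : a < b := by linarith [hi.2]
  have hδ : 0 < ξ (i + 1) - ξ i := by linarith [hi.2]
  set w := iterPrimitive a g l with hw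
  have hwi : IntegrableOn w (Ioo a b) := integrableOn_iterPrimitive hab.le hg l
  obtain ⟨q, hq, hae⟩ := HasWeakDeriv.exists_polynomial hab hv
    (hasWeakDeriv_iterPrimitive hab.le hg l)
  have hqp : q.natDegree ≤ p := by
    rcases eq_or_ne q 0 with rfl | hq0
    · simp
    · rw [Polynomial.degree_eq_natDegree hq0, Nat.cast_lt] at hq
      omega
  have hsub : ∀ j, j ≤ i → i ≤ j + p → Ioo (ξ j) (ξ (j + p + 1)) ⊆ Ioo a b := fun j h1 h2 =>
    Ioo_subset_Ioo (h.mono _ _ (by omega) (by omega)) (h.mono _ _ (by omega) (by omega))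
  have hdual : ∀ j, j ≤ i → i ≤ j + p → dualFunctional ξ p j v
      = dualFunctional ξ p j w + dualFunctional ξ p j (fun y => q.eval y) := by
    intro j h1 h2
    have hlt := h.lt_support hr hr1 (by omega : j < n)
    rw [← dualFunctional_add (h.sorted_sub (by omega)) hlt]
    · refine dualFunctional_congr hlt ?_
      filter_upwards [hae] with y hy hyI using hy (hsub j h1 h2 hyI)
    · rw [intervalIntegrable_iff_integrableOn_Ioo_of_le hlt.le]
      exact hwi.mono_set (hsub j h1 h2)
    · exact (contDiff_polynomial_eval q (n := 0)).continuous.intervalIntegrable _ _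
  set J := (Finset.range n).filter fun j => j ≤ i ∧ i ≤ j + p with hJ
  have hEq : EqOn (proj ξ p n v) ((fun y => ∑ j ∈ J, dualFunctional ξ p j w * bspline ξ p j y)
      + fun y => q.eval y) (element ξ i) := by
    intro y hy
    have hy1 := element_subset h hi hy
    rw [Pi.add_apply, ← proj_polynomial h hr hr1 hqp ⟨hy1.1.le, hy1.2⟩, proj, proj, hJ,
      Finset.sum_filter, ← Finset.sum_add_distrib]
    refine Finset.sum_congr rfl fun j hj => ?_
    rw [Finset.mem_range] at hj
    split_ifs with hc
    · rw [hdual j hc.1 hc.2, add_mul]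
    · rw [bspline_eq_zero_of_mem_element h hi hy hj hc]
      simp
  have hBd : ∀ j ∈ J, ContDiffAt ℝ l (fun y => dualFunctional ξ p j w * bspline ξ p j y) x := by
    intro j hj
    rw [hJ, Finset.mem_filter, Finset.mem_range] at hj
    exact contDiffAt_const.mul ((contDiffAt_bspline
      (offKnots_of_mem_element h hx (by omega) hi.1)).of_le (by exact_mod_cast le_top))
  have hD : iteratedDeriv l (proj ξ p n v) x
      = ∑ j ∈ J, dualFunctional ξ p j w * iteratedDeriv l (bspline ξ p j) x := by
    rw [hEq.iteratedDeriv_of_isOpen isOpen_Ioo l hx, iteratedDeriv_add (ContDiffAt.sum hBd)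
      (contDiff_polynomial_eval q).contDiffAt, iteratedDeriv_fun_sum hBd,
      iteratedDeriv_polynomial_eval, Polynomial.iterate_derivative_eq_zero_of_degree_lt hq]
    simp only [Polynomial.eval_zero, add_zero]
    exact Finset.sum_congr rfl fun j _ => by rw [iteratedDeriv_const_mul_field]
  have hterm : ∀ j ∈ J, |dualFunctional ξ p j w * iteratedDeriv l (bspline ξ p j) x|
      * (ξ (i + 1) - ξ i) ^ (l + 1)
      ≤ C * (2 ^ p * (2 * (p : ℝ) + 1) ^ (p + 1)) * ((b - a) ^ l * ∫ x in Ioo a b, |g x|) := by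
    intro j hj
    rw [hJ, Finset.mem_filter, Finset.mem_range] at hj
    have hlt := h.lt_support hr hr1 hj.1
    have hH : ξ (i + 1) - ξ i ≤ ξ (j + p + 1) - ξ j := by
      have h1 := h.mono j i hj.2.1 (by omega)
      have h2 := h.mono (i + 1) (j + p + 1) (by omega) (by omega)
      linarith
    have hsj := hsub j hj.2.1 hj.2.2
    have b1 : |dualFunctional ξ p j w| * (ξ (i + 1) - ξ i)
        ≤ C * ((b - a) ^ l * ∫ x in Ioo a b, |g x|) := by
      calc |dualFunctional ξ p j w| * (ξ (i + 1) - ξ i)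
          ≤ |dualFunctional ξ p j w| * (ξ (j + p + 1) - ξ j) := by gcongr
        _ ≤ C * ∫ x in Ioo (ξ j) (ξ (j + p + 1)), |w x| :=
            hC ξ j (h.sorted_sub (by omega)) hlt w (hwi.mono_set hsj)
        _ ≤ C * ∫ x in Ioo a b, |w x| :=
            mul_le_mul_of_nonneg_left (setIntegral_mono_set hwi.norm
              (Filter.Eventually.of_forall fun t => abs_nonneg _) hsj.eventuallyLE) hC0
        _ ≤ _ := by
            gcongr
            exact integral_abs_iterPrimitive_le hab.le hg l
    have b2 : |iteratedDeriv l (bspline ξ p j) x| * (ξ (i + 1) - ξ i) ^ l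
        ≤ 2 ^ p * (2 * (p : ℝ) + 1) ^ (p + 1) := by
      refine (abs_iteratedDeriv_bspline_le_of_mem_element h hi hx hj.1 l).trans ?_
      have hp0 : (0 : ℝ) ≤ p := by positivity
      calc (2 : ℝ) ^ p * (2 * (p : ℝ)) ^ l ≤ 2 ^ p * (2 * (p : ℝ) + 1) ^ l := by
            gcongr; linarith
        _ ≤ 2 ^ p * (2 * (p : ℝ) + 1) ^ (p + 1) := by
            gcongr; linarith
    calc |dualFunctional ξ p j w * iteratedDeriv l (bspline ξ p j) x| * (ξ (i + 1) - ξ i) ^ (l + 1)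
        = (|dualFunctional ξ p j w| * (ξ (i + 1) - ξ i))
          * (|iteratedDeriv l (bspline ξ p j) x| * (ξ (i + 1) - ξ i) ^ l) := by
          rw [abs_mul]; ring
      _ ≤ (C * ((b - a) ^ l * ∫ x in Ioo a b, |g x|))
          * (2 ^ p * (2 * (p : ℝ) + 1) ^ (p + 1)) := by
          refine mul_le_mul b1 b2 (by positivity) ?_
          have : 0 ≤ b - a := by linarith
          have : 0 ≤ ∫ x in Ioo a b, |g x| := integral_nonneg fun x => abs_nonneg _
          positivity
      _ = _ := by ring
  have hcard : J.card ≤ (Finset.Icc 0 p).card := by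
    refine Finset.card_le_card_of_injOn (fun j => i - j) ?_ ?_
    · intro j hj
      have hj' := (Finset.mem_filter.1 hj).2
      simp only [Finset.coe_Icc, mem_Icc]
      omega
    · intro j hj k hk hjk
      have hj' := (Finset.mem_filter.1 hj).2
      have hk' := (Finset.mem_filter.1 hk).2
      simp only at hjk
      omega
  have hM : 0 ≤ C * (2 ^ p * (2 * (p : ℝ) + 1) ^ (p + 1))
      * ((b - a) ^ l * ∫ x in Ioo a b, |g x|) := by
    have : 0 ≤ b - a := by linarith
    have : 0 ≤ ∫ x in Ioo a b, |g x| := integral_nonneg fun x => abs_nonneg _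
    positivity
  rw [hD]
  calc |∑ j ∈ J, dualFunctional ξ p j w * iteratedDeriv l (bspline ξ p j) x|
        * (ξ (i + 1) - ξ i) ^ (l + 1)
      ≤ (∑ j ∈ J, |dualFunctional ξ p j w * iteratedDeriv l (bspline ξ p j) x|)
        * (ξ (i + 1) - ξ i) ^ (l + 1) := by
        gcongr; exact Finset.abs_sum_le_sum_abs _ _
    _ ≤ ∑ j ∈ J, C * (2 ^ p * (2 * (p : ℝ) + 1) ^ (p + 1))
        * ((b - a) ^ l * ∫ x in Ioo a b, |g x|) := by
        rw [Finset.sum_mul]; exact Finset.sum_le_sum hterm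
    _ ≤ ∑ j ∈ Finset.Icc 0 p, C * (2 ^ p * (2 * (p : ℝ) + 1) ^ (p + 1))
        * ((b - a) ^ l * ∫ x in Ioo a b, |g x|) := by
        rw [Finset.sum_const, Finset.sum_const, nsmul_eq_mul, nsmul_eq_mul]
        gcongr
    _ = _ := by rw [Finset.sum_mul]; rfl

end UnivariateSpline

namespace UnivariateSpline

variable {p n : ℕ} {ξ : ℕ → ℝ} {r : ℤ}

/-! ### Local stability -/

lemma sub_le_meshSize {k : ℕ} (hk : k < n + p) : ξ (k + 1) - ξ k ≤ meshSize p n ξ :=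
  le_ciSup (f := fun i : Fin (n + p) => ξ (i + 1) - ξ i) (finite_range _).bddAbove ⟨k, hk⟩

lemma sub_le_mul_meshSize (a m : ℕ) (hm : a + m ≤ n + p) :
    ξ (a + m) - ξ a ≤ m * meshSize p n ξ := by
  induction m with
  | zero => simp
  | succ m ih =>
    have h1 := ih (by omega)
    have h2 := sub_le_meshSize (ξ := ξ) (p := p) (n := n) (k := a + m) (by omega)
    push_cast
    rw [← add_assoc]
    linarith

lemma supportExtension_length_le {c : ℝ} (h : IsOpenKnotVector p n ξ)
    (hc : IsRegularMesh c p n ξ) {i : ℕ} (hi : IsElement p n ξ i) :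
    ξ (i + p + 1) - ξ (i - p) ≤ (2 * p + 1) * max c 1 * (ξ (i + 1) - ξ i) := by
  have hpi := hi.le h
  have hin := hi.lt h
  have h1 := sub_le_mul_meshSize (ξ := ξ) (p := p) (n := n) (i - p) (2 * p + 1) (by omega)
  rw [show i - p + (2 * p + 1) = i + p + 1 by omega] at h1
  have hδ : 0 < ξ (i + 1) - ξ i := sub_pos.2 hi.2
  calc ξ (i + p + 1) - ξ (i - p) ≤ (2 * p + 1) * meshSize p n ξ := by exact_mod_cast h1
    _ ≤ (2 * p + 1) * (c * (ξ (i + 1) - ξ i)) := by gcongr; exact hc i hi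
    _ ≤ (2 * p + 1) * (max c 1 * (ξ (i + 1) - ξ i)) := by gcongr; exact le_max_left _ _
    _ = _ := by ring

/-- A pointwise bound by the mean of `g` over a larger interval of comparable length yields a bound
of the `L²`-norms. -/
lemma eLpNorm_le_of_abs_mul_pow_le {a b α β C K : ℝ} {L m : ℕ} {D g : ℝ → ℝ} (hC : 0 ≤ C)
    (hab : a < b) (hle : b - a ≤ β - α) (hK : 1 ≤ K) (hcomp : β - α ≤ K * (b - a)) (hL : L + 1 ≤ m)
    (hg : MemLp g 2 (volume.restrict (Ioo α β)))
    (hD : ∀ x ∈ Ioo a b,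
      |D x| * (b - a) ^ (L + 1) ≤ C * ((β - α) ^ L * ∫ x in Ioo α β, |g x|)) :
    eLpNorm D 2 (volume.restrict (Ioo a b))
      ≤ ENNReal.ofReal (C * K ^ m) * eLpNorm g 2 (volume.restrict (Ioo α β)) := by
  have hh : 0 < b - a := sub_pos.2 hab
  have hT : 0 < β - α := hh.trans_le hle
  have hgi : Integrable g (volume.restrict (Ioo α β)) := hg.integrable one_le_two
  have hG0 : 0 ≤ ∫ x in Ioo α β, |g x| := integral_nonneg fun x => abs_nonneg _
  have hpt : ∀ᵐ x ∂volume.restrict (Ioo a b), ‖D x‖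
      ≤ C * (β - α) ^ L / (b - a) ^ (L + 1) * ∫ x in Ioo α β, |g x| := by
    refine ae_restrict_of_forall_mem measurableSet_Ioo fun x hx => ?_
    rw [Real.norm_eq_abs, div_mul_eq_mul_div, le_div_iff₀ (by positivity), mul_assoc C]
    exact hD x hx
  have h1 := eLpNorm_le_of_ae_bound (p := 2) hpt
  have hGe : ENNReal.ofReal (∫ x in Ioo α β, |g x|)
      ≤ eLpNorm g 2 (volume.restrict (Ioo α β)) * ENNReal.ofReal (β - α) ^ (2⁻¹ : ℝ) := by
    have h2 := eLpNorm_le_eLpNorm_mul_rpow_measure_univ (p := 1) (q := 2)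
      one_le_two hg.aestronglyMeasurable
    rw [eLpNorm_one_eq_lintegral_enorm, ← ofReal_integral_norm_eq_lintegral_enorm hgi,
      Measure.restrict_apply_univ, Real.volume_Ioo] at h2
    norm_num at h2 ⊢
    exact h2
  have hR : C * (β - α) ^ L / (b - a) ^ (L + 1) * (β - α) ≤ C * K ^ m := by
    have h3 : (β - α) / (b - a) ≤ K := (div_le_iff₀ hh).2 hcomp
    calc C * (β - α) ^ L / (b - a) ^ (L + 1) * (β - α)
        = C * ((β - α) / (b - a)) ^ (L + 1) := by rw [div_pow]; ring
      _ ≤ C * K ^ (L + 1) := by gcongr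
      _ ≤ C * K ^ m := by gcongr
  rw [Measure.restrict_apply_univ, Real.volume_Ioo, ENNReal.toReal_ofNat,
    ENNReal.ofReal_mul (by positivity)] at h1
  calc eLpNorm D 2 (volume.restrict (Ioo a b))
      ≤ ENNReal.ofReal (b - a) ^ (2⁻¹ : ℝ)
        * (ENNReal.ofReal (C * (β - α) ^ L / (b - a) ^ (L + 1))
          * ENNReal.ofReal (∫ x in Ioo α β, |g x|)) := h1
    _ ≤ ENNReal.ofReal (β - α) ^ (2⁻¹ : ℝ)
        * (ENNReal.ofReal (C * (β - α) ^ L / (b - a) ^ (L + 1))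
          * (eLpNorm g 2 (volume.restrict (Ioo α β)) * ENNReal.ofReal (β - α) ^ (2⁻¹ : ℝ))) := by
        gcongr
    _ = ENNReal.ofReal (C * (β - α) ^ L / (b - a) ^ (L + 1))
        * (ENNReal.ofReal (β - α) ^ (2⁻¹ : ℝ) * ENNReal.ofReal (β - α) ^ (2⁻¹ : ℝ))
        * eLpNorm g 2 (volume.restrict (Ioo α β)) := by ring
    _ = ENNReal.ofReal (C * (β - α) ^ L / (b - a) ^ (L + 1) * (β - α))
        * eLpNorm g 2 (volume.restrict (Ioo α β)) := by
        rw [← ENNReal.rpow_add_of_nonneg _ _ (by norm_num) (by norm_num),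
          ENNReal.ofReal_mul (by positivity)]
        norm_num
    _ ≤ _ := by gcongr

lemma hasWeakDeriv_zero {Ω : Set ℝ} {v : ℝ → ℝ} (hv : LocallyIntegrableOn v Ω) :
    HasWeakDeriv Ω 0 v v :=
  ⟨hv, hv, fun φ _ _ _ => by simp⟩

lemma MemSobolev.integrableOn {l : ℕ} {v : ℝ → ℝ} (hv : MemSobolev (Ioo 0 1) l v) :
    IntegrableOn v (Ioo 0 1) := by
  obtain ⟨g, hg, -⟩ := hv 0 (Nat.zero_le _)
  exact integrableOn_of_memLp (hv.memLp (Nat.zero_le _) (hasWeakDeriv_zero hg.1))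

/-- Stability of the derivatives of the projection, of which all the stability estimates are
special cases. -/
lemma exists_eLpNorm_iteratedDeriv_proj_le (p : ℕ) (c : ℝ) : ∃ C : ℝ≥0, ∀ (n : ℕ) (ξ : ℕ → ℝ)
    (r : ℤ), IsOpenKnotVector p n ξ → HasRegularity p n ξ r → -1 ≤ r → IsRegularMesh c p n ξ →
    ∀ i, IsElement p n ξ i → ∀ l ≤ p + 1, ∀ v g : ℝ → ℝ, HasWeakDeriv (Ioo 0 1) l v g →
    MemLp g 2 (volume.restrict (Ioo 0 1)) →
    eLpNorm (iteratedDeriv l (proj ξ p n v)) 2 (volume.restrict (element ξ i))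
      ≤ C * eLpNorm g 2 (volume.restrict (supportExtension ξ p i)) := by
  obtain ⟨C, hC0, hC⟩ := exists_abs_iteratedDeriv_proj_le p
  refine ⟨(C * ((2 * p + 1) * max c 1) ^ (p + 2)).toNNReal,
    fun n ξ r h hr hr1 hc i hi l hl v g hv hg => ?_⟩
  have hpi := hi.le h
  have hin := hi.lt h
  have hsub := supportExtension_subset h hi
  have hg' : MemLp g 2 (volume.restrict (supportExtension ξ p i)) :=
    hg.mono_measure (Measure.restrict_mono hsub le_rfl)
  have hK : (1 : ℝ) ≤ (2 * p + 1) * max c 1 := by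
    have : (0 : ℝ) ≤ p := p.cast_nonneg
    nlinarith [le_max_right c 1]
  refine eLpNorm_le_of_abs_mul_pow_le hC0 hi.2 ?_ hK (supportExtension_length_le h hc hi)
    (by omega : l + 1 ≤ p + 2) hg' (hC n ξ r h hr hr1 i hi l hl v g (hv.restrict hsub)
      ((integrableOn_of_memLp hg).mono_set hsub))
  have h1 := h.mono (i - p) i (by omega) (by omega)
  have h2 := h.mono (i + 1) (i + p + 1) (by omega) (by omega)
  linarith

lemma contDiffAt_deriv {f : ℝ → ℝ} {x : ℝ} (hf : ContDiffAt ℝ ∞ f x) :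
    ContDiffAt ℝ ∞ (deriv f) x :=
  (hf.fderiv_right (m := ∞) le_rfl).clm_apply contDiffAt_const

lemma isOpen_element {i : ℕ} : IsOpen (element ξ i) := isOpen_Ioo

lemma isOpen_supportExtension {i : ℕ} : IsOpen (supportExtension ξ p i) := isOpen_Ioo

lemma exists_sobolevSeminorm_proj_le (p : ℕ) (c : ℝ) : ∃ C : ℝ≥0, ∀ (n : ℕ) (ξ : ℕ → ℝ)
    (r : ℤ), IsOpenKnotVector p n ξ → HasRegularity p n ξ r → -1 ≤ r → IsRegularMesh c p n ξ →
    ∀ i, IsElement p n ξ i →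
    (∀ l ≤ p + 1, ∀ v, MemSobolev (Ioo 0 1) l v →
      sobolevSeminorm (element ξ i) l (proj ξ p n v)
        ≤ C * sobolevSeminorm (supportExtension ξ p i) l v) ∧
    (∀ l ≤ p, ∀ v, MemSobolev (Ioo 0 1) l v →
      sobolevSeminorm (element ξ i) l (projC1 ξ p n v)
        ≤ C * sobolevSeminorm (supportExtension ξ p i) l v) ∧
    (∀ l, l + 1 ≤ p → ∀ v, MemSobolev (Ioo 0 1) l v →
      sobolevSeminorm (element ξ i) l (projC2 ξ p n v)
        ≤ C * sobolevSeminorm (supportExtension ξ p i) l v) := by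
  obtain ⟨C, hC⟩ := exists_eLpNorm_iteratedDeriv_proj_le p c
  refine ⟨C, fun n ξ r h hr hr1 hc i hi => ⟨fun l hl v hv => ?_, fun l hl v hv => ?_,
    fun l hl v hv => ?_⟩⟩
  all_goals
    obtain ⟨g, hg, hg2⟩ := hv l le_rfl
    have hvi := hv.integrableOn
    rw [(hg.restrict (supportExtension_subset h hi)).sobolevSeminorm_eq isOpen_supportExtension]
  · rw [(hasWeakDeriv_of_contDiffAt isOpen_element
      (fun x hx => contDiffAt_proj h hi v hx) l).sobolevSeminorm_eq isOpen_element]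
    exact hC n ξ r h hr hr1 hc i hi l hl v g hg hg2
  · rw [projC1, (hasWeakDeriv_of_contDiffAt isOpen_element
      (fun x hx => contDiffAt_deriv (contDiffAt_proj h hi _ hx)) l).sobolevSeminorm_eq isOpen_element,
      ← iteratedDeriv_succ']
    exact hC n ξ r h hr hr1 hc i hi (l + 1) (by omega) _ g
      ((hasWeakDeriv_antideriv hvi).comp hg) hg2
  · rw [projC2, (hasWeakDeriv_of_contDiffAt isOpen_element
      (fun x hx => contDiffAt_deriv (contDiffAt_deriv (contDiffAt_proj h hi _ hx))) l).sobolevSeminorm_eq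
        isOpen_element, ← iteratedDeriv_succ', ← iteratedDeriv_succ']
    exact hC n ξ r h hr hr1 hc i hi (l + 1 + 1) (by omega) _ g
      ((hasWeakDeriv_antideriv (integrableOn_antideriv hvi)).comp
        ((hasWeakDeriv_antideriv hvi).comp hg)) hg2

/-! ### Commutation with the weak derivatives -/

lemma projC1_commute (h : IsOpenKnotVector (p + 1) n ξ) (hr : HasRegularity (p + 1) n ξ r)
    (hr0 : 0 ≤ r) {v v' : ℝ → ℝ} (hv : MemSobolev (Ioo 0 1) 1 v)
    (hv' : HasWeakDeriv (Ioo 0 1) 1 v v') :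
    projC1 ξ (p + 1) n v' =ᵐ[volume.restrict (Ioo 0 1)] deriv (proj ξ (p + 1) n v) ∧
      HasWeakDeriv (Ioo 0 1) 1 (proj ξ (p + 1) n v) (projC1 ξ (p + 1) n v') := by
  have hpt := fun x (hx : x ∈ Ioo (0 : ℝ) 1) =>
    projC1_eq_deriv_proj h hr hr0 hv' (integrableOn_of_memLp (hv.memLp le_rfl hv')) hx
  exact ⟨ae_restrict_of_forall_mem measurableSet_Ioo hpt, hasWeakDeriv_proj h hr hr0 hpt⟩

lemma projC2_commute (h : IsOpenKnotVector (p + 2) n ξ) (hr : HasRegularity (p + 2) n ξ r)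
    (hr1 : 1 ≤ r) {v v' v'' : ℝ → ℝ} (hv : MemSobolev (Ioo 0 1) 2 v)
    (hv' : HasWeakDeriv (Ioo 0 1) 1 v v') (hv'' : HasWeakDeriv (Ioo 0 1) 2 v v'') :
    projC2 ξ (p + 2) n v'' =ᵐ[volume.restrict (Ioo 0 1)] deriv (deriv (proj ξ (p + 2) n v)) ∧
      projC2 ξ (p + 2) n v'' =ᵐ[volume.restrict (Ioo 0 1)] deriv (projC1 ξ (p + 2) n v') ∧
      HasWeakDeriv (Ioo 0 1) 2 (proj ξ (p + 2) n v) (projC2 ξ (p + 2) n v'') ∧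
      HasWeakDeriv (Ioo 0 1) 1 (projC1 ξ (p + 2) n v') (projC2 ξ (p + 2) n v'') := by
  have hr0 : 0 ≤ r := by omega
  have h1 : EqOn (projC1 ξ (p + 2) n v') (deriv (proj ξ (p + 2) n v)) (Ioo 0 1) := fun x hx =>
    projC1_eq_deriv_proj h hr hr0 hv' (integrableOn_of_memLp (hv.memLp one_le_two hv')) hx
  have h2 : EqOn (projC2 ξ (p + 2) n v'') (deriv (deriv (proj ξ (p + 2) n v))) (Ioo 0 1) :=
    fun x hx => projC2_eq_deriv_deriv_proj h hr hr1 hv''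
      (integrableOn_of_memLp (hv.memLp le_rfl hv'')) hx
  have h3 := hasWeakDeriv_deriv_proj h hr hr1 h1 h2
  exact ⟨ae_restrict_of_forall_mem measurableSet_Ioo h2,
    ae_restrict_of_forall_mem measurableSet_Ioo fun x hx =>
      (h2 hx).trans (h1.deriv isOpen_Ioo hx).symm,
    (hasWeakDeriv_proj h hr hr0 h1).comp h3, h3⟩

end UnivariateSpline

open UnivariateSpline in
theorem mainTheorem4 (p : ℕ) (r : ℤ) (hr : -1 ≤ r) (hrp : r ≤ (p : ℤ) - 1) :
    -- spline preservation and commutation, for every knot vector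
    (∀ (n : ℕ) (ξ : ℕ → ℝ), IsOpenKnotVector p n ξ → HasRegularity p n ξ r →
      ((∀ v, MemLp v 2 (volume.restrict (Ioo 0 1)) → proj ξ p n v ∈ splineSpace ξ p n) ∧
        (∀ s ∈ splineSpace ξ p n, proj ξ p n s = s)) ∧
      (0 ≤ r →
        (∀ v, MemLp v 2 (volume.restrict (Ioo 0 1)) → ∃ s ∈ reducedSplineSpace 1 ξ p n,
          projC1 ξ p n v =ᵐ[volume.restrict (Ioo 0 1)] s) ∧
        (∀ s ∈ reducedSplineSpace 1 ξ p n,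
          projC1 ξ p n s =ᵐ[volume.restrict (Ioo 0 1)] s) ∧
        (∀ v v' : ℝ → ℝ, MemSobolev (Ioo 0 1) 1 v → HasWeakDeriv (Ioo 0 1) 1 v v' →
          projC1 ξ p n v' =ᵐ[volume.restrict (Ioo 0 1)] deriv (proj ξ p n v) ∧
          HasWeakDeriv (Ioo 0 1) 1 (proj ξ p n v) (projC1 ξ p n v'))) ∧
      (1 ≤ r →
        (∀ v, MemLp v 2 (volume.restrict (Ioo 0 1)) → ∃ s ∈ reducedSplineSpace 2 ξ p n,
          projC2 ξ p n v =ᵐ[volume.restrict (Ioo 0 1)] s) ∧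
        (∀ s ∈ reducedSplineSpace 2 ξ p n,
          projC2 ξ p n s =ᵐ[volume.restrict (Ioo 0 1)] s) ∧
        (∀ v v' v'' : ℝ → ℝ, MemSobolev (Ioo 0 1) 2 v → HasWeakDeriv (Ioo 0 1) 1 v v' →
          HasWeakDeriv (Ioo 0 1) 2 v v'' →
          projC2 ξ p n v'' =ᵐ[volume.restrict (Ioo 0 1)] deriv (deriv (proj ξ p n v)) ∧
          projC2 ξ p n v'' =ᵐ[volume.restrict (Ioo 0 1)] deriv (projC1 ξ p n v') ∧
          HasWeakDeriv (Ioo 0 1) 2 (proj ξ p n v) (projC2 ξ p n v'') ∧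
          HasWeakDeriv (Ioo 0 1) 1 (projC1 ξ p n v') (projC2 ξ p n v'')))) ∧
    -- local stability, with a constant that does not depend on the mesh
    (∀ c : ℝ, ∃ C : ℝ≥0, ∀ (n : ℕ) (ξ : ℕ → ℝ), IsOpenKnotVector p n ξ → HasRegularity p n ξ r →
      IsRegularMesh c p n ξ → ∀ i, IsElement p n ξ i →
      (∀ l ≤ p + 1, ∀ v, MemSobolev (Ioo 0 1) l v →
        sobolevSeminorm (element ξ i) l (proj ξ p n v)
          ≤ C * sobolevSeminorm (supportExtension ξ p i) l v) ∧
      (0 ≤ r → ∀ l ≤ p, ∀ v, MemSobolev (Ioo 0 1) l v →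
        sobolevSeminorm (element ξ i) l (projC1 ξ p n v)
          ≤ C * sobolevSeminorm (supportExtension ξ p i) l v) ∧
      (1 ≤ r → ∀ l ≤ p - 1, ∀ v, MemSobolev (Ioo 0 1) l v →
        sobolevSeminorm (element ξ i) l (projC2 ξ p n v)
          ≤ C * sobolevSeminorm (supportExtension ξ p i) l v)) := by
  refine ⟨fun n ξ h hreg => ⟨⟨fun v _ => proj_mem_splineSpace v, fun s hs =>
    proj_eq_self h hreg hr hs⟩, fun hr0 => ?_, fun hr1 => ?_⟩, fun c => ?_⟩
  · obtain ⟨q, rfl⟩ : ∃ q, p = q + 1 := ⟨p - 1, by omega⟩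
    exact ⟨fun v _ => exists_projC1_ae_eq h v, fun s hs => projC1_eq_self h hreg hr0 hs,
      fun v v' hv hv' => projC1_commute h hreg hr0 hv hv'⟩
  · obtain ⟨q, rfl⟩ : ∃ q, p = q + 2 := ⟨p - 2, by omega⟩
    exact ⟨fun v _ => exists_projC2_ae_eq h hreg hr1 v, fun s hs => projC2_eq_self h hreg hr1 hs,
      fun v v' v'' hv hv' hv'' => projC2_commute h hreg hr1 hv hv' hv''⟩
  · obtain ⟨C, hC⟩ := exists_sobolevSeminorm_proj_le p c
    refine ⟨C, fun n ξ h hreg hc i hi => ?_⟩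
    obtain ⟨h0, h1, h2⟩ := hC n ξ r h hreg hr hc i hi
    exact ⟨h0, fun _ => h1, fun hr1 l hl => h2 l (by omega)⟩
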